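/- **Programs.** Terms are variables, integers and constants. A program is a finite set of normal rules $h\leftarrow b_1,\dots,b_n,\mathtt{not}\ c_1,\dots,\mathtt{not}\ c_m$, hard constraints (empty head), choice rules (head $l\{h_1,\dots,h_k\}u$) and weak constraints $:\sim b_1,\dots,b_n,\mathtt{not}\ c_1,\dots,\mathtt{not}\ c_m.[w@l,t_1,\dots,t_o]$. A rule is safe if each of its variables occurs in a positive body literal. $AS(P)$ is the set of answer sets of $P$: the $I\subseteq HB_P$ that are the least model of the reduct $P^I$, which is obtained from the grounding of $P$ by deleting the rules whose body contains $\mathtt{not}\ c$ with $c\in I$, deleting the remaining negative literals, replacing the heads of hard constraints and of choice rules with $\neg(l\le|I\cap\{h_1,\dots,h_k\}|\le u)$ by $\bot$, and replacing every other choice rule by the rules with head $h_i\in I$ and the same body. $P^l_A$ is the sum of $w$ over the set of tuples $(w,l,t_1,\dots,t_o)$ of ground weak constraints of $P$ whose body is true in $A$, and $A_1\succ_P A_2$ means that for some $l$, $P^l_{A_1}<P^l_{A_2}$ and $P^m_{A_1}=P^m_{A_2}$ for all $m>l$. $AS^*(P)$ is the set of those $A\in AS(P)$ for which no $A'\in AS(P)$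 has $A'\succ_P A$. **Tasks.** An $ILP_{LOAS}$ task is $T=\langle B,S_M,E^+,E^-,O^b,O^c\rangle$ with $B$ a program of safe rules, $S_M$ a finite set of safe rules (the search space, e.g. given by a mode bias), $E^+,E^-$ finite sets of partial interpretations (pairs $e=\langle e^{inc},e^{exc}\rangle$ of finite sets of ground atoms; $A$ extends $e$ iff $e^{inc}\subseteq A$ and $e^{exc}\cap A=\emptyset$), and $O^b,O^c$ finite sets of pairs of elements of $E^+$. A hypothesis $H\subseteq S_M$ is an inductive solution of $T$ iff, with $H'$ the set of its rules that are not weak constraints, (1) every $e\in E^+$ and no $e\in E^-$ is extended by an element of $AS(B\cup H')$; (2) for all $\langle e_1,e_2\rangle\in O^b$ there are $A_1,A_2\in AS(B\cup H)$ extending $e_1,e_2$ with $A_1\succ_{B\cup H}A_2$; (3) for all $\langle e_1,e_2\rangle\in O^c$ and all $A_1,A_2\in AS(B\cup H)$ extending $e_1,e_2$, $A_1\succ_{B\cup H}A_2$. The length $|H|$ is the sum of the numbers of literals $|R|$ of its rules $R$, where a weak constraint counts with the literals of its body and a head $l\{h_1,\dots,h_k\}u$ counts $\sum_{i=l}^{u}k\binom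 ki$. A solution is optimal if no solution is shorter. **Meta programs.** These also use function symbols, comparisons, and cardinality and $\#sum$ aggregates in bodies; atoms of $T$ occur in them as terms, and every object mentioned has its own identifier. $cover(e,t)$ is: $cov(t)\leftarrow in\_as(a,t)$ for all $a\in e^{inc}$, $\mathtt{not}\ in\_as(a,t)$ for all $a\in e^{exc}$; $\ \leftarrow\mathtt{not}\ cov(t)$. $dominates(t_1,t_2)$ is: $dom\_lv(t_1,t_2,L)\leftarrow lv(L),\#sum\{w(W,L,A,t_1)=W,w(W,L,A,t_2)=-W\}<0$; $non\_dom\_lv(t_1,t_2,L)\leftarrow lv(L),\#sum\{w(W,L,A,t_2)=W,w(W,L,A,t_1)=-W\}<0$; $non\_bef(t_1,t_2,L)\leftarrow lv(L),lv(L_2),L<L_2,non\_dom\_lv(t_1,t_2,L_2)$; $dom(t_1,t_2)\leftarrow dom\_lv(t_1,t_2,L),\mathtt{not}\ non\_bef(t_1,t_2,L)$. $meta_{weak}(W,p,q)$ is the rule $w(w,l,args(t_1,\dots,t_o),X)\leftarrow q(X),p(b_i,X)\ (\text{all }i),\mathtt{not}\ p(c_j,X)\ (\text{all }j)$. $T_{meta}$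 consists of: the rules of $B$ and of $S_M$ other than weak constraints, with every atom $a$ replaced by $in\_as(a,X)$, with $as(X)$ added to the body, and for $R\in S_M$ also $in\_h(R_{id})$; $meta_{weak}(W,in\_as,as)$ for the weak constraints $W$ of $B$ and of $S_M$, in the latter case with $in\_h(W_{id})$ added to the body; $:\sim in\_h(R_{id}).[2|R|@0,R_{id}]$ for $R\in S_M$; the unbounded choice $\{in\_h(R_{id}):R\in S_M\}$; $as(e_{id})$ and $cover(e,e_{id})$ for $e\in E^+$; $as(n)$ and $v\_i\leftarrow in\_as(a,n)$ $(a\in e^{inc})$, $\mathtt{not}\ in\_as(a,n)$ $(a\in e^{exc})$ for $e\in E^-$; $as(o_{id1})$, $as(o_{id2})$, $cover(e_1,o_{id1})$, $cover(e_2,o_{id2})$, $dominates(o_{id1},o_{id2})$ and $\leftarrow\mathtt{not}\ dom(o_{id1},o_{id2})$ for $o=\langle e_1,e_2\rangle\in O^b$; $dominates(e_{1,id},e_{2,id})$ and $v\_p(e_{1,id},e_{2,id})\leftarrow\mathtt{not}\ dom(e_{1,id},e_{2,id})$ for $\langle e_1,e_2\rangle\in O^c$; $v\_p\leftarrow v\_p(T_1,T_2)$;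 $violating\leftarrow v\_i$; $violating\leftarrow v\_p$; $:\sim\mathtt{not}\ violating.[1@0]$; and $lv(l)$ for the levels $l$ of the ground weak constraints of $B\cup S_M$. For a list $VR$ of interpretations and pairs of interpretations, $VR_{meta}(T)$ consists of: $vs(I_{id})$, $in\_vs(a,I_{id})$ $(a\in I)$ and $\leftarrow\mathtt{not}\ nas(I_{id})$ for each interpretation $I$ in $VR$; for each pair $p=\langle I_1,I_2\rangle$ in $VR$, $vs(p_{idk})$ and $in\_vs(a,p_{idk})$ $(a\in I_k)$ for $k=1,2$, $dominates(p_{id1},p_{id2})$ and $\leftarrow\mathtt{not}\ nas(p_{id1}),\mathtt{not}\ nas(p_{id2}),\mathtt{not}\ dom(p_{id1},p_{id2})$; $nas(X)\leftarrow in\_vs(Y,X),\mathtt{not}\ mmr(Y,X)$ and $nas(X)\leftarrow mmr(Y,X),\mathtt{not}\ in\_vs(Y,X)$; the facts $lv(l)$ as above; and, for every rule $R$ of $B\cup S_M$, the following rules, with $in\_h(R_{id})$ added to the bodies if $R$ is taken from $S_M$: for a weak constraint, $meta_{weak}(R,in\_vs,vs)$; otherwise, with $\beta$ the body $vs(X)$,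 $mmr(b_i,X)$ (all $i$), $\mathtt{not}\ in\_vs(c_j,X)$ (all $j$): $mmr(h,X)\leftarrow\beta$ for a normal rule; $mmr(\bot,X)\leftarrow\beta$ for a hard constraint; and for a choice rule, with $\gamma=\{in\_vs(h_1,X),\dots,in\_vs(h_k,X)\}$, the rules $mmr(h_i,X)\leftarrow\beta,\,l\,\gamma\,u,\,in\_vs(h_i,X)$ for each $i$, $mmr(\bot,X)\leftarrow\beta,\,(u+1)\,\gamma$ and $mmr(\bot,X)\leftarrow\beta,\,\gamma\,(l-1)$. **Algorithm ILASP2.** $solve(P)$ returns $\mathtt{nil}$ if $AS(P)=\emptyset$, and otherwise some $A\in AS^*(P)$ together with its optimality $P^0_A$. Start with $VR=[\,]$ and $solution=solve(T_{meta}\cup VR_{meta}(T))$. While $solution$ is not $\mathtt{nil}$ and its optimality is even, let $A$ be its answer set; if $v\_i\in A$, add $\{a: in\_as(a,n)\in A\}$ to $VR$; otherwise, if $v\_p(t_1,t_2)\in A$ for some $t_1,t_2$, add the pair $\langle\{a: in\_as(a,t_1)\in A\},\{a: in\_as(a,t_2)\in A\}\rangle$ for some such $t_1,t_2$; then set $solution=solve(T_{meta}\cup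 VR_{meta}(T))$ for the new $VR$. On leaving the loop, return $\{\{R\in S_M: in\_h(R_{id})\in A\}: A\in AS^*(T_{meta}\cup VR_{meta}(T))\}$. **Theorem.** Let $T$ be an $ILP_{LOAS}$ task such that $E^+\neq\emptyset$ if $E^-\neq\emptyset$. If $ILASP2(T)$ terminates (for whatever choices are made by $solve$ and of the pairs $t_1,t_2$), then it returns exactly the set of optimal inductive solutions of $T$. -/

import Mathlib

/-! ## Answer set programs: syntax -/

namespace ASP

universe u v w u' v'

/-- Terms over function symbols `F` (constants are applications to `[]`), integers, and variables
`V`. -/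
inductive Term (F : Type u) (V : Type v) : Type (max u v)
  | var (x : V) : Term F V
  | int (z : ℤ) : Term F V
  | app (f : F) (ts : List (Term F V)) : Term F V

namespace Term

variable {F : Type u} {V : Type v} {F' : Type u'} {V' : Type v'}

/-- Rename function symbols by `φ` and simultaneously replace variables by terms. -/
def hom (φ : F → F') (σ : V → Term F' V') : Term F V → Term F' V'
  | var x => σ x
  | int z => int z
  | app f ts => app (φ f) (ts.map (hom φ σ))

/-- Substitution of terms for variables. -/
def subst (σ : V → Term F V) (t : Term F V) : Term F V := hom id σ t

/-- `Subterm s t`: the term `s` occurs in `t` (possibly `s = t`). -/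
inductive Subterm : Term F V → Term F V → Prop
  | refl (t : Term F V) : Subterm t t
  | app (s t : Term F V) (f : F) (ts : List (Term F V)) :
      t ∈ ts → Subterm s t → Subterm s (.app f ts)

/-- The variables of a term. -/
def vars (t : Term F V) : Set V := {x | Subterm (.var x) t}

/-- A term is function-free if it is a variable, an integer or a constant. -/
def FunctionFree (t : Term F V) : Prop :=
  (∃ x, t = .var x) ∨ (∃ z, t = .int z) ∨ ∃ c, t = .app c []

/-- A constant: an integer or a function symbol without arguments. -/
def IsConst (t : Term F V) : Prop := (∃ z, t = .int z) ∨ ∃ c, t = .app c []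

end Term

/-- Atoms `p(t₁, …, tₙ)`. -/
structure Atom (F : Type u) (V : Type v) (P : Type w) : Type (max u v w) where
  pred : P
  args : List (Term F V)

namespace Atom

variable {F : Type u} {V : Type v} {P : Type w}

def subst (σ : V → Term F V) (a : Atom F V P) : Atom F V P := ⟨a.pred, a.args.map (Term.subst σ)⟩

def vars (a : Atom F V P) : Set V := {x | ∃ t ∈ a.args, x ∈ t.vars}

def IsGround (a : Atom F V P) : Prop := a.vars = ∅

end Atom

/-- An element `a = c * t` of a `#sum` aggregate: the atom `a` contributes `c * t`. -/
structure SumElem (F : Type u) (V : Type v) (P : Type w) : Type (max u v w) where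
  atom : Atom F V P
  coeff : ℤ
  weight : Term F V

/-- The body elements other than literals:
* `lt s t` is the comparison `s < t` of integers;
* `card lo as hi` is the cardinality aggregate `lo {as} hi`, either bound may be missing;
* `sumLt locals es b` is the aggregate `#sum{es} < b`, whose local variables are `locals`. -/
inductive Guard (F : Type u) (V : Type v) (P : Type w) : Type (max u v w)
  | lt (s t : Term F V) : Guard F V P
  | card (lo : Option ℤ) (as : List (Atom F V P)) (hi : Option ℤ) : Guard F V P
  | sumLt (locals : Set V) (es : List (SumElem F V P)) (b : ℤ) : Guard F V P

namespace Guard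

variable {F : Type u} {V : Type v} {P : Type w}

open Classical in
/-- Substitution for the global variables of a guard. -/
noncomputable def subst (σ : V → Term F V) : Guard F V P → Guard F V P
  | lt s t => lt (s.subst σ) (t.subst σ)
  | card lo as hi => card lo (as.map (Atom.subst σ)) hi
  | sumLt locals es b =>
      let τ : V → Term F V := fun x => if x ∈ locals then .var x else σ x
      sumLt locals (es.map fun e => ⟨e.atom.subst τ, e.coeff, e.weight.subst τ⟩) b

/-- The terms that occur (as arguments of atoms, as weights or in comparisons) in a guard. -/
def terms : Guard F V P → Set (Term F V)
  | lt s t => {s, t}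
  | card _ as _ => {t | ∃ a ∈ as, t ∈ a.args}
  | sumLt _ es _ => {t | ∃ e ∈ es, t ∈ e.atom.args ∨ t = e.weight}

def atoms : Guard F V P → Set (Atom F V P)
  | lt _ _ => ∅
  | card _ as _ => {a | a ∈ as}
  | sumLt _ es _ => {a | ∃ e ∈ es, a = e.atom}

/-- The global variables of a guard. -/
def vars : Guard F V P → Set V
  | sumLt locals es b => {x | x ∉ locals ∧ ∃ t ∈ (sumLt locals es b).terms, x ∈ t.vars}
  | g => {x | ∃ t ∈ g.terms, x ∈ t.vars}

end Guard

/-- Heads: an atom, the empty head of a hard constraint, or an aggregate `l {h₁, …, hₖ} u`. -/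
inductive Head (F : Type u) (V : Type v) (P : Type w) : Type (max u v w)
  | atom (a : Atom F V P) : Head F V P
  | bot : Head F V P
  | choice (l : ℤ) (hs : List (Atom F V P)) (u : ℤ) : Head F V P

namespace Head

variable {F : Type u} {V : Type v} {P : Type w}

def subst (σ : V → Term F V) : Head F V P → Head F V P
  | atom a => atom (a.subst σ)
  | bot => bot
  | choice l hs u => choice l (hs.map (Atom.subst σ)) u

/-- The atoms of a head. -/
def atoms : Head F V P → List (Atom F V P)
  | atom a => [a]
  | bot => []
  | choice _ hs _ => hs

/-- The number of literals in the head, where `l {h₁, …, hₖ} u` is first converted to the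
disjunction, over all subsets of `{h₁, …, hₖ}` with between `l` and `u` elements, of conjunctions of
`k` literals. -/
def length : Head F V P → ℕ
  | atom _ => 1
  | bot => 0
  | choice l hs u =>
      ∑ i ∈ (Finset.range (hs.length + 1)).filter (fun i : ℕ => l ≤ (i : ℤ) ∧ (i : ℤ) ≤ u),
        hs.length.choose i * hs.length

end Head

/-- Bodies: positive literals, atoms under `not`, and guards. -/
structure Body (F : Type u) (V : Type v) (P : Type w) : Type (max u v w) where
  pos : List (Atom F V P)
  neg : List (Atom F V P)
  guards : List (Guard F V P)

namespace Body

variable {F : Type u} {V : Type v} {P : Type w}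

noncomputable def subst (σ : V → Term F V) (b : Body F V P) : Body F V P :=
  ⟨b.pos.map (Atom.subst σ), b.neg.map (Atom.subst σ), b.guards.map (Guard.subst σ)⟩

def atoms (b : Body F V P) : Set (Atom F V P) :=
  {a | a ∈ b.pos ∨ a ∈ b.neg ∨ ∃ g ∈ b.guards, a ∈ g.atoms}

def terms (b : Body F V P) : Set (Term F V) :=
  {t | (∃ a, (a ∈ b.pos ∨ a ∈ b.neg) ∧ t ∈ a.args) ∨ ∃ g ∈ b.guards, t ∈ g.terms}

def vars (b : Body F V P) : Set V :=
  {x | (∃ a, (a ∈ b.pos ∨ a ∈ b.neg) ∧ x ∈ a.vars) ∨ ∃ g ∈ b.guards, x ∈ g.vars}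

/-- The number of literals in a body. -/
def length (b : Body F V P) : ℕ := b.pos.length + b.neg.length

end Body

/-- Rules: `strong h b` is the normal rule, hard constraint or choice rule `h ← b`, and
`weak b w l ts` is the weak constraint `:~ b.[w@l, ts]`. -/
inductive Rule (F : Type u) (V : Type v) (P : Type w) : Type (max u v w)
  | strong (h : Head F V P) (b : Body F V P) : Rule F V P
  | weak (b : Body F V P) (wt lev : Term F V) (ts : List (Term F V)) : Rule F V P

namespace Rule

variable {F : Type u} {V : Type v} {P : Type w}

noncomputable def subst (σ : V → Term F V) : Rule F V P → Rule F V P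
  | strong h b => strong (h.subst σ) (b.subst σ)
  | weak b wt lev ts => weak (b.subst σ) (wt.subst σ) (lev.subst σ) (ts.map (Term.subst σ))

def IsWeak : Rule F V P → Prop
  | strong _ _ => False
  | weak _ _ _ _ => True

def body : Rule F V P → Body F V P
  | strong _ b => b
  | weak b _ _ _ => b

def atoms : Rule F V P → Set (Atom F V P)
  | strong h b => {a | a ∈ h.atoms} ∪ b.atoms
  | weak b _ _ _ => b.atoms

/-- The terms that occur in a rule, as arguments of atoms or otherwise. -/
def terms : Rule F V P → Set (Term F V)
  | strong h b => {t | ∃ a ∈ h.atoms, t ∈ a.args} ∪ b.terms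
  | weak b wt lev ts => b.terms ∪ {wt, lev} ∪ {t | t ∈ ts}

/-- The (global) variables of a rule. -/
def vars : Rule F V P → Set V
  | strong h b => {x | ∃ a ∈ h.atoms, x ∈ a.vars} ∪ b.vars
  | weak b wt lev ts => b.vars ∪ wt.vars ∪ lev.vars ∪ {x | ∃ t ∈ ts, x ∈ t.vars}

/-- Every variable occurs in a positive body literal. -/
def IsSafe (r : Rule F V P) : Prop := ∀ x ∈ r.vars, ∃ a ∈ r.body.pos, x ∈ a.vars

/-- The rules of the basic language: normal rules, hard constraints, choice rules and weak
constraints whose bodies consist of literals, over variables and constants. -/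
def IsBasic (r : Rule F V P) : Prop := r.body.guards = [] ∧ ∀ t ∈ r.terms, t.FunctionFree

/-- The number of literals in a rule; a weak constraint counts with the literals of its body. -/
def length : Rule F V P → ℕ
  | strong h b => h.length + b.length
  | weak b _ _ _ => b.length

end Rule

/-! ## Answer set programs: semantics -/

section Semantics

variable {F : Type u} {V : Type v} {P : Type w}

/-- The Herbrand universe of a program: the ground terms built from the integers, constants and
function symbols that occur in it. -/
inductive HerbrandUniverse (Q : Set (Rule F V P)) : Term F V → Prop
  | int (z : ℤ) (r : Rule F V P) (t : Term F V) :
      r ∈ Q → t ∈ r.terms → Term.Subterm (.int z) t → HerbrandUniverse Q (.int z)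
  | app (f : F) (ss ts : List (Term F V)) (r : Rule F V P) (t : Term F V) :
      r ∈ Q → t ∈ r.terms → Term.Subterm (.app f ss) t → ss.length = ts.length →
      (∀ s ∈ ts, HerbrandUniverse Q s) → HerbrandUniverse Q (.app f ts)

/-- The Herbrand base: the ground atoms formed from predicates (with their arities) and ground
terms of the program. -/
def herbrandBase (Q : Set (Rule F V P)) : Set (Atom F V P) :=
  {a | (∀ t ∈ a.args, HerbrandUniverse Q t) ∧
    ∃ r ∈ Q, ∃ b ∈ r.atoms, b.pred = a.pred ∧ b.args.length = a.args.length}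

/-- The grounding of a program. -/
def grounding (Q : Set (Rule F V P)) : Set (Rule F V P) :=
  {g | ∃ r ∈ Q, ∃ σ : V → Term F V, (∀ x ∈ r.vars, HerbrandUniverse Q (σ x)) ∧ g = r.subst σ}

/-- The number of elements of `I ∩ {as}`. -/
noncomputable def count (I : Set (Atom F V P)) (as : List (Atom F V P)) : ℤ :=
  (Set.ncard {a | a ∈ as ∧ a ∈ I} : ℤ)

/-- The contribution of an element of a `#sum` aggregate: the sum over all ground instances of
its atom that belong to `I`, of the corresponding instance of the weight (instances with a
non-integer weight are ignored). -/
noncomputable def SumElem.value (I : Set (Atom F V P)) (e : SumElem F V P) : ℤ :=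
  e.coeff * ∑ᶠ p ∈ {p : Atom F V P × ℤ | p.1 ∈ I ∧
    ∃ θ : V → Term F V, e.atom.subst θ = p.1 ∧ e.weight.subst θ = .int p.2}, p.2

/-- Truth of a ground guard in an interpretation. -/
def Guard.Holds (I : Set (Atom F V P)) : Guard F V P → Prop
  | .lt s t => ∃ a b : ℤ, s = .int a ∧ t = .int b ∧ a < b
  | .card lo as hi => (∀ l ∈ lo, l ≤ count I as) ∧ ∀ u ∈ hi, count I as ≤ u
  | .sumLt _ es b => (es.map (SumElem.value I)).sum < b

/-- Truth of a ground body in an interpretation. -/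
def Body.Holds (I : Set (Atom F V P)) (b : Body F V P) : Prop :=
  (∀ a ∈ b.pos, a ∈ I) ∧ (∀ a ∈ b.neg, a ∉ I) ∧ ∀ g ∈ b.guards, g.Holds I

/-- The heads that replace a given head in the reduct with respect to `I`; `none` is `⊥`. -/
def Head.reduct (I : Set (Atom F V P)) : Head F V P → Set (Option (Atom F V P))
  | .atom a => {some a}
  | .bot => {none}
  | .choice l hs u =>
      {h | (l ≤ count I hs ∧ count I hs ≤ u ∧ ∃ a ∈ hs, a ∈ I ∧ h = some a) ∨
        (¬ (l ≤ count I hs ∧ count I hs ≤ u) ∧ h = none)}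

/-- The reduct of a program: a set of positive rules, with head `none` for `⊥`. Guards, like
negative literals, are evaluated in `I` (for programs in which no predicate depends on itself
through a guard, all usual semantics of aggregates agree with this one). -/
def reduct (Q : Set (Rule F V P)) (I : Set (Atom F V P)) :
    Set (Option (Atom F V P) × List (Atom F V P)) :=
  {d | ∃ h b, Rule.strong h b ∈ grounding Q ∧ (∀ a ∈ b.neg, a ∉ I) ∧ (∀ g ∈ b.guards, g.Holds I) ∧
    d.1 ∈ h.reduct I ∧ d.2 = b.pos}

/-- Models of a set of positive rules. -/
def IsModel (D : Set (Option (Atom F V P) × List (Atom F V P))) (M : Set (Atom F V P)) : Prop :=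
  ∀ d ∈ D, (∀ a ∈ d.2, a ∈ M) → ∃ a ∈ d.1, a ∈ M

/-- The answer sets of a program. -/
def answerSets (Q : Set (Rule F V P)) : Set (Set (Atom F V P)) :=
  {I | I ⊆ herbrandBase Q ∧ IsLeast {M | IsModel (reduct Q I) M} I}

/-- The tuples `(w, l, t₁, …, tₒ)` of the ground weak constraints whose body is true in `A`. -/
def weakTuples (Q : Set (Rule F V P)) (A : Set (Atom F V P)) : Set (ℤ × ℤ × List (Term F V)) :=
  {p | ∃ b, Rule.weak b (.int p.1) (.int p.2.1) p.2.2 ∈ grounding Q ∧ b.Holds A}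

/-- The sum of the weights at level `l`. -/
noncomputable def levelSum (Q : Set (Rule F V P)) (A : Set (Atom F V P)) (l : ℤ) : ℤ :=
  ∑ᶠ p ∈ {p ∈ weakTuples Q A | p.2.1 = l}, p.1

/-- `A₁` dominates `A₂` with respect to the weak constraints of `Q`. -/
def Dominates (Q : Set (Rule F V P)) (A₁ A₂ : Set (Atom F V P)) : Prop :=
  ∃ l, levelSum Q A₁ l < levelSum Q A₂ l ∧ ∀ m, l < m → levelSum Q A₁ m = levelSum Q A₂ m

/-- The optimal answer sets of a program. -/
def optimalAnswerSets (Q : Set (Rule F V P)) : Set (Set (Atom F V P)) :=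
  {A | A ∈ answerSets Q ∧ ∀ A' ∈ answerSets Q, ¬ Dominates Q A' A}

/-- The levels of the ground weak constraints of a program. -/
def levels (Q : Set (Rule F V P)) : Set ℤ :=
  {l | ∃ b wt ts, Rule.weak b wt (.int l) ts ∈ grounding Q}

end Semantics

end ASP

/-! ## Learning from ordered answer sets -/

namespace LOAS

open ASP

universe u v

/-- Atoms and rules of learning tasks: constants `C`, predicates `P`, variables `ℕ`. -/
abbrev OAtom (C : Type u) (P : Type v) := Atom C ℕ P

abbrev ORule (C : Type u) (P : Type v) := Rule C ℕ P

/-- Partial interpretations: inclusions and exclusions. -/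
structure PartialInterp (C : Type u) (P : Type v) : Type (max u v) where
  inc : Finset (OAtom C P)
  exc : Finset (OAtom C P)

namespace PartialInterp

variable {C : Type u} {P : Type v}

/-- The partial interpretation consists of ground atoms. -/
def IsGround (e : PartialInterp C P) : Prop :=
  (∀ a ∈ e.inc, a.IsGround) ∧ ∀ a ∈ e.exc, a.IsGround

end PartialInterp

section

variable {C : Type u} {P : Type v}

/-- `A` extends the partial interpretation `e`. -/
def Extends (A : Set (OAtom C P)) (e : PartialInterp C P) : Prop :=
  (∀ a ∈ e.inc, a ∈ A) ∧ ∀ a ∈ e.exc, a ∉ A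

def BravelyRespects (Q : Set (ORule C P)) (o : PartialInterp C P × PartialInterp C P) : Prop :=
  ∃ A₁ ∈ answerSets Q, ∃ A₂ ∈ answerSets Q,
    Extends A₁ o.1 ∧ Extends A₂ o.2 ∧ Dominates Q A₁ A₂

def CautiouslyRespects (Q : Set (ORule C P)) (o : PartialInterp C P × PartialInterp C P) : Prop :=
  ∀ A₁ ∈ answerSets Q, ∀ A₂ ∈ answerSets Q,
    Extends A₁ o.1 → Extends A₂ o.2 → Dominates Q A₁ A₂

/-- The rules of a program that are not weak constraints. -/
def nonWeak (Q : Set (ORule C P)) : Set (ORule C P) := {r ∈ Q | ¬ r.IsWeak}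

end

/-- A task of learning from ordered answer sets. The search space may be any finite set of safe
rules; see `Task.ofModeBias` for search spaces given by a mode bias. -/
structure Task (C : Type u) (P : Type v) : Type (max u v) where
  background : Finset (ORule C P)
  space : Finset (ORule C P)
  pos : Finset (PartialInterp C P)
  neg : Finset (PartialInterp C P)
  brave : Finset (PartialInterp C P × PartialInterp C P)
  cautious : Finset (PartialInterp C P × PartialInterp C P)
  background_basic : ∀ r ∈ background, r.IsBasic
  background_safe : ∀ r ∈ background, r.IsSafe
  space_basic : ∀ r ∈ space, r.IsBasic
  space_safe : ∀ r ∈ space, r.IsSafe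
  pos_ground : ∀ e ∈ pos, e.IsGround
  neg_ground : ∀ e ∈ neg, e.IsGround
  brave_over_pos : ∀ o ∈ brave, o.1 ∈ pos ∧ o.2 ∈ pos
  cautious_over_pos : ∀ o ∈ cautious, o.1 ∈ pos ∧ o.2 ∈ pos

section

variable {C : Type u} {P : Type v}

/-- Inductive solutions of the task of learning from answer sets with background `B`, search space
`S` and examples `E⁺`, `E⁻`. -/
def IsLASSolution (B S : Set (ORule C P)) (pos neg : Finset (PartialInterp C P))
    (H : Set (ORule C P)) : Prop :=
  H ⊆ S ∧ (∀ e ∈ pos, ∃ A ∈ answerSets (B ∪ H), Extends A e) ∧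
    ∀ e ∈ neg, ¬ ∃ A ∈ answerSets (B ∪ H), Extends A e

/-- Inductive solutions of a task of learning from ordered answer sets. -/
def Task.IsSolution (T : Task C P) (H : Finset (ORule C P)) : Prop :=
  H ⊆ T.space ∧
    IsLASSolution (T.background : Set (ORule C P)) (nonWeak (T.space : Set (ORule C P)))
      T.pos T.neg (nonWeak (H : Set (ORule C P))) ∧
    (∀ o ∈ T.brave, BravelyRespects ((T.background : Set (ORule C P)) ∪ H) o) ∧
    ∀ o ∈ T.cautious, CautiouslyRespects ((T.background : Set (ORule C P)) ∪ H) o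

/-- The length of a hypothesis. -/
def hypLength (H : Finset (ORule C P)) : ℕ := ∑ r ∈ H, r.length

/-- Optimal inductive solutions: those of least length. -/
def Task.IsOptimalSolution (T : Task C P) (H : Finset (ORule C P)) : Prop :=
  T.IsSolution H ∧ ∀ H', T.IsSolution H' → hypLength H ≤ hypLength H'

end

/-! ### Mode biases -/

/-- The abstracted arguments `v` (variable) and `c` (constant) of a mode declaration. -/
inductive Slot
  | v
  | c

/-- Mode declarations. -/
structure ModeDecl (P : Type v) : Type v where
  pred : P
  slots : List Slot

section

variable {C : Type u} {P : Type v}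

def Slot.Matches : Slot → Term C ℕ → Prop
  | .v, t => ∃ x, t = .var x
  | .c, t => t.IsConst

/-- The atom `a` is compatible with the mode declaration `m`. -/
def Compatible (m : ModeDecl P) (a : OAtom C P) : Prop :=
  a.pred = m.pred ∧ List.Forall₂ Slot.Matches m.slots a.args

/-- The atom `a` is compatible with a mode declaration in `M`. -/
def CompatibleWith (M : Set (ModeDecl P)) (a : OAtom C P) : Prop := ∃ m ∈ M, Compatible m a

/-- Mode bias with ordering. -/
structure ModeBias (P : Type v) : Type v where
  head : Set (ModeDecl P)
  body : Set (ModeDecl P)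
  ord : Set (ModeDecl P)
  weights : Set ℤ
  lmax : ℕ
  lmax_pos : 0 < lmax

def headAllowed (Mh : Set (ModeDecl P)) : Head C ℕ P → Prop
  | .bot => True
  | .atom a => CompatibleWith Mh a
  | .choice l hs u => 0 ≤ l ∧ l ≤ u ∧ u ≤ hs.length ∧ hs.Nodup ∧ ∀ a ∈ hs, CompatibleWith Mh a

def bodyAllowed (Mb : Set (ModeDecl P)) (b : Body C ℕ P) : Prop :=
  b.guards = [] ∧ ∀ a, a ∈ b.pos ∨ a ∈ b.neg → CompatibleWith Mb a

/-- The search space without weak constraints. -/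
def searchSpaceLAS (C : Type u) (Mh Mb : Set (ModeDecl P)) : Set (ORule C P) :=
  {r | r.IsSafe ∧ ∃ h b, r = .strong h b ∧ headAllowed Mh h ∧ bodyAllowed Mb b}

/-- The search space of a mode bias with ordering. -/
def ModeBias.searchSpace (C : Type u) (M : ModeBias P) : Set (ORule C P) :=
  searchSpaceLAS C M.head M.body ∪
    {r | r.IsSafe ∧ ∃ (b : Body C ℕ P) (wt l : ℤ) (ts : List (Term C ℕ)),
      r = .weak b (.int wt) (.int l) ts ∧ bodyAllowed M.ord b ∧ ts.Nodup ∧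
      (∀ t, t ∈ ts ↔ ∃ a, (a ∈ b.pos ∨ a ∈ b.neg) ∧ t ∈ a.args) ∧
      wt ∈ M.weights ∧ 0 ≤ l ∧ l < M.lmax}

theorem CompatibleWith.functionFree {M : Set (ModeDecl P)} {a : OAtom C P}
    (h : CompatibleWith M a) : ∀ t ∈ a.args, t.FunctionFree := by
  obtain ⟨m, -, -, hm⟩ := h
  intro t ht
  obtain ⟨s, hs⟩ : ∃ s : Slot, s.Matches t := by
    obtain ⟨i, hi, rfl⟩ := List.getElem_of_mem ht
    exact ⟨m.slots[i]'(hm.length_eq ▸ hi), (List.forall₂_iff_get.1 hm).2 i _ hi⟩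
  cases s with
  | v => exact Or.inl hs
  | c => exact Or.inr hs

theorem bodyAllowed.functionFree {M : Set (ModeDecl P)} {b : Body C ℕ P} (h : bodyAllowed M b) :
    ∀ t ∈ b.terms, t.FunctionFree := by
  rintro t (⟨a, ha, ht⟩ | ⟨g, hg, -⟩)
  · exact (h.2 a ha).functionFree t ht
  · rw [h.1] at hg
    cases hg

theorem ModeBias.isSafe_of_mem {M : ModeBias P} {r : ORule C P} (hr : r ∈ M.searchSpace C) :
    r.IsSafe := by
  rcases hr with h | h <;> exact h.1

theorem ModeBias.isBasic_of_mem {M : ModeBias P} {r : ORule C P} (hr : r ∈ M.searchSpace C) :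
    r.IsBasic := by
  rcases hr with ⟨-, h, b, rfl, hh, hb⟩ | ⟨-, b, wt, l, ts, rfl, hb, -, hts, -⟩
  · refine ⟨hb.1, ?_⟩
    rintro t (⟨a, ha, ht⟩ | ht)
    · cases h with
      | atom a' =>
        obtain rfl : a = a' := by simpa [Head.atoms] using ha
        exact CompatibleWith.functionFree hh t ht
      | bot => simp [Head.atoms] at ha
      | choice l hs u => exact (hh.2.2.2.2 a ha).functionFree t ht
    · exact hb.functionFree t ht
  · refine ⟨hb.1, ?_⟩
    rintro t ((ht | rfl | rfl) | ht)
    · exact hb.functionFree t ht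
    · exact Or.inr (Or.inl ⟨_, rfl⟩)
    · exact Or.inr (Or.inl ⟨_, rfl⟩)
    · obtain ⟨a, ha, hta⟩ := (hts t).1 ht
      exact (hb.2 a ha).functionFree t hta

/-- The task whose search space is a finite part `S` of the search space of a mode bias. -/
def Task.ofModeBias (M : ModeBias P) (B S : Finset (ORule C P))
    (hS : (S : Set (ORule C P)) ⊆ M.searchSpace C)
    (pos neg : Finset (PartialInterp C P))
    (brave cautious : Finset (PartialInterp C P × PartialInterp C P))
    (hB : ∀ r ∈ B, r.IsBasic) (hB' : ∀ r ∈ B, r.IsSafe)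
    (hpos : ∀ e ∈ pos, e.IsGround) (hneg : ∀ e ∈ neg, e.IsGround)
    (hb : ∀ o ∈ brave, o.1 ∈ pos ∧ o.2 ∈ pos)
    (hc : ∀ o ∈ cautious, o.1 ∈ pos ∧ o.2 ∈ pos) : Task C P where
  background := B
  space := S
  pos := pos
  neg := neg
  brave := brave
  cautious := cautious
  background_basic := hB
  background_safe := hB'
  space_basic := fun _ hr => ModeBias.isBasic_of_mem (hS hr)
  space_safe := fun _ hr => ModeBias.isSafe_of_mem (hS hr)
  pos_ground := hpos
  neg_ground := hneg
  brave_over_pos := hb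
  cautious_over_pos := hc

end

/-! ## The meta encoding -/

/-- Violating reasons: an interpretation, or a pair of interpretations. -/
inductive Reason (C : Type u) (P : Type v) : Type (max u v)
  | interp (I : Set (OAtom C P)) : Reason C P
  | pair (I₁ I₂ : Set (OAtom C P)) : Reason C P

/-- Function symbols of the meta programs: the constants and predicates of the task (atoms of the
task are terms of the meta programs), the tuple constructor `args`, the symbol `⊥`, and identifiers
of rules, examples, orderings, and violating reasons. -/
inductive MetaFn (C : Type u) (P : Type v) : Type (max u v)
  | const (c : C) : MetaFn C P
  | pred (p : P) : MetaFn C P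
  | args : MetaFn C P
  | bot : MetaFn C P
  | ruleId (r : ORule C P) : MetaFn C P
  | posId (e : PartialInterp C P) : MetaFn C P
  | negId : MetaFn C P
  | ordId₁ (o : PartialInterp C P × PartialInterp C P) : MetaFn C P
  | ordId₂ (o : PartialInterp C P × PartialInterp C P) : MetaFn C P
  | interpId (I : Set (OAtom C P)) : MetaFn C P
  | pairId₁ (I₁ I₂ : Set (OAtom C P)) : MetaFn C P
  | pairId₂ (I₁ I₂ : Set (OAtom C P)) : MetaFn C P

/-- Variables of the meta programs: those of the task and some further ones. -/
inductive MetaVar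
  | obj (x : ℕ)
  | X | L | L2 | W | A | T1 | T2 | ATOM

/-- Predicates of the meta programs; `vp` is used with no argument and with two. -/
inductive MetaPred
  | inAs | as | inH | cov | w | vi | vp | violating
  | dom | domLv | nonDomLv | nonBef | lv
  | mmr | inVs | vs | nas

section

variable {C : Type u} {P : Type v}

abbrev MTerm (C : Type u) (P : Type v) := Term (MetaFn C P) MetaVar

abbrev MAtom (C : Type u) (P : Type v) := Atom (MetaFn C P) MetaVar MetaPred

abbrev MBody (C : Type u) (P : Type v) := Body (MetaFn C P) MetaVar MetaPred

abbrev MRule (C : Type u) (P : Type v) := Rule (MetaFn C P) MetaVar MetaPred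

/-- Identifiers are constants. -/
def idt (f : MetaFn C P) : MTerm C P := .app f []

/-- A meta variable as a term. -/
def mv (x : MetaVar) : MTerm C P := .var x

/-- A term of the task as a term of the meta programs. -/
def ofTerm (t : Term C ℕ) : MTerm C P := t.hom MetaFn.const (fun x => .var (.obj x))

/-- An atom of the task as a term of the meta programs. -/
def ofAtom (a : OAtom C P) : MTerm C P := .app (.pred a.pred) (a.args.map ofTerm)

/-- The atom `p(a, t)`. -/
def reifyAtom (p : MetaPred) (t : MTerm C P) (a : OAtom C P) : MAtom C P := ⟨p, [ofAtom a, t]⟩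

def reifyHead (p : MetaPred) (t : MTerm C P) : Head C ℕ P → Head (MetaFn C P) MetaVar MetaPred
  | .atom a => .atom (reifyAtom p t a)
  | .bot => .bot
  | .choice l hs u => .choice l (hs.map (reifyAtom p t)) u

/-- Bodies in tasks have no guards. -/
def reifyBody (p : MetaPred) (t : MTerm C P) (b : Body C ℕ P) : MBody C P :=
  ⟨b.pos.map (reifyAtom p t), b.neg.map (reifyAtom p t), []⟩

/-- Append a positive literal to the body of a rule. -/
def append (a : MAtom C P) : MRule C P → MRule C P
  | .strong h b => .strong h ⟨b.pos ++ [a], b.neg, b.guards⟩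
  | .weak b wt lev ts => .weak ⟨b.pos ++ [a], b.neg, b.guards⟩ wt lev ts

/-- The fact `a`. -/
def fact (a : MAtom C P) : MRule C P := .strong (.atom a) ⟨[], [], []⟩

/-- The rule `h ← pos, not neg, guards`. -/
def rule (h : MAtom C P) (pos neg : List (MAtom C P))
    (guards : List (Guard (MetaFn C P) MetaVar MetaPred)) : MRule C P :=
  .strong (.atom h) ⟨pos, neg, guards⟩

/-- The hard constraint `← not neg`. -/
def forbid (neg : List (MAtom C P)) : MRule C P := .strong .bot ⟨[], neg, []⟩

/-- The program `cover(e, t)`. -/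
noncomputable def cover (e : PartialInterp C P) (t : MTerm C P) : Set (MRule C P) :=
  {rule ⟨.cov, [t]⟩ (e.inc.toList.map (reifyAtom .inAs t)) (e.exc.toList.map (reifyAtom .inAs t)) [],
   forbid [⟨.cov, [t]⟩]}

/-- The rule that represents the weak constraint `:~ b.[wt@lev, ts]`. -/
def metaWeak (p₁ p₂ : MetaPred) (b : Body C ℕ P) (wt lev : Term C ℕ) (ts : List (Term C ℕ)) :
    MRule C P :=
  rule ⟨.w, [ofTerm wt, ofTerm lev, .app .args (ts.map ofTerm), mv .X]⟩
    (⟨p₂, [mv .X]⟩ :: b.pos.map (reifyAtom p₁ (mv .X))) (b.neg.map (reifyAtom p₁ (mv .X))) []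

/-- The aggregate `#sum{w(W,L,A,t₁) = W, w(W,L,A,t₂) = -W} < 0`. -/
def sumGuard (t₁ t₂ : MTerm C P) : Guard (MetaFn C P) MetaVar MetaPred :=
  .sumLt {.W, .A}
    [⟨⟨.w, [mv .W, mv .L, mv .A, t₁]⟩, 1, mv .W⟩, ⟨⟨.w, [mv .W, mv .L, mv .A, t₂]⟩, -1, mv .W⟩] 0

/-- The program `dominates(t₁, t₂)`. -/
def dominates (t₁ t₂ : MTerm C P) : Set (MRule C P) :=
  {rule ⟨.domLv, [t₁, t₂, mv .L]⟩ [⟨.lv, [mv .L]⟩] [] [sumGuard t₁ t₂],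
   rule ⟨.nonDomLv, [t₁, t₂, mv .L]⟩ [⟨.lv, [mv .L]⟩] [] [sumGuard t₂ t₁],
   rule ⟨.nonBef, [t₁, t₂, mv .L]⟩
     [⟨.lv, [mv .L]⟩, ⟨.lv, [mv .L2]⟩, ⟨.nonDomLv, [t₁, t₂, mv .L2]⟩] [] [.lt (mv .L) (mv .L2)],
   rule ⟨.dom, [t₁, t₂]⟩ [⟨.domLv, [t₁, t₂, mv .L]⟩] [⟨.nonBef, [t₁, t₂, mv .L]⟩] []}

/-- The atom `in_h(R_id)`. -/
def inH (r : ORule C P) : MAtom C P := ⟨.inH, [idt (.ruleId r)]⟩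

/-- The facts `lv(l)`, for the levels of the task. -/
def levelFacts (T : Task C P) : Set (MRule C P) :=
  {r | ∃ l ∈ levels ((T.background : Set (ORule C P)) ∪ T.space), r = fact ⟨.lv, [.int l]⟩}

def metaBackground (T : Task C P) : Set (MRule C P) :=
  {r | ∃ h b, Rule.strong h b ∈ T.background ∧
    r = append ⟨.as, [mv .X]⟩ (.strong (reifyHead .inAs (mv .X) h) (reifyBody .inAs (mv .X) b))} ∪
  {r | ∃ b wt lev ts, Rule.weak b wt lev ts ∈ T.background ∧ r = metaWeak .inAs .as b wt lev ts}

noncomputable def metaSpace (T : Task C P) : Set (MRule C P) :=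
  {r | ∃ h b, Rule.strong h b ∈ T.space ∧
    r = append (inH (.strong h b)) (append ⟨.as, [mv .X]⟩
      (.strong (reifyHead .inAs (mv .X) h) (reifyBody .inAs (mv .X) b)))} ∪
  {r | ∃ b wt lev ts, Rule.weak b wt lev ts ∈ T.space ∧
    r = append (inH (.weak b wt lev ts)) (metaWeak .inAs .as b wt lev ts)} ∪
  {r | ∃ R ∈ T.space,
    r = .weak ⟨[inH R], [], []⟩ (.int (2 * R.length)) (.int 0) [idt (.ruleId R)]} ∪
  {.strong (.choice 0 (T.space.toList.map inH) T.space.card) ⟨[], [], []⟩}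

noncomputable def metaPos (T : Task C P) : Set (MRule C P) :=
  {r | ∃ e ∈ T.pos, r ∈ cover e (idt (.posId e)) ∨ r = fact ⟨.as, [idt (.posId e)]⟩}

noncomputable def metaNeg (T : Task C P) : Set (MRule C P) :=
  {r | ∃ e ∈ T.neg,
    r = rule ⟨.vi, []⟩ (e.inc.toList.map (reifyAtom .inAs (idt .negId)))
      (e.exc.toList.map (reifyAtom .inAs (idt .negId))) [] ∨
    r = fact ⟨.as, [idt .negId]⟩} ∪
  {rule ⟨.violating, []⟩ [⟨.vi, []⟩] [] [],
   .weak ⟨[], [⟨.violating, []⟩], []⟩ (.int 1) (.int 0) []}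

noncomputable def metaBrave (T : Task C P) : Set (MRule C P) :=
  {r | ∃ o ∈ T.brave,
    r = fact ⟨.as, [idt (.ordId₁ o)]⟩ ∨ r = fact ⟨.as, [idt (.ordId₂ o)]⟩ ∨
    r ∈ cover o.1 (idt (.ordId₁ o)) ∨ r ∈ cover o.2 (idt (.ordId₂ o)) ∨
    r ∈ dominates (idt (.ordId₁ o)) (idt (.ordId₂ o)) ∨
    r = forbid [⟨.dom, [idt (.ordId₁ o), idt (.ordId₂ o)]⟩]} ∪
  levelFacts T

def metaCautious (T : Task C P) : Set (MRule C P) :=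
  {r | ∃ o ∈ T.cautious,
    r ∈ dominates (idt (.posId o.1)) (idt (.posId o.2)) ∨
    r = rule ⟨.vp, [idt (.posId o.1), idt (.posId o.2)]⟩ []
      [⟨.dom, [idt (.posId o.1), idt (.posId o.2)]⟩] []} ∪
  {rule ⟨.vp, []⟩ [⟨.vp, [mv .T1, mv .T2]⟩] [] [],
   rule ⟨.violating, []⟩ [⟨.vp, []⟩] [] []}

/-- The program `T_meta`. -/
noncomputable def taskMeta (T : Task C P) : Set (MRule C P) :=
  metaBackground T ∪ metaSpace T ∪ metaPos T ∪ metaNeg T ∪ metaBrave T ∪ metaCautious T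

/-- The body `reify(body⁺, mmr, X), reify(body⁻, not in_vs, X), vs(X)` together with additional
positive literals and guards. -/
def reductBody (b : Body C ℕ P) (pos : List (MAtom C P))
    (guards : List (Guard (MetaFn C P) MetaVar MetaPred)) : MBody C P :=
  ⟨b.pos.map (reifyAtom .mmr (mv .X)) ++ [⟨.vs, [mv .X]⟩] ++ pos,
    b.neg.map (reifyAtom .inVs (mv .X)), guards⟩

/-- The atom `mmr(⊥, X)`. -/
def mmrBot : MAtom C P := ⟨.mmr, [idt .bot, mv .X]⟩

/-- The program `reductify(h ← b)`. -/
def reductify (h : Head C ℕ P) (b : Body C ℕ P) : Set (MRule C P) :=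
  match h with
  | .atom a => {.strong (.atom (reifyAtom .mmr (mv .X) a)) (reductBody b [] [])}
  | .bot => {.strong (.atom mmrBot) (reductBody b [] [])}
  | .choice l hs u =>
      {r | ∃ a ∈ hs, r = .strong (.atom (reifyAtom .mmr (mv .X) a))
        (reductBody b [reifyAtom .inVs (mv .X) a]
          [.card (some l) (hs.map (reifyAtom .inVs (mv .X))) (some u)])} ∪
      {.strong (.atom mmrBot)
          (reductBody b [] [.card (some (u + 1)) (hs.map (reifyAtom .inVs (mv .X))) none]),
       .strong (.atom mmrBot)
          (reductBody b [] [.card none (hs.map (reifyAtom .inVs (mv .X))) (some (l - 1))])}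

/-- The facts `in_vs(a, t)` for `a ∈ I`. -/
def interpFacts (I : Set (OAtom C P)) (t : MTerm C P) : Set (MRule C P) :=
  {r | ∃ a ∈ I, r = fact (reifyAtom .inVs t a)}

def metaInterps (VR : List (Reason C P)) : Set (MRule C P) :=
  {r | ∃ I, Reason.interp I ∈ VR ∧
    (r ∈ interpFacts I (idt (.interpId I)) ∨ r = forbid [⟨.nas, [idt (.interpId I)]⟩] ∨
      r = fact ⟨.vs, [idt (.interpId I)]⟩)}

def metaPairs (VR : List (Reason C P)) : Set (MRule C P) :=
  {r | ∃ I₁ I₂, Reason.pair I₁ I₂ ∈ VR ∧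
    (r ∈ dominates (idt (.pairId₁ I₁ I₂)) (idt (.pairId₂ I₁ I₂)) ∨
      r ∈ interpFacts I₁ (idt (.pairId₁ I₁ I₂)) ∨ r ∈ interpFacts I₂ (idt (.pairId₂ I₁ I₂)) ∨
      r = fact ⟨.vs, [idt (.pairId₁ I₁ I₂)]⟩ ∨ r = fact ⟨.vs, [idt (.pairId₂ I₁ I₂)]⟩ ∨
      r = forbid [⟨.nas, [idt (.pairId₁ I₁ I₂)]⟩, ⟨.nas, [idt (.pairId₂ I₁ I₂)]⟩,
        ⟨.dom, [idt (.pairId₁ I₁ I₂), idt (.pairId₂ I₁ I₂)]⟩])}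

def metaAux (T : Task C P) : Set (MRule C P) :=
  {r | ∃ h b, Rule.strong h b ∈ T.background ∧ r ∈ reductify h b} ∪
  {rule ⟨.nas, [mv .X]⟩ [⟨.inVs, [mv .ATOM, mv .X]⟩] [⟨.mmr, [mv .ATOM, mv .X]⟩] [],
   rule ⟨.nas, [mv .X]⟩ [⟨.mmr, [mv .ATOM, mv .X]⟩] [⟨.inVs, [mv .ATOM, mv .X]⟩] []} ∪
  {r | ∃ h b, Rule.strong h b ∈ T.space ∧ ∃ r' ∈ reductify h b,
    r = append (inH (.strong h b)) r'} ∪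
  {r | ∃ b wt lev ts, Rule.weak b wt lev ts ∈ T.space ∧
    r = append (inH (.weak b wt lev ts)) (metaWeak .inVs .vs b wt lev ts)} ∪
  {r | ∃ b wt lev ts, Rule.weak b wt lev ts ∈ T.background ∧ r = metaWeak .inVs .vs b wt lev ts} ∪
  levelFacts T

/-- The program `VR_meta(T)`. -/
def reasonsMeta (T : Task C P) (VR : List (Reason C P)) : Set (MRule C P) :=
  metaInterps VR ∪ metaPairs VR ∪ metaAux T

/-- The program `T_meta ∪ VR_meta(T)`. -/
noncomputable def metaProgram (T : Task C P) (VR : List (Reason C P)) : Set (MRule C P) :=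
  taskMeta T ∪ reasonsMeta T VR

/-! ## The algorithm -/

open Classical in
/-- The hypothesis represented by an answer set of the meta program. -/
noncomputable def hypOf (T : Task C P) (A : Set (MAtom C P)) : Finset (ORule C P) :=
  T.space.filter fun r => inH r ∈ A

/-- The interpretation with identifier `t` in an answer set of the meta program. -/
def interpOf (A : Set (MAtom C P)) (t : MTerm C P) : Set (OAtom C P) :=
  {a | reifyAtom .inAs t a ∈ A}

/-- `Solve Q s`: the value `s` may be returned by `solve(Q)`, namely `none` (for `nil`) if `Q` is
unsatisfiable, and otherwise an optimal answer set with its optimality (at the only level `0`). -/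
def Solve (Q : Set (MRule C P)) : Option (Set (MAtom C P) × ℤ) → Prop
  | none => answerSets Q = ∅
  | some (A, z) => A ∈ optimalAnswerSets Q ∧ z = levelSum Q A 0

/-- The condition of the while loop. -/
def Continue : Option (Set (MAtom C P) × ℤ) → Prop
  | none => False
  | some (_, z) => z % 2 = 0

/-- The body of the loop up to the call of `solve`: from the answer set `A` and the list `VR` of
violating reasons, the new list may be `VR'`. -/
inductive Update (A : Set (MAtom C P)) (VR : List (Reason C P)) : List (Reason C P) → Prop
  | interp : (⟨.vi, []⟩ : MAtom C P) ∈ A → Update A VR (VR ++ [.interp (interpOf A (idt .negId))])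
  | pair (t₁ t₂ : MTerm C P) : (⟨.vi, []⟩ : MAtom C P) ∉ A → (⟨.vp, [t₁, t₂]⟩ : MAtom C P) ∈ A →
      Update A VR (VR ++ [.pair (interpOf A t₁) (interpOf A t₂)])
  | skip : (⟨.vi, []⟩ : MAtom C P) ∉ A → (¬ ∃ t₁ t₂, (⟨.vp, [t₁, t₂]⟩ : MAtom C P) ∈ A) →
      Update A VR VR

/-- `Loop T VR s res`: started with the list `VR` and the value `s` of `solution`, the while loop
may terminate, and the value then returned is `res`. -/
inductive Loop (T : Task C P) : List (Reason C P) → Option (Set (MAtom C P) × ℤ) →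
    Set (Finset (ORule C P)) → Prop
  | exit (VR : List (Reason C P)) (s : Option (Set (MAtom C P) × ℤ)) : ¬ Continue s →
      Loop T VR s {H | ∃ A ∈ optimalAnswerSets (metaProgram T VR), H = hypOf T A}
  | step (VR VR' : List (Reason C P)) (A : Set (MAtom C P)) (z : ℤ)
      (s : Option (Set (MAtom C P) × ℤ)) (res : Set (Finset (ORule C P))) :
      Continue (some (A, z)) → Update A VR VR' → Solve (metaProgram T VR') s →
      Loop T VR' s res → Loop T VR (some (A, z)) res

/-- `ILASP2 T res`: some run of the algorithm ILASP2 on the task `T` terminates and returns `res`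
(runs differ in the choices made by `solve` and in the violating pairs that are extracted). -/
def ILASP2 (T : Task C P) (res : Set (Finset (ORule C P))) : Prop :=
  ∃ s, Solve (metaProgram T []) s ∧ Loop T [] s res

end

end LOAS

/-! ## Safe programs: independence of the Herbrand universe -/

namespace ASP

universe u v w u' v' u'' v''

/-! ### Terms, homomorphisms and substitutions. -/

namespace Term

variable {F : Type u} {V : Type v} {F' : Type u'} {V' : Type v'} {F'' : Type u''} {V'' : Type v''}

/-! An answer set of `metaProgram T VR` is a hypothesis H together with an independently chosen
answer set of B ∪ H for every identifier t with a fact as(t). The positive and brave examples are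
enforced as constraints. The atom violating records that the interpretation chosen for n extends a
negative example, or that the interpretations chosen for some cautious pair are not in the required
order. The part of the program that depends on VR recomputes the reduct of B ∪ H for each stored
interpretation and excludes H if a stored single interpretation is an answer set of B ∪ H, or if
both members of a stored pair are answer sets and the first does not dominate the second
(`Stable.avoids`).

The weak constraints give such an answer set the value 2|H|, plus 1 if it is not violating
(`levelSum_metaProgram_zero`). Hence, for one hypothesis, violating answer sets are strictly cheaper
than non-violating ones. If the minimal value is odd, then no answer set of the meta program with
the same hypothesis is violating. Any counterexample to conditions (1) or (3) could be used as the
interpretation of n, or of the two positive examples, and would produce a violating answer set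
(`exists_stable`); so H is a solution (`isSolution_of_stable`). Conversely, every stored reason
extends a negative example or a cautious pair (`Justified`), so it never excludes a solution: each
solution H is represented by a non-violating answer set of value 2|H| + 1
(`exists_stable_of_isSolution`). On leaving the loop the optimal answer sets therefore represent
exactly the shortest solutions, and if there are no answer sets there are no solutions
(`hypOf_optimalAnswerSets_eq`). The loop preserves `Justified` (`Update.invariant`). As termination
is assumed, no progress argument is needed.

If E⁻ is nonempty, the fact as(n) requires some answer set of B ∪ H even for a solution that
violates nothing; a positive example guarantees one. This is where the hypothesis on E⁺ enters.

Most of the work is the description of the answer sets. By safety, grounding over the Herbrand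
universe may be replaced by all substitutions (`mem_answerSets_iff`). The immediate consequences of
the meta program are then listed as the relation `Step`, and its answer sets are the stable models
of `Step` (`mem_answerSets_metaProgram_iff`). What a stable model represents is read off by deleting
suspicious atoms and using minimality (`Stable.slice_inAs_mem`, `Stable.nas_notMem`). In the other
direction an explicit stable model `canon` is built from a hypothesis and a choice of
interpretations (`Witnesses.stable_canon`). -/

theorem induction {motive : Term F V → Prop} (var : ∀ x, motive (.var x))
    (int : ∀ z, motive (.int z))
    (app : ∀ f ts, (∀ t ∈ ts, motive t) → motive (.app f ts)) : ∀ t, motive t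
  | .var x => var x
  | .int z => int z
  | .app f ts => app f ts fun t _ => Term.induction var int app t

@[simp] theorem hom_var (φ : F → F') (σ : V → Term F' V') (x : V) :
    hom φ σ (.var x) = σ x := by simp [hom]

@[simp] theorem hom_int (φ : F → F') (σ : V → Term F' V') (z : ℤ) :
    hom φ σ (.int z) = .int z := by simp [hom]

@[simp] theorem hom_app (φ : F → F') (σ : V → Term F' V') (f : F) (ts : List (Term F V)) :
    hom φ σ (.app f ts) = .app (φ f) (ts.map (hom φ σ)) := by simp [hom]

@[simp] theorem subst_var (σ : V → Term F V) (x : V) : (var x : Term F V).subst σ = σ x := by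
  simp [subst]

@[simp] theorem subst_int (σ : V → Term F V) (z : ℤ) :
    (int z : Term F V).subst σ = .int z := by simp [subst]

@[simp] theorem subst_app (σ : V → Term F V) (f : F) (ts : List (Term F V)) :
    (app f ts).subst σ = .app f (ts.map (subst σ)) := by
  simp only [subst, hom_app, id]; rfl

@[simp] theorem mem_vars_var (x y : V) : x ∈ (var y : Term F V).vars ↔ x = y := by
  constructor
  · rintro (_ | _); rfl
  · rintro rfl; exact .refl _

@[simp] theorem not_mem_vars_int (x : V) (z : ℤ) : x ∉ (int z : Term F V).vars := by
  rintro (_ | _)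

@[simp] theorem mem_vars_app (x : V) (f : F) (ts : List (Term F V)) :
    x ∈ (app f ts).vars ↔ ∃ t ∈ ts, x ∈ t.vars := by
  constructor
  · intro h
    cases h with
    | app t _ _ ht h => exact ⟨t, ht, h⟩
  · rintro ⟨t, ht, h⟩; exact .app _ t _ _ ht h

theorem hom_hom (φ : F → F') (σ : V → Term F' V') (φ' : F' → F'') (σ' : V' → Term F'' V'')
    (t : Term F V) :
    hom φ' σ' (hom φ σ t) = hom (fun f => φ' (φ f)) (fun x => hom φ' σ' (σ x)) t := by
  induction t using Term.induction with
  | var x => simp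
  | int z => simp
  | app f ts ih => simpa using ih

theorem hom_congr {φ : F → F'} {σ τ : V → Term F' V'} {t : Term F V}
    (h : ∀ x ∈ t.vars, σ x = τ x) : hom φ σ t = hom φ τ t := by
  induction t using Term.induction with
  | var x => simpa using h
  | int z => simp
  | app f ts ih =>
    simp only [hom_app, app.injEq, true_and]
    refine List.map_congr_left fun t ht => ih t ht fun x hx => h x ?_
    exact (mem_vars_app ..).2 ⟨t, ht, hx⟩

theorem subst_of_vars_eq_empty {t : Term F V} (ht : t.vars = ∅) (σ : V → Term F V) :
    t.subst σ = t := by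
  induction t using Term.induction with
  | var x =>
    have : x ∈ (var x : Term F V).vars := (mem_vars_var x x).2 rfl
    rw [ht] at this
    exact this.elim
  | int z => simp
  | app f ts ih =>
    simp only [subst_app, app.injEq, true_and]
    conv_rhs => rw [← List.map_id ts]
    refine List.map_congr_left fun t ht' => ih t ht' ?_
    refine Set.eq_empty_of_forall_notMem fun x hx => ?_
    have : x ∈ (app f ts).vars := (mem_vars_app ..).2 ⟨t, ht', hx⟩
    rw [ht] at this
    exact this

theorem Subterm.trans {a b c : Term F V} (hab : Subterm a b) (hbc : Subterm b c) :
    Subterm a c := by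
  induction hbc with
  | refl => exact hab
  | app t f ts ht _ ih => exact .app _ t _ _ ht ih

end Term

/-! ### Herbrand universe, Herbrand base and reducts of safe programs. -/

variable {F : Type u} {V : Type v} {P : Type w}

theorem Atom.subst_of_isGround {a : Atom F V P} (ha : a.IsGround) (σ : V → Term F V) :
    a.subst σ = a := by
  obtain ⟨p, ts⟩ := a
  simp only [Atom.subst, Atom.mk.injEq, true_and]
  conv_rhs => rw [← List.map_id ts]
  refine List.map_congr_left fun t ht => Term.subst_of_vars_eq_empty ?_ σ
  refine Set.eq_empty_of_forall_notMem fun x hx => ?_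
  have : x ∈ (⟨p, ts⟩ : Atom F V P).vars := ⟨t, ht, hx⟩
  rw [ha] at this
  exact this

theorem HerbrandUniverse.mem_args {Q : Set (Rule F V P)} {f : F} {ts : List (Term F V)}
    (h : HerbrandUniverse Q (.app f ts)) : ∀ t ∈ ts, HerbrandUniverse Q t := by
  cases h; assumption

theorem HerbrandUniverse.vars_eq_empty {Q : Set (Rule F V P)} {t : Term F V}
    (h : HerbrandUniverse Q t) : t.vars = ∅ := by
  refine Set.eq_empty_of_forall_notMem ?_
  induction h with
  | int => simp
  | app f ss ts r t _ _ _ _ _ ih =>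
    intro x hx
    obtain ⟨s, hs, hx⟩ := (Term.mem_vars_app ..).1 hx
    exact ih s hs x hx

/-- The Herbrand universe is closed under subterms. This is how safety bounds a substitution: a
ground positive body in the Herbrand base forces the values of its variables into the universe. -/
theorem HerbrandUniverse.of_subst {Q : Set (Rule F V P)} {σ : V → Term F V} {t : Term F V}
    (h : HerbrandUniverse Q (t.subst σ)) {x : V} (hx : x ∈ t.vars) : HerbrandUniverse Q (σ x) := by
  induction t using Term.induction with
  | var y =>
    obtain rfl := (Term.mem_vars_var ..).1 hx
    simpa using h
  | int z => simp at hx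
  | app f ts ih =>
    obtain ⟨s, hs, hx⟩ := (Term.mem_vars_app ..).1 hx
    rw [Term.subst_app] at h
    exact ih s hs (h.mem_args _ (List.mem_map_of_mem hs)) hx

theorem HerbrandUniverse.subst {Q : Set (Rule F V P)} {σ : V → Term F V} {r : Rule F V P}
    {s t : Term F V} (hr : r ∈ Q) (ht : t ∈ r.terms) (hst : Term.Subterm s t)
    (hσ : ∀ x ∈ s.vars, HerbrandUniverse Q (σ x)) : HerbrandUniverse Q (s.subst σ) := by
  induction s using Term.induction with
  | var y => simpa using hσ
  | int z => simpa using HerbrandUniverse.int z r t hr ht hst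
  | app f ts ih =>
    rw [Term.subst_app]
    refine .app f ts _ r t hr ht hst (by simp) ?_
    simp only [List.mem_map, forall_exists_index, and_imp, forall_apply_eq_imp_iff₂]
    intro s hs
    exact ih s hs (.trans (.app _ s _ _ hs (.refl s)) hst)
      fun x hx => hσ x ((Term.mem_vars_app ..).2 ⟨s, hs, hx⟩)

theorem isGround_of_mem_herbrandBase {Q : Set (Rule F V P)} {a : Atom F V P}
    (ha : a ∈ herbrandBase Q) : a.IsGround := by
  refine Set.eq_empty_of_forall_notMem ?_
  rintro x ⟨t, ht, hx⟩
  rw [(ha.1 t ht).vars_eq_empty] at hx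
  exact hx

theorem HerbrandUniverse.of_subst_mem_herbrandBase {Q : Set (Rule F V P)} {σ : V → Term F V}
    {a : Atom F V P} (ha : a.subst σ ∈ herbrandBase Q) {x : V} (hx : x ∈ a.vars) :
    HerbrandUniverse Q (σ x) := by
  obtain ⟨t, ht, hx⟩ := hx
  exact (ha.1 _ (List.mem_map_of_mem ht)).of_subst hx

theorem Rule.IsSafe.herbrandUniverse {Q : Set (Rule F V P)} {r : Rule F V P} (hr : r.IsSafe)
    {σ : V → Term F V} (hσ : ∀ a ∈ r.body.pos, a.subst σ ∈ herbrandBase Q) :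
    ∀ x ∈ r.vars, HerbrandUniverse Q (σ x) := fun x hx => by
  obtain ⟨a, ha, hx⟩ := hr x hx
  exact .of_subst_mem_herbrandBase (hσ a ha) hx

/-- The reduct of a program with respect to all substitutions. -/
def fullReduct (Q : Set (Rule F V P)) (I : Set (Atom F V P)) :
    Set (Option (Atom F V P) × List (Atom F V P)) :=
  {d | ∃ h b, Rule.strong h b ∈ Q ∧ ∃ σ : V → Term F V, (∀ a ∈ b.neg, a.subst σ ∉ I) ∧
    (∀ g ∈ b.guards, (g.subst σ).Holds I) ∧ d.1 ∈ (h.subst σ).reduct I ∧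
    d.2 = b.pos.map (Atom.subst σ)}

theorem fullReduct_mono {Q Q' : Set (Rule F V P)} (h : Q ⊆ Q') (I : Set (Atom F V P)) :
    fullReduct Q I ⊆ fullReduct Q' I := by
  rintro d ⟨h', b, hr, hd⟩
  exact ⟨h', b, h hr, hd⟩

theorem reduct_subset_fullReduct (Q : Set (Rule F V P)) (I : Set (Atom F V P)) :
    reduct Q I ⊆ fullReduct Q I := by
  rintro d ⟨h, b, ⟨r, hr, σ, -, hg⟩, hneg, hgu, hd, hb⟩
  cases r with
  | weak => simp [Rule.subst] at hg
  | strong h' b' =>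
    simp only [Rule.subst, Rule.strong.injEq] at hg
    obtain ⟨rfl, rfl⟩ := hg
    refine ⟨h', b', hr, σ, fun a ha => hneg _ (List.mem_map_of_mem ha),
      fun g hg => hgu _ (List.mem_map_of_mem hg), hd, hb⟩

theorem mem_atoms_of_mem_reduct {I : Set (Atom F V P)} {h : Head F V P} {a : Atom F V P}
    (ha : some a ∈ h.reduct I) : a ∈ h.atoms := by
  cases h with
  | atom b =>
    have : some a = some b := ha
    simpa [Head.atoms] using this
  | bot =>
    have : some a = none := ha
    cases this
  | choice l hs u =>
    rcases ha with ⟨-, -, b, hb, -, h⟩ | ⟨-, h⟩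
    · cases h; exact hb
    · cases h

theorem Head.atoms_subst (σ : V → Term F V) (h : Head F V P) :
    (h.subst σ).atoms = h.atoms.map (Atom.subst σ) := by
  cases h <;> rfl

/-- An instance of a safe rule whose positive body lies in the Herbrand base belongs to the
reduct, and its head lies in the Herbrand base. -/
theorem mem_reduct_of_mem_fullReduct {Q : Set (Rule F V P)} (hQ : ∀ r ∈ Q, r.IsSafe)
    {I : Set (Atom F V P)} {d : Option (Atom F V P) × List (Atom F V P)}
    (hd : d ∈ fullReduct Q I) (hb : ∀ a ∈ d.2, a ∈ herbrandBase Q) :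
    d ∈ reduct Q I ∧ ∀ a ∈ d.1, a ∈ herbrandBase Q := by
  obtain ⟨h, b, hr, σ, hneg, hg, hd, hpos⟩ := hd
  -- Safety: each variable of the rule occurs in an atom of the positive body, whose instance lies
  -- in the Herbrand base.
  have hσ : ∀ x ∈ (Rule.strong h b).vars, HerbrandUniverse Q (σ x) :=
    (hQ _ hr).herbrandUniverse fun a ha => hb _ (hpos ▸ List.mem_map_of_mem ha)
  refine ⟨⟨h.subst σ, b.subst σ, ⟨_, hr, σ, hσ, rfl⟩, ?_, ?_, hd, hpos⟩, ?_⟩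
  · simpa [Body.subst] using hneg
  · simpa [Body.subst] using hg
  · rintro a ha
    rw [Option.mem_def] at ha
    rw [ha] at hd
    have := mem_atoms_of_mem_reduct hd
    rw [Head.atoms_subst] at this
    obtain ⟨a', ha', rfl⟩ := List.mem_map.1 this
    refine ⟨?_, _, hr, a', Or.inl ha', rfl, by simp [Atom.subst]⟩
    simp only [Atom.subst, List.mem_map, forall_exists_index, and_imp, forall_apply_eq_imp_iff₂]
    intro t ht
    exact .subst hr (Or.inl ⟨a', ha', ht⟩) (.refl t)
      fun x hx => hσ x (Or.inl ⟨a', ha', t, ht, hx⟩)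

/-- The instances in `fullReduct` that are missing from `reduct` have a positive body outside the
Herbrand base, so they never fire in an answer set. The condition that an answer set lies in the
Herbrand base also becomes a consequence of minimality, so the Herbrand universe disappears from the
rest of the argument. -/
theorem mem_answerSets_iff_isLeast {Q : Set (Rule F V P)} (hQ : ∀ r ∈ Q, r.IsSafe)
    {I : Set (Atom F V P)} :
    I ∈ answerSets Q ↔ IsLeast {M | IsModel (fullReduct Q I) M} I := by
  constructor
  · rintro ⟨hI, hmod, hleast⟩
    refine ⟨fun d hd hb => hmod d (mem_reduct_of_mem_fullReduct hQ hd fun a ha => hI (hb a ha)).1 hb,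
      fun M hM => hleast fun d hd hb => hM d (reduct_subset_fullReduct Q I hd) hb⟩
  · rintro ⟨hmod, hleast⟩
    have hI : I ⊆ herbrandBase Q := by
      -- Heads derived from the Herbrand base stay in it, so the intersection is again a model and
      -- contains the least model `I`.
      refine (hleast (a := I ∩ herbrandBase Q) fun d hd hb => ?_).trans Set.inter_subset_right
      obtain ⟨a, ha, haI⟩ := hmod d hd fun a ha => (hb a ha).1
      exact ⟨a, ha, haI, (mem_reduct_of_mem_fullReduct hQ hd fun a ha => (hb a ha).2).2 a ha⟩
    refine ⟨hI, fun d hd hb => hmod d (reduct_subset_fullReduct Q I hd) hb, fun M hM => ?_⟩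
    -- `M` is only a model of the smaller set of rules; cutting it down to `I`, which lies in the
    -- Herbrand base, makes it a model of the larger one.
    refine (hleast (a := I ∩ M) fun d hd hb => ?_).trans Set.inter_subset_right
    obtain ⟨a, ha, haI⟩ := hmod d hd fun a ha => (hb a ha).1
    obtain ⟨a', ha', haM⟩ := hM d (mem_reduct_of_mem_fullReduct hQ hd
      fun a ha => hI (hb a ha).1).1 fun a ha => (hb a ha).2
    obtain rfl : a = a' := Option.mem_unique ha ha'
    exact ⟨a, ha, haI, haM⟩

/-- The head `o` is derivable in one step from `M` by a positive rule of `D`. -/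
def Derives (D : Set (Option (Atom F V P) × List (Atom F V P))) (M : Set (Atom F V P))
    (o : Option (Atom F V P)) : Prop :=
  ∃ body, (o, body) ∈ D ∧ ∀ b ∈ body, b ∈ M

theorem Derives.mono {D D' : Set (Option (Atom F V P) × List (Atom F V P))}
    {M M' : Set (Atom F V P)} {o : Option (Atom F V P)} (hD : D ⊆ D') (hM : M ⊆ M')
    (h : Derives D M o) : Derives D' M' o :=
  let ⟨body, hd, hb⟩ := h
  ⟨body, hD hd, fun b hb' => hM (hb b hb')⟩

/-- Rules with head `⊥` can be separated from minimality: once `⊥` is not derivable from `I`, it is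
not derivable from any subset of `I`, so `I` may be compared with sets closed under the remaining
rules only. -/
theorem isLeast_isModel_iff {D : Set (Option (Atom F V P) × List (Atom F V P))}
    {I : Set (Atom F V P)} :
    IsLeast {M | IsModel D M} I ↔ (∀ a, Derives D I (some a) → a ∈ I) ∧ ¬ Derives D I none ∧
      ∀ M, (∀ a, Derives D M (some a) → a ∈ M) → I ⊆ M := by
  constructor
  · rintro ⟨hmod, hleast⟩
    have hcl : ∀ a, Derives D I (some a) → a ∈ I := by
      rintro a ⟨body, hd, hb⟩
      obtain ⟨a', ha', h⟩ := hmod _ hd hb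
      cases ha'
      exact h
    have hbot : ¬ Derives D I none := by
      rintro ⟨body, hd, hb⟩
      obtain ⟨a', ha', h⟩ := hmod _ hd hb
      cases ha'
    refine ⟨hcl, hbot, fun M hM => ?_⟩
    refine (hleast (a := I ∩ M) ?_).trans Set.inter_subset_right
    rintro ⟨o, body⟩ hd hb
    cases o with
    | none => exact absurd ⟨body, hd, fun b hb' => (hb b hb').1⟩ hbot
    | some a =>
      exact ⟨a, rfl, hcl a ⟨body, hd, fun b hb' => (hb b hb').1⟩,
        hM a ⟨body, hd, fun b hb' => (hb b hb').2⟩⟩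
  · rintro ⟨hcl, hbot, hleast⟩
    refine ⟨?_, fun M hM => hleast M ?_⟩
    · rintro ⟨o, body⟩ hd hb
      cases o with
      | none => exact absurd ⟨body, hd, hb⟩ hbot
      | some a => exact ⟨a, rfl, hcl a ⟨body, hd, hb⟩⟩
    · rintro a ⟨body, hd, hb⟩
      obtain ⟨a', ha', h⟩ := hM _ hd hb
      cases ha'
      exact h

theorem mem_answerSets_iff {Q : Set (Rule F V P)} (hQ : ∀ r ∈ Q, r.IsSafe)
    {I : Set (Atom F V P)} :
    I ∈ answerSets Q ↔ (∀ a, Derives (fullReduct Q I) I (some a) → a ∈ I) ∧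
      ¬ Derives (fullReduct Q I) I none ∧
      ∀ M, (∀ a, Derives (fullReduct Q I) M (some a) → a ∈ M) → I ⊆ M :=
  (mem_answerSets_iff_isLeast hQ).trans isLeast_isModel_iff

/-- Weak constraints can enlarge the Herbrand base, and thus the grounding. For safe programs this
has no effect on the answer sets, since `fullReduct` sees only the other rules. -/
theorem answerSets_congr {Q Q' : Set (Rule F V P)} (hQ : ∀ r ∈ Q, r.IsSafe)
    (hQ' : ∀ r ∈ Q', r.IsSafe) (h : ∀ h b, Rule.strong h b ∈ Q ↔ Rule.strong h b ∈ Q') :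
    answerSets Q = answerSets Q' := by
  ext I
  have : fullReduct Q I = fullReduct Q' I := by
    ext d
    simp only [fullReduct, h]
  rw [mem_answerSets_iff_isLeast hQ, mem_answerSets_iff_isLeast hQ', this]

/-- A one-step derivation uses a single rule, so the meta programs can be analysed rule by rule. -/
theorem derives_fullReduct_iff {Q : Set (Rule F V P)} {A M : Set (Atom F V P)}
    {o : Option (Atom F V P)} :
    Derives (fullReduct Q A) M o ↔ ∃ r ∈ Q, Derives (fullReduct {r} A) M o := by
  constructor
  · rintro ⟨body, ⟨h, b, hr, hd⟩, hb⟩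
    exact ⟨_, hr, body, ⟨h, b, rfl, hd⟩, hb⟩
  · rintro ⟨r, hr, h⟩
    exact h.mono (fullReduct_mono (by simpa using hr) A) subset_rfl

theorem derives_strong_iff {h : Head F V P} {b : Body F V P} {A M : Set (Atom F V P)}
    {o : Option (Atom F V P)} :
    Derives (fullReduct {Rule.strong h b} A) M o ↔ ∃ σ : V → Term F V,
      (∀ a ∈ b.pos, a.subst σ ∈ M) ∧ (∀ a ∈ b.neg, a.subst σ ∉ A) ∧
      (∀ g ∈ b.guards, (g.subst σ).Holds A) ∧ o ∈ (h.subst σ).reduct A := by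
  constructor
  · rintro ⟨body, ⟨h', b', hr, σ, hneg, hg, ho, rfl⟩, hb⟩
    simp only [Set.mem_singleton_iff, Rule.strong.injEq] at hr
    obtain ⟨rfl, rfl⟩ := hr
    exact ⟨σ, by simpa using hb, hneg, hg, ho⟩
  · rintro ⟨σ, hpos, hneg, hg, ho⟩
    exact ⟨_, ⟨h, b, rfl, σ, hneg, hg, ho, rfl⟩, by simpa using hpos⟩

theorem not_derives_weak {b : Body F V P} {wt lev : Term F V} {ts : List (Term F V)}
    {A M : Set (Atom F V P)} {o : Option (Atom F V P)} :
    ¬ Derives (fullReduct {Rule.weak b wt lev ts} A) M o := by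
  rintro ⟨body, ⟨h', b', hr, -⟩, -⟩
  simp at hr

/-- The analogue of `fullReduct` for weak constraints: their instances, given by the weight, the
level, the terms, and the positive body. -/
def weakReduct (Q : Set (Rule F V P)) (I : Set (Atom F V P)) :
    Set ((Term F V × Term F V × List (Term F V)) × List (Atom F V P)) :=
  {d | ∃ b wt lev ts, Rule.weak b wt lev ts ∈ Q ∧ ∃ σ : V → Term F V,
    (∀ a ∈ b.neg, a.subst σ ∉ I) ∧
    d.1 = (wt.subst σ, lev.subst σ, ts.map (Term.subst σ)) ∧ d.2 = b.pos.map (Atom.subst σ)}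

theorem weakReduct_mono {Q Q' : Set (Rule F V P)} (h : Q ⊆ Q') (I : Set (Atom F V P)) :
    weakReduct Q I ⊆ weakReduct Q' I := by
  rintro d ⟨b, wt, lev, ts, hr, hd⟩
  exact ⟨b, wt, lev, ts, h hr, hd⟩

/-- The tuple `p` belongs to an instance of a weak constraint of `Q` whose positive body is true in
`M` and whose negative body is true in `I`. -/
def WeakDerives (Q : Set (Rule F V P)) (I M : Set (Atom F V P))
    (p : Term F V × Term F V × List (Term F V)) : Prop :=
  ∃ body, (p, body) ∈ weakReduct Q I ∧ ∀ b ∈ body, b ∈ M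

theorem WeakDerives.mono {Q Q' : Set (Rule F V P)} {I M M' : Set (Atom F V P)}
    {p : Term F V × Term F V × List (Term F V)} (hQ : Q ⊆ Q') (hM : M ⊆ M')
    (h : WeakDerives Q I M p) : WeakDerives Q' I M' p :=
  let ⟨body, hd, hb⟩ := h
  ⟨body, weakReduct_mono hQ I hd, fun b hb' => hM (hb b hb')⟩

theorem weakDerives_iff {Q : Set (Rule F V P)} {I M : Set (Atom F V P)}
    {p : Term F V × Term F V × List (Term F V)} :
    WeakDerives Q I M p ↔ ∃ r ∈ Q, WeakDerives {r} I M p := by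
  constructor
  · rintro ⟨body, ⟨b, wt, lev, ts, hr, hd⟩, hb⟩
    exact ⟨_, hr, body, ⟨b, wt, lev, ts, rfl, hd⟩, hb⟩
  · rintro ⟨r, hr, h⟩
    exact h.mono (by simpa using hr) subset_rfl

theorem weakDerives_weak_iff {b : Body F V P} {wt lev : Term F V} {ts : List (Term F V)}
    {I M : Set (Atom F V P)} {p : Term F V × Term F V × List (Term F V)} :
    WeakDerives {Rule.weak b wt lev ts} I M p ↔ ∃ σ : V → Term F V,
      (∀ a ∈ b.pos, a.subst σ ∈ M) ∧ (∀ a ∈ b.neg, a.subst σ ∉ I) ∧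
      p = (wt.subst σ, lev.subst σ, ts.map (Term.subst σ)) := by
  constructor
  · rintro ⟨body, ⟨b', wt', lev', ts', hr, σ, hneg, hp, rfl⟩, hb⟩
    simp only [Set.mem_singleton_iff, Rule.weak.injEq] at hr
    obtain ⟨rfl, rfl, rfl, rfl⟩ := hr
    exact ⟨σ, by simpa using hb, hneg, hp⟩
  · rintro ⟨σ, hpos, hneg, hp⟩
    exact ⟨_, ⟨b, wt, lev, ts, rfl, σ, hneg, hp, rfl⟩, by simpa using hpos⟩

theorem not_weakDerives_strong {h : Head F V P} {b : Body F V P}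
    {I M : Set (Atom F V P)} {p : Term F V × Term F V × List (Term F V)} :
    ¬ WeakDerives {Rule.strong h b} I M p := by
  rintro ⟨body, ⟨b', wt, lev, ts, hr, -⟩, -⟩
  simp at hr

/-- The sum of the integer weights of the active tuples at level `l`. -/
noncomputable def activeSum (Q : Set (Rule F V P)) (I : Set (Atom F V P)) (l : ℤ) : ℤ :=
  ∑ᶠ p ∈ {p : ℤ × ℤ × List (Term F V) | WeakDerives Q I I (.int p.1, .int p.2.1, p.2.2) ∧
    p.2.1 = l}, p.1

theorem mem_grounding_weak_of_mem_weakReduct {Q : Set (Rule F V P)} (hQ : ∀ r ∈ Q, r.IsSafe)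
    (hg : ∀ r ∈ Q, r.body.guards = [])
    {I J : Set (Atom F V P)} {p : Term F V × Term F V × List (Term F V)} {body : List (Atom F V P)}
    (hp : (p, body) ∈ weakReduct Q I) (hJ : J ⊆ herbrandBase Q) (hb : ∀ b ∈ body, b ∈ J) :
    ∃ b : Body F V P, Rule.weak b p.1 p.2.1 p.2.2 ∈ grounding Q ∧ b.pos = body ∧
      (∀ a ∈ b.neg, a ∉ I) ∧ b.guards = [] := by
  obtain ⟨b, wt, lev, ts, hr, σ, hneg, hp, rfl⟩ := hp
  simp only at hp
  subst hp
  refine ⟨b.subst σ, ⟨_, hr, σ, (hQ _ hr).herbrandUniverse fun a ha => hJ (hb _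
    (List.mem_map_of_mem ha)), rfl⟩, rfl, ?_, ?_⟩
  · simpa [Body.subst] using hneg
  · have := hg _ hr
    simp only [Rule.body] at this
    simp [Body.subst, this]

theorem mem_weakTuples_iff {Q : Set (Rule F V P)} (hQ : ∀ r ∈ Q, r.IsSafe)
    (hg : ∀ r ∈ Q, r.body.guards = []) {I : Set (Atom F V P)} (hI : I ⊆ herbrandBase Q)
    (p : ℤ × ℤ × List (Term F V)) :
    p ∈ weakTuples Q I ↔ WeakDerives Q I I (.int p.1, .int p.2.1, p.2.2) := by
  constructor
  · rintro ⟨b, ⟨r, hr, σ, -, hrσ⟩, hpos, hneg, -⟩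
    cases r with
    | strong => simp [Rule.subst] at hrσ
    | weak b' wt lev ts =>
      simp only [Rule.subst, Rule.weak.injEq] at hrσ
      obtain ⟨rfl, h1, h2, h3⟩ := hrσ
      refine ⟨_, ⟨b', wt, lev, ts, hr, σ, ?_, ?_, rfl⟩, hpos⟩
      · simpa [Body.subst] using hneg
      · simp [h1, h2, h3]
  · rintro ⟨body, hp, hb⟩
    obtain ⟨b, hb', rfl, hneg, hgu⟩ := mem_grounding_weak_of_mem_weakReduct hQ hg hp hI hb
    exact ⟨b, hb', hb, hneg, by simp [hgu]⟩

/-- `activeSum` is what the meta program computes for any interpretation, including stored ones that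
are not answer sets of the current program. It is the official sum only for interpretations inside
the Herbrand base. -/
theorem levelSum_eq_activeSum {Q : Set (Rule F V P)} (hQ : ∀ r ∈ Q, r.IsSafe)
    (hg : ∀ r ∈ Q, r.body.guards = []) {I : Set (Atom F V P)} (hI : I ⊆ herbrandBase Q) (l : ℤ) :
    levelSum Q I l = activeSum Q I l := by
  simp only [levelSum, activeSum, mem_weakTuples_iff hQ hg hI]

/-- The levels of a finite program of the basic language are finite in number. -/
theorem finite_levels {Q : Set (Rule F V P)} (hfin : Q.Finite) (hQ : ∀ r ∈ Q, r.IsBasic) :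
    (levels Q).Finite := by
  -- Terms of basic rules are function-free, so an integer that occurs in a term is the whole term.
  have hint : ∀ z, HerbrandUniverse Q (.int z) → ∃ r ∈ Q, Term.int z ∈ r.terms := by
    intro z hz
    cases hz with
    | int _ r t hr ht hs =>
      refine ⟨r, hr, ?_⟩
      rcases (hQ r hr).2 t ht with ⟨x, rfl⟩ | ⟨z', rfl⟩ | ⟨c, rfl⟩
      · cases hs
      · cases hs; exact ht
      · cases hs with
        | app t _ _ h => cases h
  have hterms : (⋃ r ∈ Q, r.terms).Finite := by
    refine hfin.biUnion fun r hr => ?_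
    have hbody : ∀ b : Body F V P, b.guards = [] → b.terms.Finite := by
      intro b hb
      refine Set.Finite.subset (s := ⋃ a ∈ {a | a ∈ b.pos ++ b.neg}, {t | t ∈ a.args}) ?_ ?_
      · exact (List.finite_toSet _).biUnion fun a _ => List.finite_toSet _
      · rintro t (⟨a, ha, ht⟩ | ⟨g, hg, -⟩)
        · simp only [Set.mem_iUnion]
          exact ⟨a, by simpa using ha, ht⟩
        · simp [hb] at hg
    have hb := hbody _ (hQ r hr).1
    cases r with
    | strong h b =>
      refine Set.Finite.union ?_ hb
      refine Set.Finite.subset (s := ⋃ a ∈ {a | a ∈ h.atoms}, {t | t ∈ a.args}) ?_ ?_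
      · exact (List.finite_toSet _).biUnion fun a _ => List.finite_toSet _
      · rintro t ⟨a, ha, ht⟩
        simp only [Set.mem_iUnion]
        exact ⟨a, ha, ht⟩
    | weak b wt lev ts =>
      exact (hb.union (by simp)).union (List.finite_toSet _)
  refine (hterms.preimage (f := Term.int) (by intro a _ b _ h; simpa using h)).subset ?_
  rintro l ⟨b, wt, ts, ⟨r, hr, σ, hσ, h⟩⟩
  cases r with
  | strong => simp [Rule.subst] at h
  | weak b' wt' lev' ts' =>
    simp only [Rule.subst, Rule.weak.injEq] at h
    have hlev : lev' ∈ (Rule.weak b' wt' lev' ts').terms := by simp [Rule.terms]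
    simp only [Set.mem_preimage, Set.mem_iUnion]
    -- A level is a variable, instantiated by an integer of the Herbrand universe, or an integer
    -- written in the rule. A symbolic constant cannot become an integer.
    rcases (hQ _ hr).2 lev' hlev with ⟨x, rfl⟩ | ⟨z', rfl⟩ | ⟨c, rfl⟩
    · have hx := hσ x (by simp [Rule.vars])
      have h' := h.2.2.1
      simp only [Term.subst_var] at h'
      rw [← h'] at hx
      obtain ⟨r, hr, h⟩ := hint l hx
      exact ⟨r, hr, h⟩
    · have h' := h.2.2.1
      simp only [Term.subst_int] at h'
      rw [h']
      exact ⟨_, hr, hlev⟩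
    · simp at h

end ASP

/-! ## Reified atoms and rules -/

namespace LOAS

open ASP

universe u v

variable {C : Type u} {P : Type v}

/-! ### The embedding of task terms and atoms into meta terms. -/

theorem ofTerm_subst {σ : MetaVar → MTerm C P} {τ : ℕ → Term C ℕ} {t : Term C ℕ}
    (h : ∀ x ∈ t.vars, σ (.obj x) = ofTerm (τ x)) :
    (ofTerm t : MTerm C P).subst σ = ofTerm (t.subst τ) := by
  unfold ofTerm Term.subst
  rw [Term.hom_hom, Term.hom_hom]
  exact Term.hom_congr fun x hx => by simpa [ofTerm] using h x hx

theorem ofTerm_injective : Function.Injective (ofTerm : Term C ℕ → MTerm C P) := by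
  intro s
  induction s using Term.induction with
  | var x => intro t h; cases t <;> simp_all [ofTerm]
  | int x => intro t h; cases t <;> simp_all [ofTerm]
  | app f ts ih =>
    intro t h
    cases t with
    | var => simp [ofTerm] at h
    | int => simp [ofTerm] at h
    | app g ss =>
      simp only [ofTerm, Term.hom_app, Term.app.injEq, MetaFn.const.injEq] at h
      obtain ⟨rfl, h⟩ := h
      congr 1
      change ts.map ofTerm = ss.map ofTerm at h
      clear * - ih h
      induction ts generalizing ss with
      | nil => simpa using h.symm
      | cons a ts iht =>
        cases ss with
        | nil => simp at h
        | cons b ss =>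
          simp only [List.map_cons, List.cons.injEq] at h
          rw [ih a (by simp) h.1, iht (fun t ht => ih t (by simp [ht])) ss h.2]

theorem ofAtom_injective : Function.Injective (ofAtom : OAtom C P → MTerm C P) := by
  rintro ⟨p, ts⟩ ⟨q, ss⟩ h
  simp only [ofAtom, Term.app.injEq, MetaFn.pred.injEq] at h
  obtain ⟨rfl, h⟩ := h
  rw [List.map_injective_iff.2 ofTerm_injective h]

@[simp] theorem reifyAtom_inj {p p' : MetaPred} {t t' : MTerm C P} {a a' : OAtom C P} :
    reifyAtom p t a = reifyAtom p' t' a' ↔ p = p' ∧ t = t' ∧ a = a' := by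
  simp only [reifyAtom, Atom.mk.injEq, List.cons.injEq, ofAtom_injective.eq_iff, and_true]
  tauto

theorem reifyAtom_injective (p : MetaPred) (t : MTerm C P) :
    Function.Injective (reifyAtom p t) := fun _ _ h => (reifyAtom_inj.1 h).2.2

/-- Meta variables range over all meta terms, including identifiers and reified atoms. Matching
against an embedded term excludes these values: the value of a variable is a subterm of the result,
hence embedded as well. -/
theorem exists_eq_ofTerm {σ : MetaVar → MTerm C P} {t t' : Term C ℕ}
    (h : (ofTerm t : MTerm C P).subst σ = ofTerm t') {x : ℕ} (hx : x ∈ t.vars) :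
    ∃ u, σ (.obj x) = ofTerm u := by
  induction t using Term.induction generalizing t' with
  | var y =>
    obtain rfl := (Term.mem_vars_var ..).1 hx
    exact ⟨t', by simpa [ofTerm] using h⟩
  | int z => simp at hx
  | app f ts ih =>
    obtain ⟨s, hs, hx⟩ := (Term.mem_vars_app ..).1 hx
    cases t' with
    | var => simp [ofTerm] at h
    | int => simp [ofTerm] at h
    | app g ss =>
      simp only [ofTerm, Term.hom_app, Term.subst_app, Term.app.injEq, List.map_map] at h
      have := List.mem_map_of_mem (f := Term.subst σ ∘ (ofTerm : Term C ℕ → MTerm C P)) hs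
      change _ ∈ ts.map (Term.subst σ ∘ Term.hom MetaFn.const _) at this
      rw [h.2] at this
      obtain ⟨s', -, hs'⟩ := List.mem_map.1 this
      exact ih s hs hs'.symm hx

theorem exists_eq_ofTerm_of_ofAtom {σ : MetaVar → MTerm C P} {a a' : OAtom C P}
    (h : (ofAtom a).subst σ = ofAtom a') {x : ℕ} (hx : x ∈ a.vars) :
    ∃ u, σ (.obj x) = ofTerm u := by
  obtain ⟨t, ht, hx⟩ := hx
  simp only [ofAtom, Term.subst_app, Term.app.injEq, List.map_map] at h
  have := List.mem_map_of_mem (f := Term.subst σ ∘ (ofTerm : Term C ℕ → MTerm C P)) ht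
  rw [h.2] at this
  obtain ⟨s', -, hs'⟩ := List.mem_map.1 this
  exact exists_eq_ofTerm hs'.symm hx

theorem ofAtom_subst {σ : MetaVar → MTerm C P} {τ : ℕ → Term C ℕ} {a : OAtom C P}
    (h : ∀ x ∈ a.vars, σ (.obj x) = ofTerm (τ x)) :
    (ofAtom a).subst σ = ofAtom (a.subst τ) := by
  simp only [ofAtom, Term.subst_app, Atom.subst, List.map_map, Term.app.injEq, true_and]
  exact List.map_congr_left fun t ht => ofTerm_subst fun x hx => h x ⟨t, ht, hx⟩

theorem reifyAtom_subst {σ : MetaVar → MTerm C P} {τ : ℕ → Term C ℕ} {a : OAtom C P}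
    (h : ∀ x ∈ a.vars, σ (.obj x) = ofTerm (τ x)) (p : MetaPred) (t : MTerm C P) :
    (reifyAtom p t a).subst σ = reifyAtom p (t.subst σ) (a.subst τ) := by
  simp [reifyAtom, Atom.subst, ofAtom_subst h]

theorem reifyAtom_subst_of_isGround {a : OAtom C P} (ha : a.IsGround) (σ : MetaVar → MTerm C P)
    (p : MetaPred) (t : MTerm C P) :
    (reifyAtom p t a).subst σ = reifyAtom p (t.subst σ) a := by
  rw [reifyAtom_subst (τ := .var) (fun x hx => ?_), a.subst_of_isGround ha]
  rw [ha] at hx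
  exact hx.elim

@[simp] theorem idt_subst (f : MetaFn C P) (σ : MetaVar → MTerm C P) :
    (idt f).subst σ = idt f := by simp [idt]

@[simp] theorem mv_subst (x : MetaVar) (σ : MetaVar → MTerm C P) :
    (mv x : MTerm C P).subst σ = σ x := by simp [mv]

@[simp] theorem inH_subst (r : ORule C P) (σ : MetaVar → MTerm C P) : (inH r).subst σ = inH r := by
  simp [inH, Atom.subst]

@[simp] theorem inH_inj {r r' : ORule C P} : inH r = inH r' ↔ r = r' := by
  simp [inH, idt]

/-- The atoms `a` with `p(a, t) ∈ A`. -/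
def slice (p : MetaPred) (A : Set (MAtom C P)) (t : MTerm C P) : Set (OAtom C P) :=
  {a | reifyAtom p t a ∈ A}

@[simp] theorem mem_slice {p : MetaPred} {A : Set (MAtom C P)} {t : MTerm C P} {a : OAtom C P} :
    a ∈ slice p A t ↔ reifyAtom p t a ∈ A := Iff.rfl

theorem slice_mono {p : MetaPred} {A B : Set (MAtom C P)} (h : A ⊆ B) (t : MTerm C P) :
    slice p A t ⊆ slice p B t := fun _ ha => h ha

/-- Reification is injective, so cardinality bounds of choice heads are unaffected by it. -/
theorem count_map_reifyAtom (p : MetaPred) (A : Set (MAtom C P)) (t : MTerm C P)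
    (hs : List (OAtom C P)) : count A (hs.map (reifyAtom p t)) = count (slice p A t) hs := by
  unfold count
  rw [← Set.ncard_image_of_injective _ (reifyAtom_injective p t)]
  congr 2
  ext x
  simp only [List.mem_map, Set.mem_ofPred_eq, Set.mem_image, mem_slice]
  constructor
  · rintro ⟨⟨a, ha, rfl⟩, h⟩; exact ⟨a, ⟨ha, h⟩, rfl⟩
  · rintro ⟨a, ⟨ha, h⟩, rfl⟩; exact ⟨⟨a, ha, rfl⟩, h⟩

theorem mem_reduct_reifyHead {p : MetaPred} {A : Set (MAtom C P)} {t : MTerm C P}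
    {h : Head C ℕ P} {o : Option (MAtom C P)} :
    o ∈ (reifyHead p t h).reduct A ↔
      ∃ h' ∈ h.reduct (slice p A t), o = h'.map (reifyAtom p t) := by
  cases h with
  | atom a => simp [reifyHead, Head.reduct]
  | bot => simp [reifyHead, Head.reduct]
  | choice l hs u =>
    simp only [reifyHead, Head.reduct, count_map_reifyAtom, Set.mem_ofPred_eq, List.mem_map]
    constructor
    · rintro (⟨h1, h2, _, ⟨a, ha, rfl⟩, haA, rfl⟩ | ⟨h1, rfl⟩)
      · exact ⟨some a, Or.inl ⟨h1, h2, a, ha, haA, rfl⟩, rfl⟩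
      · exact ⟨none, Or.inr ⟨h1, rfl⟩, rfl⟩
    · rintro ⟨_, ⟨h1, h2, a, ha, haA, rfl⟩ | ⟨h1, rfl⟩, rfl⟩
      · exact Or.inl ⟨h1, h2, _, ⟨a, ha, rfl⟩, haA, rfl⟩
      · exact Or.inr ⟨h1, rfl⟩

theorem reifyHead_subst {σ : MetaVar → MTerm C P} {τ : ℕ → Term C ℕ} {h : Head C ℕ P}
    (hστ : ∀ a ∈ h.atoms, ∀ x ∈ a.vars, σ (.obj x) = ofTerm (τ x)) (p : MetaPred) (t : MTerm C P) :
    (reifyHead p t h).subst σ = reifyHead p (t.subst σ) (h.subst τ) := by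
  cases h with
  | atom a => simp [reifyHead, Head.subst, reifyAtom_subst (hστ a (by simp [Head.atoms]))]
  | bot => rfl
  | choice l hs u =>
    simp only [reifyHead, Head.subst, List.map_map, Head.choice.injEq, true_and, and_true]
    exact List.map_congr_left fun a ha => reifyAtom_subst (hστ a ha) _ _

/-- The first arguments of the atoms with predicates `in_as`, `in_vs` and `mmr` in `M` represent
atoms of the task or `⊥`. -/
def Reified (M : Set (MAtom C P)) : Prop :=
  ∀ p y t, (⟨p, [y, t]⟩ : MAtom C P) ∈ M → p = .inAs ∨ p = .inVs ∨ p = .mmr →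
    y = idt .bot ∨ ∃ a, y = ofAtom a

theorem Reified.mono {M M' : Set (MAtom C P)} (hM : Reified M') (h : M ⊆ M') : Reified M :=
  fun p y t hy => hM p y t (h hy)

/-- By safety each variable of a task rule occurs in a positive body atom. Its instance lies in `M`,
hence is an embedded atom, and so the meta substitution restricts to a substitution by task terms.
-/
theorem Reified.exists_subst {M : Set (MAtom C P)} (hM : Reified M) {p : MetaPred}
    (hp : p = .inAs ∨ p = .inVs ∨ p = .mmr) {r : ORule C P} (hr : r.IsSafe)
    {σ : MetaVar → MTerm C P} {u : MTerm C P}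
    (hσ : ∀ b ∈ r.body.pos, (reifyAtom p u b).subst σ ∈ M) :
    ∃ τ : ℕ → Term C ℕ, ∀ x ∈ r.vars, σ (.obj x) = ofTerm (τ x) := by
  have : ∀ x, ∃ t, x ∈ r.vars → σ (.obj x) = ofTerm t := by
    intro x
    by_cases hx : x ∈ r.vars
    · obtain ⟨b, hb, hxb⟩ := hr x hx
      have h : (⟨p, [(ofAtom b).subst σ, u.subst σ]⟩ : MAtom C P) ∈ M := hσ b hb
      rcases hM _ _ _ h hp with h | ⟨a, ha⟩
      -- The identifier of `⊥` is not an application of a predicate symbol, so no reified body atom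
      -- can match it.
      · simp [ofAtom, idt] at h
      · obtain ⟨t, ht⟩ := exists_eq_ofTerm_of_ofAtom ha hxb
        exact ⟨t, fun _ => ht⟩
    · exact ⟨.int 0, fun h => absurd h hx⟩
  choose τ hτ using this
  exact ⟨τ, fun x hx => hτ x hx⟩

/-- The substitution of the meta variables given by a substitution of the variables of the task and
a value of `X`. -/
def metaSubst (τ : ℕ → Term C ℕ) (t : MTerm C P) : MetaVar → MTerm C P
  | .obj x => ofTerm (τ x)
  | _ => t

@[simp] theorem metaSubst_X (τ : ℕ → Term C ℕ) (t : MTerm C P) : metaSubst τ t .X = t := rfl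

theorem derives_append_iff {a : MAtom C P} (ha : ∀ σ, a.subst σ = a) {r : MRule C P}
    {A M : Set (MAtom C P)} {o : Option (MAtom C P)} :
    Derives (fullReduct {append a r} A) M o ↔ a ∈ M ∧ Derives (fullReduct {r} A) M o := by
  cases r with
  | strong h b =>
    simp only [append, derives_strong_iff, List.mem_append, List.mem_singleton]
    constructor
    · rintro ⟨σ, h1, h2⟩
      exact ⟨ha σ ▸ h1 a (Or.inr rfl), σ, fun x hx => h1 x (Or.inl hx), h2⟩
    · rintro ⟨h0, σ, h1, h2⟩
      refine ⟨σ, ?_, h2⟩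
      rintro x (hx | rfl)
      · exact h1 x hx
      · rwa [ha]
  | weak => simp [append, not_derives_weak]

theorem vars_subset_of_mem_pos {r : ORule C P} {a : OAtom C P} (ha : a ∈ r.body.pos) :
    ∀ x ∈ a.vars, x ∈ r.vars := by
  intro x hx
  cases r with
  | strong h b => exact Or.inr (Or.inl ⟨a, Or.inl ha, hx⟩)
  | weak b wt lev ts => exact Or.inl (Or.inl (Or.inl (Or.inl ⟨a, Or.inl ha, hx⟩)))

theorem vars_subset_of_mem_neg {r : ORule C P} {a : OAtom C P} (ha : a ∈ r.body.neg) :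
    ∀ x ∈ a.vars, x ∈ r.vars := by
  intro x hx
  cases r with
  | strong h b => exact Or.inr (Or.inl ⟨a, Or.inr ha, hx⟩)
  | weak b wt lev ts => exact Or.inl (Or.inl (Or.inl (Or.inl ⟨a, Or.inr ha, hx⟩)))

/-- The value of X picks an identifier t, and the slices at t turn the meta rule back into the
original rule. A reified constraint keeps the head `⊥`, so constraints of the task remain
constraints on each interpretation. -/
theorem derives_reify_iff {h : Head C ℕ P} {b : Body C ℕ P} (hr : (Rule.strong h b).IsSafe)
    (hg : b.guards = []) {A M : Set (MAtom C P)} (hM : Reified M) {o : Option (MAtom C P)} :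
    Derives (fullReduct {append ⟨.as, [mv .X]⟩
        (.strong (reifyHead .inAs (mv .X) h) (reifyBody .inAs (mv .X) b))} A) M o ↔
      ∃ t o', Derives (fullReduct {Rule.strong h b} (slice .inAs A t)) (slice .inAs M t) o' ∧
        (⟨.as, [t]⟩ : MAtom C P) ∈ M ∧ o = o'.map (reifyAtom .inAs t) := by
  have key : ∀ (σ : MetaVar → MTerm C P) (τ : ℕ → Term C ℕ),
      (∀ x ∈ (Rule.strong h b).vars, σ (.obj x) = ofTerm (τ x)) →
      (∀ a ∈ b.pos, (reifyAtom .inAs (mv .X) a).subst σ = reifyAtom .inAs (σ .X) (a.subst τ)) ∧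
      (∀ a ∈ b.neg, (reifyAtom .inAs (mv .X) a).subst σ = reifyAtom .inAs (σ .X) (a.subst τ)) ∧
      (reifyHead .inAs (mv .X) h).subst σ = reifyHead .inAs (σ .X) (h.subst τ) := by
    intro σ τ hστ
    refine ⟨fun a ha => ?_, fun a ha => ?_, ?_⟩
    · rw [reifyAtom_subst fun x hx => hστ x (vars_subset_of_mem_pos (r := .strong h b) ha x hx),
        mv_subst]
    · rw [reifyAtom_subst fun x hx => hστ x (vars_subset_of_mem_neg (r := .strong h b) ha x hx),
        mv_subst]
    · rw [reifyHead_subst fun a ha x hx => hστ x (Or.inl ⟨a, ha, hx⟩), mv_subst]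
  simp only [append, reifyBody, derives_strong_iff, List.mem_append, List.mem_singleton,
    List.mem_map, List.not_mem_nil, false_imp_iff, implies_true, true_and, hg, mem_slice]
  constructor
  · rintro ⟨σ, hpos, hneg, ho⟩
    obtain ⟨τ, hτ⟩ := hM.exists_subst (Or.inl rfl) hr (σ := σ) (u := mv .X)
      fun a ha => hpos _ (Or.inl ⟨a, ha, rfl⟩)
    obtain ⟨k1, k2, k3⟩ := key σ τ hτ
    rw [k3, mem_reduct_reifyHead] at ho
    obtain ⟨o', ho', rfl⟩ := ho
    refine ⟨σ .X, o', ⟨τ, fun a ha => ?_, fun a ha => ?_, ho'⟩, ?_, rfl⟩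
    · rw [← k1 a ha]; exact hpos _ (Or.inl ⟨a, ha, rfl⟩)
    · rw [← k2 a ha]; exact hneg _ ⟨a, ha, rfl⟩
    · simpa [Atom.subst] using hpos _ (Or.inr rfl)
  · rintro ⟨t, o', ⟨τ, hpos, hneg, ho⟩, has, rfl⟩
    obtain ⟨k1, k2, k3⟩ := key (metaSubst τ t) τ fun x _ => rfl
    refine ⟨metaSubst τ t, ?_, ?_, ?_⟩
    · rintro _ (⟨a, ha, rfl⟩ | rfl)
      · rw [k1 a ha]; exact hpos a ha
      · simpa [Atom.subst] using has
    · rintro _ ⟨a, ha, rfl⟩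
      rw [k2 a ha]; exact hneg a ha
    · rw [k3, mem_reduct_reifyHead]
      exact ⟨o', ho, rfl⟩

/-- The atom `w(w, l, args(t₁, …, tₒ), t)`. -/
def weightAtom (p : Term C ℕ × Term C ℕ × List (Term C ℕ)) (t : MTerm C P) : MAtom C P :=
  ⟨.w, [ofTerm p.1, ofTerm p.2.1, .app .args (p.2.2.map ofTerm), t]⟩

/-- Left open in `p₁` and `p₂` because weak constraints are encoded twice, over in_as with as and
over in_vs with vs. -/
theorem derives_metaWeak_iff {b : Body C ℕ P} {wt lev : Term C ℕ} {ts : List (Term C ℕ)}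
    (hr : (Rule.weak b wt lev ts).IsSafe) {p₁ p₂ : MetaPred}
    (hp : p₁ = .inAs ∨ p₁ = .inVs ∨ p₁ = .mmr)
    {A M : Set (MAtom C P)} (hM : Reified M) {o : Option (MAtom C P)} :
    Derives (fullReduct {metaWeak p₁ p₂ b wt lev ts} A) M o ↔
      ∃ t p, WeakDerives {Rule.weak b wt lev ts} (slice p₁ A t) (slice p₁ M t) p ∧
        (⟨p₂, [t]⟩ : MAtom C P) ∈ M ∧ o = some (weightAtom p t) := by
  have key : ∀ (σ : MetaVar → MTerm C P) (τ : ℕ → Term C ℕ),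
      (∀ x ∈ (Rule.weak b wt lev ts).vars, σ (.obj x) = ofTerm (τ x)) →
      (∀ a ∈ b.pos, (reifyAtom p₁ (mv .X) a).subst σ = reifyAtom p₁ (σ .X) (a.subst τ)) ∧
      (∀ a ∈ b.neg, (reifyAtom p₁ (mv .X) a).subst σ = reifyAtom p₁ (σ .X) (a.subst τ)) ∧
      (⟨.w, [ofTerm wt, ofTerm lev, .app .args (ts.map ofTerm), mv .X]⟩ : MAtom C P).subst σ =
        weightAtom (wt.subst τ, lev.subst τ, ts.map (Term.subst τ)) (σ .X) := by
    intro σ τ hστ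
    refine ⟨fun a ha => ?_, fun a ha => ?_, ?_⟩
    · rw [reifyAtom_subst fun x hx => hστ x (vars_subset_of_mem_pos
        (r := .weak b wt lev ts) ha x hx), mv_subst]
    · rw [reifyAtom_subst fun x hx => hστ x (vars_subset_of_mem_neg
        (r := .weak b wt lev ts) ha x hx), mv_subst]
    · simp only [Atom.subst, weightAtom, List.map_cons, Term.subst_app, List.map_nil, mv_subst,
        List.map_map]
      rw [ofTerm_subst fun x hx => hστ x (Or.inl (Or.inl (Or.inr hx))),
        ofTerm_subst fun x hx => hστ x (Or.inl (Or.inr hx))]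
      congr 4
      congr 1
      exact List.map_congr_left fun t ht => ofTerm_subst fun x hx => hστ x (Or.inr ⟨t, ht, hx⟩)
  simp only [metaWeak, rule, derives_strong_iff, weakDerives_weak_iff, List.mem_cons,
    List.mem_map, List.not_mem_nil, false_imp_iff, implies_true, true_and, mem_slice,
    Head.subst, Head.reduct, Set.mem_singleton_iff]
  constructor
  · rintro ⟨σ, hpos, hneg, ho⟩
    -- Safety of a weak constraint also covers the variables in its weight, level and terms, so the
    -- derived w-atom is the embedding of a task tuple.
    obtain ⟨τ, hτ⟩ := hM.exists_subst hp hr (σ := σ) (u := mv .X)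
      fun a ha => hpos _ (Or.inr ⟨a, ha, rfl⟩)
    obtain ⟨k1, k2, k3⟩ := key σ τ hτ
    rw [k3] at ho
    refine ⟨σ .X, _, ⟨τ, fun a ha => ?_, fun a ha => ?_, rfl⟩, ?_, ho⟩
    · rw [← k1 a ha]; exact hpos _ (Or.inr ⟨a, ha, rfl⟩)
    · rw [← k2 a ha]; exact hneg _ ⟨a, ha, rfl⟩
    · simpa [Atom.subst] using hpos _ (Or.inl rfl)
  · rintro ⟨t, p, ⟨τ, hpos, hneg, rfl⟩, has, rfl⟩
    obtain ⟨k1, k2, k3⟩ := key (metaSubst τ t) τ fun x _ => rfl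
    refine ⟨metaSubst τ t, ?_, ?_, ?_⟩
    · rintro _ (rfl | ⟨a, ha, rfl⟩)
      · simpa [Atom.subst] using has
      · rw [k1 a ha]; exact hpos a ha
    · rintro _ ⟨a, ha, rfl⟩
      rw [k2 a ha]; exact hneg a ha
    · rw [k3]; rfl

/-- The atom `mmr(a, t)`, or `mmr(⊥, t)`. -/
def mmrAtom (t : MTerm C P) : Option (OAtom C P) → MAtom C P
  | some a => reifyAtom .mmr t a
  | none => ⟨.mmr, [idt .bot, t]⟩

theorem mmrBot_subst (σ : MetaVar → MTerm C P) : (mmrBot : MAtom C P).subst σ =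
    mmrAtom (σ .X) none := by
  simp [mmrBot, mmrAtom, Atom.subst]

/-- The translation of an instance of a rule of `reductify(h ← b)`. -/
theorem derives_reductBody_iff {h : Head C ℕ P} {b : Body C ℕ P}
    (hr : (Rule.strong h b).IsSafe) {A M : Set (MAtom C P)} (hM : Reified M)
    {a : MAtom C P} {pos : List (MAtom C P)}
    {guards : List (Guard (MetaFn C P) MetaVar MetaPred)}
    {R : (ℕ → Term C ℕ) → MTerm C P → Option (MAtom C P) → Prop} {o : Option (MAtom C P)}
    (hR : ∀ (σ : MetaVar → MTerm C P) (τ : ℕ → Term C ℕ),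
      (∀ x ∈ (Rule.strong h b).vars, σ (.obj x) = ofTerm (τ x)) →
      ((∀ a ∈ pos, a.subst σ ∈ M) ∧ (∀ g ∈ guards, (g.subst σ).Holds A) ∧
        o = some (a.subst σ) ↔ R τ (σ .X) o)) :
    Derives (fullReduct {Rule.strong (.atom a) (reductBody b pos guards)} A) M o ↔
      ∃ t τ, (⟨.vs, [t]⟩ : MAtom C P) ∈ M ∧ (∀ a ∈ b.pos, a.subst τ ∈ slice .mmr M t) ∧
        (∀ a ∈ b.neg, a.subst τ ∉ slice .inVs A t) ∧ R τ t o := by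
  have key : ∀ (σ : MetaVar → MTerm C P) (τ : ℕ → Term C ℕ),
      (∀ x ∈ (Rule.strong h b).vars, σ (.obj x) = ofTerm (τ x)) →
      (∀ a ∈ b.pos, (reifyAtom .mmr (mv .X) a).subst σ = reifyAtom .mmr (σ .X) (a.subst τ)) ∧
      (∀ a ∈ b.neg, (reifyAtom .inVs (mv .X) a).subst σ = reifyAtom .inVs (σ .X) (a.subst τ)) := by
    intro σ τ hστ
    refine ⟨fun a ha => ?_, fun a ha => ?_⟩
    · rw [reifyAtom_subst fun x hx => hστ x (vars_subset_of_mem_pos (r := .strong h b) ha x hx),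
        mv_subst]
    · rw [reifyAtom_subst fun x hx => hστ x (vars_subset_of_mem_neg (r := .strong h b) ha x hx),
        mv_subst]
  simp only [reductBody, derives_strong_iff, List.mem_append, List.mem_singleton,
    List.mem_map, mem_slice, Head.subst, Head.reduct, Set.mem_singleton_iff]
  constructor
  · rintro ⟨σ, hpos, hneg, hg, ho⟩
    obtain ⟨τ, hτ⟩ := hM.exists_subst (Or.inr (Or.inr rfl)) hr (σ := σ) (u := mv .X)
      fun a ha => hpos _ (Or.inl (Or.inl ⟨a, ha, rfl⟩))
    obtain ⟨k1, k2⟩ := key σ τ hτ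
    refine ⟨σ .X, τ, ?_, fun a ha => ?_, fun a ha => ?_,
      (hR σ τ hτ).1 ⟨fun a ha => hpos a (Or.inr ha), hg, ho⟩⟩
    · simpa [Atom.subst] using hpos _ (Or.inl (Or.inr rfl))
    · rw [← k1 a ha]; exact hpos _ (Or.inl (Or.inl ⟨a, ha, rfl⟩))
    · rw [← k2 a ha]; exact hneg _ ⟨a, ha, rfl⟩
  · rintro ⟨t, τ, hvs, hpos, hneg, ho⟩
    obtain ⟨k1, k2⟩ := key (metaSubst τ t) τ fun x _ => rfl
    obtain ⟨r1, r2, r3⟩ := (hR (metaSubst τ t) τ fun x _ => rfl).2 ho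
    refine ⟨metaSubst τ t, ?_, ?_, r2, r3⟩
    · rintro _ ((⟨a, ha, rfl⟩ | rfl) | ha)
      · rw [k1 a ha]; exact hpos a ha
      · simpa [Atom.subst] using hvs
      · exact r1 _ ha
    · rintro _ ⟨a, ha, rfl⟩
      rw [k2 a ha]; exact hneg a ha

/-- The two directions need opposite inclusions because of choice rules. The literal in_vs(hᵢ, X) is
a positive body literal, tested in `M`, whereas the original reduct tests whether hᵢ belongs to the
fixed interpretation, that is, to the slice of `A`. Both inclusions are available later: `M` is part
of `A`, and in_vs is given by facts. -/
theorem derives_reductify {h : Head C ℕ P} {b : Body C ℕ P}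
    (hr : (Rule.strong h b).IsSafe) (hg : b.guards = [])
    {A M : Set (MAtom C P)} (hM : Reified M) {o : Option (MAtom C P)} :
    ((∀ t a, reifyAtom .inVs t a ∈ M → reifyAtom .inVs t a ∈ A) →
      (∃ r ∈ reductify h b, Derives (fullReduct {r} A) M o) →
      ∃ t o', Derives (fullReduct {Rule.strong h b} (slice .inVs A t)) (slice .mmr M t) o' ∧
        (⟨.vs, [t]⟩ : MAtom C P) ∈ M ∧ o = some (mmrAtom t o')) ∧
    ((∀ t a, reifyAtom .inVs t a ∈ A → reifyAtom .inVs t a ∈ M) →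
      (∃ t o', Derives (fullReduct {Rule.strong h b} (slice .inVs A t)) (slice .mmr M t) o' ∧
        (⟨.vs, [t]⟩ : MAtom C P) ∈ M ∧ o = some (mmrAtom t o')) →
      ∃ r ∈ reductify h b, Derives (fullReduct {r} A) M o) := by
  simp only [derives_strong_iff, hg, List.not_mem_nil, false_imp_iff, implies_true, true_and]
  cases h with
  | atom a =>
    simp only [reductify, Set.mem_singleton_iff, exists_eq_left, Head.subst, Head.reduct]
    rw [derives_reductBody_iff hr hM
      (R := fun τ t o => o = some (reifyAtom .mmr t (a.subst τ))) ?_]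
    · constructor
      · rintro - ⟨t, τ, h1, h2, h3, h4⟩
        exact ⟨t, _, ⟨τ, h2, h3, rfl⟩, h1, h4⟩
      · rintro - ⟨t, _, ⟨τ, h2, h3, rfl⟩, h1, h4⟩
        exact ⟨t, τ, h1, h2, h3, h4⟩
    · intro σ τ hστ
      rw [reifyAtom_subst fun x hx => hστ x (Or.inl ⟨a, by simp [Head.atoms], hx⟩)]
      simp
  | bot =>
    simp only [reductify, Set.mem_singleton_iff, exists_eq_left, Head.subst, Head.reduct]
    rw [derives_reductBody_iff hr hM (R := fun τ t o => o = some (mmrAtom t none)) ?_]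
    · constructor
      · rintro - ⟨t, τ, h1, h2, h3, h4⟩
        exact ⟨t, _, ⟨τ, h2, h3, rfl⟩, h1, h4⟩
      · rintro - ⟨t, _, ⟨τ, h2, h3, rfl⟩, h1, h4⟩
        exact ⟨t, τ, h1, h2, h3, h4⟩
    · intro σ τ hστ
      simp [mmrBot_subst]
  | choice l hs u =>
    have hcount : ∀ (σ : MetaVar → MTerm C P) (τ : ℕ → Term C ℕ),
        (∀ x ∈ (Rule.strong (.choice l hs u) b).vars, σ (.obj x) = ofTerm (τ x)) →
        count A ((hs.map (reifyAtom .inVs (mv .X))).map (Atom.subst σ)) =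
          count (slice .inVs A (σ .X)) (hs.map (Atom.subst τ)) := by
      intro σ τ hστ
      rw [← count_map_reifyAtom]
      congr 1
      simp only [List.map_map]
      refine List.map_congr_left fun a ha => ?_
      simp only [Function.comp]
      rw [reifyAtom_subst fun x hx => hστ x (Or.inl ⟨a, ha, hx⟩), mv_subst]
    have h₁ : ∀ a ∈ hs, Derives (fullReduct {Rule.strong (.atom (reifyAtom .mmr (mv .X) a))
        (reductBody b [reifyAtom .inVs (mv .X) a]
          [.card (some l) (hs.map (reifyAtom .inVs (mv .X))) (some u)])} A) M o ↔ _ :=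
      fun a ha => derives_reductBody_iff hr hM
        (R := fun τ t o => reifyAtom .inVs t (a.subst τ) ∈ M ∧
          (l ≤ count (slice .inVs A t) (hs.map (Atom.subst τ)) ∧
            count (slice .inVs A t) (hs.map (Atom.subst τ)) ≤ u) ∧
          o = some (reifyAtom .mmr t (a.subst τ))) (by
        intro σ τ hστ
        have ha' : ∀ p, (reifyAtom p (mv .X) a).subst σ = reifyAtom p (σ .X) (a.subst τ) := by
          intro p
          rw [reifyAtom_subst fun x hx => hστ x (Or.inl ⟨a, ha, hx⟩), mv_subst]
        simp [ha', Guard.subst, Guard.Holds, hcount σ τ hστ,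
          -List.map_map])
    have h₂ : Derives (fullReduct {Rule.strong (.atom mmrBot)
        (reductBody b [] [.card (some (u + 1)) (hs.map (reifyAtom .inVs (mv .X))) none])} A) M o ↔
        _ := derives_reductBody_iff hr hM
          (R := fun τ t o => u + 1 ≤ count (slice .inVs A t) (hs.map (Atom.subst τ)) ∧
            o = some (mmrAtom t none)) (by
        intro σ τ hστ
        simp [Guard.subst, Guard.Holds, hcount σ τ hστ, mmrBot_subst, -List.map_map])
    have h₃ : Derives (fullReduct {Rule.strong (.atom mmrBot)
        (reductBody b [] [.card none (hs.map (reifyAtom .inVs (mv .X))) (some (l - 1))])} A) M o ↔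
        _ := derives_reductBody_iff hr hM
          (R := fun τ t o => count (slice .inVs A t) (hs.map (Atom.subst τ)) ≤ l - 1 ∧
            o = some (mmrAtom t none)) (by
        intro σ τ hστ
        simp [Guard.subst, Guard.Holds, hcount σ τ hστ, mmrBot_subst, -List.map_map])
    simp only [reductify, Head.subst, Head.reduct, Set.mem_ofPred_eq]
    constructor
    · rintro hinVs ⟨r, ⟨a, ha, rfl⟩ | rfl | rfl, hd⟩
      · obtain ⟨t, τ, h1, h2, h3, h4, h5, rfl⟩ := (h₁ a ha).1 hd
        exact ⟨t, some (a.subst τ), ⟨τ, h2, h3, Or.inl ⟨h5.1, h5.2, _, List.mem_map_of_mem ha,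
          hinVs _ _ h4,
          rfl⟩⟩, h1, rfl⟩
      · obtain ⟨t, τ, h1, h2, h3, h4, rfl⟩ := h₂.1 hd
        exact ⟨t, none, ⟨τ, h2, h3, Or.inr ⟨by omega, rfl⟩⟩, h1, rfl⟩
      · obtain ⟨t, τ, h1, h2, h3, h4, rfl⟩ := h₃.1 hd
        exact ⟨t, none, ⟨τ, h2, h3, Or.inr ⟨by omega, rfl⟩⟩, h1, rfl⟩
    · rintro hinVs ⟨t, o', ⟨τ, h2, h3, ⟨h4, h5, _, ha, ha', rfl⟩ | ⟨h4, rfl⟩⟩, h1, rfl⟩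
      · obtain ⟨a, ha₀, rfl⟩ := List.mem_map.1 ha
        exact ⟨_, Or.inl ⟨a, ha₀, rfl⟩, (h₁ a ha₀).2 ⟨t, τ, h1, h2, h3, hinVs _ _ ha', ⟨h4, h5⟩, rfl⟩⟩
      -- The bounds fail either because the count is at least u + 1 or because it is at most l - 1;
      -- each case has its own rule with head mmr(⊥, X).
      · by_cases h6 : l ≤ count (slice .inVs A t) (hs.map (Atom.subst τ))
        · exact ⟨_, Or.inr (Or.inl rfl), h₂.2 ⟨t, τ, h1, h2, h3, by
            have := not_and.1 h4 h6; omega, rfl⟩⟩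
        · exact ⟨_, Or.inr (Or.inr rfl), h₃.2 ⟨t, τ, h1, h2, h3, by omega, rfl⟩⟩

end LOAS

/-! ## The meta programs are safe -/

namespace LOAS

open ASP

universe u v

variable {C : Type u} {P : Type v}

theorem mem_vars_ofTerm {x : MetaVar} {t : Term C ℕ} :
    x ∈ (ofTerm t : MTerm C P).vars ↔ ∃ y ∈ t.vars, x = .obj y := by
  induction t using Term.induction with
  | var y => simp [ofTerm]
  | int z => simp [ofTerm]
  | app f ts ih =>
    have : (ofTerm (.app f ts) : MTerm C P) = .app (.const f) (ts.map ofTerm) := by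
      simp [ofTerm]
    simp only [this, Term.mem_vars_app, List.mem_map, exists_exists_and_eq_and]
    constructor
    · rintro ⟨t, ht, hx⟩
      obtain ⟨y, hy, rfl⟩ := (ih t ht).1 hx
      exact ⟨y, ⟨t, ht, hy⟩, rfl⟩
    · rintro ⟨y, ⟨t, ht, hy⟩, rfl⟩
      exact ⟨t, ht, (ih t ht).2 ⟨y, hy, rfl⟩⟩

theorem mem_vars_atom {x : MetaVar} {p : MetaPred} {ts : List (MTerm C P)} :
    x ∈ (⟨p, ts⟩ : MAtom C P).vars ↔ ∃ t ∈ ts, x ∈ t.vars := Iff.rfl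

theorem mem_vars_reifyAtom {x : MetaVar} {p : MetaPred} {t : MTerm C P} {a : OAtom C P} :
    x ∈ (reifyAtom p t a).vars ↔ (∃ y ∈ a.vars, x = .obj y) ∨ x ∈ t.vars := by
  simp only [reifyAtom, mem_vars_atom, List.mem_cons, List.not_mem_nil, or_false,
    exists_eq_or_imp, exists_eq_left, ofAtom, Term.mem_vars_app, List.mem_map,
    exists_exists_and_eq_and, mem_vars_ofTerm]
  refine or_congr_left ?_
  constructor
  · rintro ⟨t, ht, y, hy, rfl⟩; exact ⟨y, ⟨t, ht, hy⟩, rfl⟩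
  · rintro ⟨y, ⟨t, ht, hy⟩, rfl⟩; exact ⟨t, ht, y, hy, rfl⟩

@[simp] theorem mem_vars_mv {x y : MetaVar} : x ∈ (mv y : MTerm C P).vars ↔ x = y := by simp [mv]

@[simp] theorem not_mem_vars_idt {x : MetaVar} {f : MetaFn C P} : x ∉ (idt f).vars := by
  simp [idt]

@[simp] theorem not_mem_vars_inH {x : MetaVar} {r : ORule C P} : x ∉ (inH r).vars := by
  simp [inH, mem_vars_atom]

theorem not_mem_vars_reifyAtom_idt {x : MetaVar} {p : MetaPred} {f : MetaFn C P} {a : OAtom C P}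
    (ha : a.IsGround) : x ∉ (reifyAtom p (idt f) a).vars := by
  rw [mem_vars_reifyAtom]
  rintro (⟨y, hy, -⟩ | h)
  · rw [ha] at hy; exact hy
  · exact not_mem_vars_idt h

theorem isSafe_strong {h : Head (MetaFn C P) MetaVar MetaPred} {b : MBody C P}
    (hh : ∀ a ∈ h.atoms, ∀ x ∈ a.vars, ∃ a' ∈ b.pos, x ∈ a'.vars)
    (hneg : ∀ a ∈ b.neg, ∀ x ∈ a.vars, ∃ a' ∈ b.pos, x ∈ a'.vars)
    (hg : ∀ g ∈ b.guards, ∀ x ∈ g.vars, ∃ a' ∈ b.pos, x ∈ a'.vars) :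
    (Rule.strong h b).IsSafe := by
  rintro x (⟨a, ha, hx⟩ | ⟨a, ha | ha, hx⟩ | ⟨g, hgb, hx⟩)
  · exact hh a ha x hx
  · exact ⟨a, ha, hx⟩
  · exact hneg a ha x hx
  · exact hg g hgb x hx

theorem isSafe_fact {a : MAtom C P} (ha : ∀ x, x ∉ a.vars) : (fact a).IsSafe :=
  isSafe_strong (by simp [Head.atoms, ha]) (by simp) (by simp)

theorem isSafe_forbid {as : List (MAtom C P)} (h : ∀ a ∈ as, ∀ x, x ∉ a.vars) :
    (forbid as).IsSafe :=
  isSafe_strong (by simp [Head.atoms]) (fun a ha x hx => absurd hx (h a ha x)) (by simp)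

theorem isSafe_append {a : MAtom C P} (ha : ∀ x, x ∉ a.vars) {r : MRule C P} (hr : r.IsSafe) :
    (append a r).IsSafe := by
  cases r with
  | strong h b =>
    refine isSafe_strong ?_ ?_ ?_
    · intro a' ha' x hx
      obtain ⟨a'', h1, h2⟩ := hr x (Or.inl ⟨a', ha', hx⟩)
      exact ⟨a'', List.mem_append_left _ h1, h2⟩
    · intro a' ha' x hx
      obtain ⟨a'', h1, h2⟩ := hr x (Or.inr (Or.inl ⟨a', Or.inr ha', hx⟩))
      exact ⟨a'', List.mem_append_left _ h1, h2⟩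
    · intro g hg x hx
      obtain ⟨a'', h1, h2⟩ := hr x (Or.inr (Or.inr ⟨g, hg, hx⟩))
      exact ⟨a'', List.mem_append_left _ h1, h2⟩
  | weak b wt lev ts =>
    intro x hx
    have : x ∈ (Rule.weak b wt lev ts).vars ∨ x ∈ a.vars := by
      rcases hx with (((⟨a', ha' | ha', hx⟩ | hx) | hx) | hx) | hx
      · rcases List.mem_append.1 ha' with h | h
        · exact Or.inl (Or.inl (Or.inl (Or.inl (Or.inl ⟨a', Or.inl h, hx⟩))))
        · rw [List.mem_singleton.1 h] at hx; exact Or.inr hx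
      · exact Or.inl (Or.inl (Or.inl (Or.inl (Or.inl ⟨a', Or.inr ha', hx⟩))))
      · exact Or.inl (Or.inl (Or.inl (Or.inl (Or.inr hx))))
      · exact Or.inl (Or.inl (Or.inl (Or.inr hx)))
      · exact Or.inl (Or.inl (Or.inr hx))
      · exact Or.inl (Or.inr hx)
    rcases this with h | h
    · obtain ⟨a'', h1, h2⟩ := hr x h
      exact ⟨a'', List.mem_append_left _ h1, h2⟩
    · exact absurd h (ha x)

theorem isSafe_reify {h : Head C ℕ P} {b : Body C ℕ P} (hr : (Rule.strong h b).IsSafe) :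
    (append ⟨.as, [mv .X]⟩ (.strong (reifyHead .inAs (mv .X) h)
      (reifyBody .inAs (mv .X) b))).IsSafe := by
  have key : ∀ a : OAtom C P, (∀ y ∈ a.vars, y ∈ (Rule.strong h b).vars) →
      ∀ x ∈ (reifyAtom .inAs (mv .X) a).vars,
      ∃ a' ∈ b.pos.map (reifyAtom .inAs (mv .X)) ++ [(⟨.as, [mv .X]⟩ : MAtom C P)],
        x ∈ a'.vars := by
    intro a ha x hx
    rcases mem_vars_reifyAtom.1 hx with ⟨y, hy, rfl⟩ | hx
    · obtain ⟨a', ha', hy'⟩ := hr y (ha y hy)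
      exact ⟨_, List.mem_append_left _ (List.mem_map_of_mem ha'),
        mem_vars_reifyAtom.2 (Or.inl ⟨y, hy', rfl⟩)⟩
    · exact ⟨_, List.mem_append_right _ (List.mem_singleton.2 rfl), by simpa [mem_vars_atom] using hx⟩
  refine isSafe_strong (fun a ha => ?_) (fun a ha => ?_) (by simp [reifyBody])
  · obtain ⟨a', ha', rfl⟩ : ∃ a' ∈ h.atoms, a = reifyAtom .inAs (mv .X) a' := by
      cases h with
      | atom a' => exact ⟨a', by simp [Head.atoms], by simpa [reifyHead, Head.atoms] using ha⟩
      | bot => simp [reifyHead, Head.atoms] at ha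
      | choice l hs u =>
        obtain ⟨a', ha', rfl⟩ := List.mem_map.1 ha
        exact ⟨a', ha', rfl⟩
    exact key a' fun y hy => Or.inl ⟨a', ha', hy⟩
  · obtain ⟨a', ha', rfl⟩ := List.mem_map.1 ha
    exact key a' (vars_subset_of_mem_neg (r := .strong h b) ha')

theorem isSafe_metaWeak {b : Body C ℕ P} {wt lev : Term C ℕ} {ts : List (Term C ℕ)}
    (hr : (Rule.weak b wt lev ts).IsSafe) (p₁ p₂ : MetaPred) :
    (metaWeak p₁ p₂ b wt lev ts).IsSafe := by
  have key : ∀ x : MetaVar, ((∃ y ∈ (Rule.weak b wt lev ts).vars, x = .obj y) ∨ x = .X) →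
      ∃ a' ∈ (⟨p₂, [mv .X]⟩ : MAtom C P) :: b.pos.map (reifyAtom p₁ (mv .X)), x ∈ a'.vars := by
    rintro x (⟨y, hy, rfl⟩ | rfl)
    · obtain ⟨a', ha', hy'⟩ := hr y hy
      exact ⟨_, List.mem_cons_of_mem _ (List.mem_map_of_mem ha'),
        mem_vars_reifyAtom.2 (Or.inl ⟨y, hy', rfl⟩)⟩
    · exact ⟨_, List.mem_cons_self, by simp [mem_vars_atom]⟩
  refine isSafe_strong (fun a ha => ?_) (fun a ha => ?_) (by simp)
  · rw [List.mem_singleton.1 ha]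
    rintro x ⟨t, ht, hx⟩
    apply key
    simp only [List.mem_cons, List.not_mem_nil, or_false] at ht
    rcases ht with rfl | rfl | rfl | rfl
    · obtain ⟨y, hy, rfl⟩ := mem_vars_ofTerm.1 hx
      exact Or.inl ⟨y, Or.inl (Or.inl (Or.inr hy)), rfl⟩
    · obtain ⟨y, hy, rfl⟩ := mem_vars_ofTerm.1 hx
      exact Or.inl ⟨y, Or.inl (Or.inr hy), rfl⟩
    · obtain ⟨t, ht, hx⟩ := (Term.mem_vars_app ..).1 hx
      obtain ⟨t, ht', rfl⟩ := List.mem_map.1 ht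
      obtain ⟨y, hy, rfl⟩ := mem_vars_ofTerm.1 hx
      exact Or.inl ⟨y, Or.inr ⟨t, ht', hy⟩, rfl⟩
    · exact Or.inr (by simpa using hx)
  · obtain ⟨a', ha', rfl⟩ := List.mem_map.1 ha
    intro x hx
    apply key
    rcases mem_vars_reifyAtom.1 hx with ⟨y, hy, rfl⟩ | hx
    · exact Or.inl ⟨y, vars_subset_of_mem_neg (r := .weak b wt lev ts) ha' y hy, rfl⟩
    · exact Or.inr (by simpa using hx)

theorem isSafe_reductBody {h : Head C ℕ P} {b : Body C ℕ P} (hr : (Rule.strong h b).IsSafe)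
    {a : MAtom C P} {pos : List (MAtom C P)}
    {guards : List (Guard (MetaFn C P) MetaVar MetaPred)}
    (ha : ∀ x ∈ a.vars, (∃ y ∈ (Rule.strong h b).vars, x = .obj y) ∨ x = .X)
    (hg : ∀ g ∈ guards, ∀ x ∈ g.vars, (∃ y ∈ (Rule.strong h b).vars, x = .obj y) ∨ x = .X) :
    (Rule.strong (.atom a) (reductBody b pos guards)).IsSafe := by
  have key : ∀ x : MetaVar, ((∃ y ∈ (Rule.strong h b).vars, x = .obj y) ∨ x = .X) →
      ∃ a' ∈ (reductBody b pos guards).pos, x ∈ a'.vars := by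
    rintro x (⟨y, hy, rfl⟩ | rfl)
    · obtain ⟨a', ha', hy'⟩ := hr y hy
      exact ⟨_, List.mem_append_left _ (List.mem_append_left _ (List.mem_map_of_mem ha')),
        mem_vars_reifyAtom.2 (Or.inl ⟨y, hy', rfl⟩)⟩
    · exact ⟨⟨.vs, [mv .X]⟩, by simp [reductBody], by simp [mem_vars_atom]⟩
  refine isSafe_strong (fun a' ha' x hx => ?_) (fun a' ha' x hx => ?_)
    (fun g hg' x hx => key x (hg g hg' x hx))
  · rw [List.mem_singleton.1 ha'] at hx
    exact key x (ha x hx)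
  · obtain ⟨a', ha₀, rfl⟩ := List.mem_map.1 ha'
    apply key
    rcases mem_vars_reifyAtom.1 hx with ⟨y, hy, rfl⟩ | hx
    · exact Or.inl ⟨y, vars_subset_of_mem_neg (r := .strong h b) ha₀ y hy, rfl⟩
    · exact Or.inr (by simpa using hx)

theorem isSafe_reductify {h : Head C ℕ P} {b : Body C ℕ P} (hr : (Rule.strong h b).IsSafe) :
    ∀ r ∈ reductify h b, r.IsSafe := by
  have key : ∀ a ∈ h.atoms, ∀ p, ∀ x ∈ (reifyAtom p (mv .X) a).vars,
      (∃ y ∈ (Rule.strong h b).vars, x = .obj y) ∨ x = .X := by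
    intro a ha p x hx
    rcases mem_vars_reifyAtom.1 hx with ⟨y, hy, rfl⟩ | hx
    · exact Or.inl ⟨y, Or.inl ⟨a, ha, hy⟩, rfl⟩
    · exact Or.inr (by simpa using hx)
  have hbot : ∀ x ∈ (mmrBot : MAtom C P).vars,
      (∃ y ∈ (Rule.strong h b).vars, x = .obj y) ∨ x = .X := by
    intro x hx
    simp only [mmrBot, mem_vars_atom, List.mem_cons, List.not_mem_nil, or_false, exists_eq_or_imp,
      not_mem_vars_idt, false_or, exists_eq_left, mem_vars_mv] at hx
    exact Or.inr hx
  intro r hr'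
  cases h with
  | atom a =>
    obtain rfl := hr'
    exact isSafe_reductBody hr (key a (by simp [Head.atoms]) _) (by simp)
  | bot =>
    obtain rfl := hr'
    exact isSafe_reductBody hr hbot (by simp)
  | choice l hs u =>
    have hcard : ∀ lo hi, ∀ g ∈ [Guard.card lo (hs.map (reifyAtom .inVs (mv .X))) hi],
        ∀ x ∈ g.vars, (∃ y ∈ (Rule.strong (.choice l hs u) b).vars, x = .obj y) ∨ x = .X := by
      intro lo hi g hg x hx
      rw [List.mem_singleton.1 hg] at hx
      obtain ⟨t, ⟨a, ha, ht⟩, hx⟩ := hx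
      obtain ⟨a, ha', rfl⟩ := List.mem_map.1 ha
      exact key a ha' .inVs x ⟨t, ht, hx⟩
    rcases hr' with ⟨a, ha, rfl⟩ | rfl | rfl
    · exact isSafe_reductBody hr (key a ha _) (hcard _ _)
    · exact isSafe_reductBody hr hbot (hcard _ _)
    · exact isSafe_reductBody hr hbot (hcard _ _)

theorem isSafe_cover {e : PartialInterp C P} (he : e.IsGround) (f : MetaFn C P) :
    ∀ r ∈ cover e (idt f), r.IsSafe := by
  rintro r (rfl | rfl)
  · refine isSafe_strong ?_ ?_ (by simp)
    · simp [Head.atoms, mem_vars_atom]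
    · simp only [List.mem_map, Finset.mem_toList, forall_exists_index, and_imp,
        forall_apply_eq_imp_iff₂]
      intro a ha x hx
      exact absurd hx (not_mem_vars_reifyAtom_idt (he.2 a ha))
  · exact isSafe_forbid (by simp [mem_vars_atom])

theorem isSafe_dominates (f g : MetaFn C P) : ∀ r ∈ dominates (idt f) (idt g), r.IsSafe := by
  -- The weight and the tuple are local to the aggregate, so the level is its only global variable,
  -- and it is bound by lv(L).
  have hsum : ∀ f g : MetaFn C P, ∀ x ∈ (sumGuard (idt f) (idt g)).vars, x = .L := by
    rintro f g x ⟨hx, t, ⟨e, he, ht⟩, hxt⟩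
    simp only [List.mem_cons, List.not_mem_nil, or_false] at he
    rcases he with rfl | rfl <;>
    · simp only [List.mem_cons, List.not_mem_nil, or_false] at ht
      rcases ht with (rfl | rfl | rfl | rfl) | rfl <;> simp_all
  rintro r (rfl | rfl | rfl | rfl)
  · refine isSafe_strong ?_ (by simp) ?_
    · simp [Head.atoms, mem_vars_atom]
    · simp only [List.mem_singleton, forall_eq]
      intro x hx
      simp [hsum _ _ x hx, mem_vars_atom]
  · refine isSafe_strong ?_ (by simp) ?_
    · simp [Head.atoms, mem_vars_atom]
    · simp only [List.mem_singleton, forall_eq]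
      intro x hx
      simp [hsum _ _ x hx, mem_vars_atom]
  · refine isSafe_strong ?_ (by simp) ?_
    · simp [Head.atoms, mem_vars_atom]
    · simp [Guard.vars, Guard.terms, mem_vars_atom]
  · refine isSafe_strong ?_ ?_ (by simp)
    · simp [Head.atoms, mem_vars_atom]
    · simp [mem_vars_atom]

/-- The interpretations in a list of violating reasons consist of ground atoms. -/
def GroundReasons (VR : List (Reason C P)) : Prop :=
  (∀ I, .interp I ∈ VR → ∀ a ∈ I, a.IsGround) ∧
    ∀ I₁ I₂, .pair I₁ I₂ ∈ VR → (∀ a ∈ I₁, a.IsGround) ∧ ∀ a ∈ I₂, a.IsGround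

theorem isSafe_levelFacts (T : Task C P) : ∀ r ∈ levelFacts T, r.IsSafe := by
  rintro r ⟨l, -, rfl⟩
  exact isSafe_fact (by simp [mem_vars_atom])

theorem isSafe_interpFacts {I : Set (OAtom C P)} (hI : ∀ a ∈ I, a.IsGround) (f : MetaFn C P) :
    ∀ r ∈ interpFacts I (idt f), r.IsSafe := by
  rintro r ⟨a, ha, rfl⟩
  exact isSafe_fact fun x => not_mem_vars_reifyAtom_idt (hI a ha)

theorem isSafe_taskMeta (T : Task C P) : ∀ r ∈ taskMeta T, r.IsSafe := by
  rintro r (((((hr | hr) | hr) | hr) | hr) | hr)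
  · rcases hr with ⟨h, b, hr, rfl⟩ | ⟨b, wt, lev, ts, hr, rfl⟩
    · exact isSafe_reify (T.background_safe _ hr)
    · exact isSafe_metaWeak (T.background_safe _ hr) _ _
  · rcases hr with ((⟨h, b, hr, rfl⟩ | ⟨b, wt, lev, ts, hr, rfl⟩) | ⟨R, hR, rfl⟩) | rfl
    · exact isSafe_append (by simp) (isSafe_reify (T.space_safe _ hr))
    · exact isSafe_append (by simp) (isSafe_metaWeak (T.space_safe _ hr) _ _)
    · simp [Rule.IsSafe, Rule.vars, Body.vars]
    · exact isSafe_strong (by simp [Head.atoms]) (by simp) (by simp)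
  · obtain ⟨e, he, hr | rfl⟩ := hr
    · exact isSafe_cover (T.pos_ground e he) _ r hr
    · exact isSafe_fact (by simp [mem_vars_atom])
  · rcases hr with ⟨e, he, rfl | rfl⟩ | rfl | rfl
    · refine isSafe_strong (by simp [Head.atoms, mem_vars_atom]) ?_ (by simp)
      simp only [List.mem_map, Finset.mem_toList, forall_exists_index, and_imp,
        forall_apply_eq_imp_iff₂]
      intro a ha x hx
      exact absurd hx (not_mem_vars_reifyAtom_idt ((T.neg_ground e he).2 a ha))
    · exact isSafe_fact (by simp [mem_vars_atom])
    · exact isSafe_strong (by simp [Head.atoms, mem_vars_atom]) (by simp) (by simp)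
    · simp [Rule.IsSafe, Rule.vars, Body.vars, mem_vars_atom]
  · rcases hr with ⟨o, ho, rfl | rfl | hr | hr | hr | rfl⟩ | hr
    · exact isSafe_fact (by simp [mem_vars_atom])
    · exact isSafe_fact (by simp [mem_vars_atom])
    · exact isSafe_cover (T.pos_ground _ (T.brave_over_pos o ho).1) _ r hr
    · exact isSafe_cover (T.pos_ground _ (T.brave_over_pos o ho).2) _ r hr
    · exact isSafe_dominates _ _ r hr
    · exact isSafe_forbid (by simp [mem_vars_atom])
    · exact isSafe_levelFacts T r hr
  · rcases hr with ⟨o, ho, hr | rfl⟩ | rfl | rfl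
    · exact isSafe_dominates _ _ r hr
    · exact isSafe_strong (by simp [Head.atoms, mem_vars_atom]) (by simp [mem_vars_atom]) (by simp)
    · exact isSafe_strong (by simp [Head.atoms, mem_vars_atom]) (by simp) (by simp)
    · exact isSafe_strong (by simp [Head.atoms, mem_vars_atom]) (by simp) (by simp)

theorem isSafe_reasonsMeta (T : Task C P) {VR : List (Reason C P)} (hVR : GroundReasons VR) :
    ∀ r ∈ reasonsMeta T VR, r.IsSafe := by
  rintro r ((hr | hr) | hr)
  · obtain ⟨I, hI, hr | rfl | rfl⟩ := hr
    · exact isSafe_interpFacts (hVR.1 I hI) _ r hr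
    · exact isSafe_forbid (by simp [mem_vars_atom])
    · exact isSafe_fact (by simp [mem_vars_atom])
  · obtain ⟨I₁, I₂, hI, hr | hr | hr | rfl | rfl | rfl⟩ := hr
    · exact isSafe_dominates _ _ r hr
    · exact isSafe_interpFacts (hVR.2 I₁ I₂ hI).1 _ r hr
    · exact isSafe_interpFacts (hVR.2 I₁ I₂ hI).2 _ r hr
    · exact isSafe_fact (by simp [mem_vars_atom])
    · exact isSafe_fact (by simp [mem_vars_atom])
    · exact isSafe_forbid (by simp [mem_vars_atom])
  · rcases hr with ((((⟨h, b, hr, hr'⟩ | rfl | rfl) | ⟨h, b, hr, r', hr', rfl⟩) |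
      ⟨b, wt, lev, ts, hr, rfl⟩) | ⟨b, wt, lev, ts, hr, rfl⟩) | hr
    · exact isSafe_reductify (T.background_safe _ hr) r hr'
    · exact isSafe_strong (by simp [Head.atoms, mem_vars_atom]) (by simp [mem_vars_atom]) (by simp)
    · exact isSafe_strong (by simp [Head.atoms, mem_vars_atom]) (by simp [mem_vars_atom]) (by simp)
    · exact isSafe_append (by simp) (isSafe_reductify (T.space_safe _ hr) r' hr')
    · exact isSafe_append (by simp) (isSafe_metaWeak (T.space_safe _ hr) _ _)
    · exact isSafe_metaWeak (T.background_safe _ hr) _ _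
    · exact isSafe_levelFacts T r hr

/-- The stored interpretations become facts, which are safe only if their atoms are ground. -/
theorem isSafe_metaProgram (T : Task C P) {VR : List (Reason C P)} (hVR : GroundReasons VR) :
    ∀ r ∈ metaProgram T VR, r.IsSafe := by
  rintro r (hr | hr)
  · exact isSafe_taskMeta T r hr
  · exact isSafe_reasonsMeta T hVR r hr

end LOAS

/-! ## Immediate consequences of the meta programs -/

namespace LOAS

open ASP

universe u v

variable {C : Type u} {P : Type v}

/-- The rules of the background and of the hypothesis represented by `M`. -/
def prog (T : Task C P) (M : Set (MAtom C P)) : Set (ORule C P) :=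
  {r | r ∈ T.background ∨ (r ∈ T.space ∧ inH r ∈ M)}

theorem prog_mono (T : Task C P) {M M' : Set (MAtom C P)} (h : M ⊆ M') : prog T M ⊆ prog T M' := by
  rintro r (hr | ⟨hr, hM⟩)
  · exact Or.inl hr
  · exact Or.inr ⟨hr, h hM⟩

/-- The identifiers `t` with a fact `as(t)`. -/
def asIds (T : Task C P) : Set (MTerm C P) :=
  {t | (∃ e ∈ T.pos, t = idt (.posId e)) ∨ (T.neg.Nonempty ∧ t = idt .negId) ∨
    ∃ o ∈ T.brave, t = idt (.ordId₁ o) ∨ t = idt (.ordId₂ o)}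

/-- The pairs `(e, t)` with a program `cover(e, t)`. -/
def covers (T : Task C P) : Set (PartialInterp C P × MTerm C P) :=
  {q | (∃ e ∈ T.pos, q = (e, idt (.posId e))) ∨
    ∃ o ∈ T.brave, q = (o.1, idt (.ordId₁ o)) ∨ q = (o.2, idt (.ordId₂ o))}

/-- The interpretations in `VR`, with their identifiers. -/
def reasonIds (VR : List (Reason C P)) : Set (Set (OAtom C P) × MTerm C P) :=
  {q | (∃ I, .interp I ∈ VR ∧ q = (I, idt (.interpId I))) ∨ ∃ I₁ I₂, .pair I₁ I₂ ∈ VR ∧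
    (q = (I₁, idt (.pairId₁ I₁ I₂)) ∨ q = (I₂, idt (.pairId₂ I₁ I₂)))}

/-- The pairs `(t₁, t₂)` with a program `dominates(t₁, t₂)`. -/
def comparisons (T : Task C P) (VR : List (Reason C P)) : Set (MTerm C P × MTerm C P) :=
  {q | (∃ o ∈ T.brave, q = (idt (.ordId₁ o), idt (.ordId₂ o))) ∨
    (∃ o ∈ T.cautious, q = (idt (.posId o.1), idt (.posId o.2))) ∨
    ∃ I₁ I₂, .pair I₁ I₂ ∈ VR ∧ q = (idt (.pairId₁ I₁ I₂), idt (.pairId₂ I₁ I₂))}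

/-- The sum of the weights `W` over the atoms `w(W, L, A, t)` in `A`. -/
noncomputable def weightSum (A : Set (MAtom C P)) (t L : MTerm C P) : ℤ :=
  ∑ᶠ p ∈ {p : MAtom C P × ℤ | p.1 ∈ A ∧ ∃ θ : MetaVar → MTerm C P,
    (⟨.w, [mv .W, L, mv .A, t]⟩ : MAtom C P).subst θ = p.1 ∧ (mv .W).subst θ = .int p.2}, p.2

/-- `Step T VR A M o`: the head `o` is derived in one step from `M` by the reduct of
`T_meta ∪ VR_meta(T)` with respect to `A`. -/
inductive Step (T : Task C P) (VR : List (Reason C P)) (A M : Set (MAtom C P)) :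
    Option (MAtom C P) → Prop
  | inAs (t : MTerm C P) (a : OAtom C P) :
      Derives (fullReduct (prog T M) (slice .inAs A t)) (slice .inAs M t) (some a) →
      (⟨.as, [t]⟩ : MAtom C P) ∈ M → Step T VR A M (some (reifyAtom .inAs t a))
  | hard (t : MTerm C P) :
      Derives (fullReduct (prog T M) (slice .inAs A t)) (slice .inAs M t) none →
      (⟨.as, [t]⟩ : MAtom C P) ∈ M → Step T VR A M none
  | weightAs (t : MTerm C P) (p : Term C ℕ × Term C ℕ × List (Term C ℕ)) :
      WeakDerives (prog T M) (slice .inAs A t) (slice .inAs M t) p →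
      (⟨.as, [t]⟩ : MAtom C P) ∈ M → Step T VR A M (some (weightAtom p t))
  | hyp (r : ORule C P) : r ∈ T.space → inH r ∈ A → Step T VR A M (some (inH r))
  | as (t : MTerm C P) : t ∈ asIds T → Step T VR A M (some ⟨.as, [t]⟩)
  | cov (e : PartialInterp C P) (t : MTerm C P) : (e, t) ∈ covers T →
      (∀ a ∈ e.inc, reifyAtom .inAs t a ∈ M) → (∀ a ∈ e.exc, reifyAtom .inAs t a ∉ A) →
      Step T VR A M (some ⟨.cov, [t]⟩)
  | uncovered (e : PartialInterp C P) (t : MTerm C P) : (e, t) ∈ covers T →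
      (⟨.cov, [t]⟩ : MAtom C P) ∉ A → Step T VR A M none
  | vi (e : PartialInterp C P) : e ∈ T.neg →
      (∀ a ∈ e.inc, reifyAtom .inAs (idt .negId) a ∈ M) →
      (∀ a ∈ e.exc, reifyAtom .inAs (idt .negId) a ∉ A) → Step T VR A M (some ⟨.vi, []⟩)
  | violatingVi : (⟨.vi, []⟩ : MAtom C P) ∈ M → Step T VR A M (some ⟨.violating, []⟩)
  | violatingVp : (⟨.vp, []⟩ : MAtom C P) ∈ M → Step T VR A M (some ⟨.violating, []⟩)
  | vp (o : PartialInterp C P × PartialInterp C P) : o ∈ T.cautious →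
      (⟨.dom, [idt (.posId o.1), idt (.posId o.2)]⟩ : MAtom C P) ∉ A →
      Step T VR A M (some ⟨.vp, [idt (.posId o.1), idt (.posId o.2)]⟩)
  | vpNil (t₁ t₂ : MTerm C P) : (⟨.vp, [t₁, t₂]⟩ : MAtom C P) ∈ M →
      Step T VR A M (some ⟨.vp, []⟩)
  | brave (o : PartialInterp C P × PartialInterp C P) : o ∈ T.brave →
      (⟨.dom, [idt (.ordId₁ o), idt (.ordId₂ o)]⟩ : MAtom C P) ∉ A → Step T VR A M none
  | lv (l : ℤ) : l ∈ levels ((T.background : Set (ORule C P)) ∪ T.space) →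
      Step T VR A M (some ⟨.lv, [.int l]⟩)
  | domLv (t₁ t₂ L : MTerm C P) : (t₁, t₂) ∈ comparisons T VR →
      (⟨.lv, [L]⟩ : MAtom C P) ∈ M → weightSum A t₁ L < weightSum A t₂ L →
      Step T VR A M (some ⟨.domLv, [t₁, t₂, L]⟩)
  | nonDomLv (t₁ t₂ L : MTerm C P) : (t₁, t₂) ∈ comparisons T VR →
      (⟨.lv, [L]⟩ : MAtom C P) ∈ M → weightSum A t₂ L < weightSum A t₁ L →
      Step T VR A M (some ⟨.nonDomLv, [t₁, t₂, L]⟩)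
  | nonBef (t₁ t₂ : MTerm C P) (l m : ℤ) : (t₁, t₂) ∈ comparisons T VR →
      (⟨.lv, [.int l]⟩ : MAtom C P) ∈ M → (⟨.lv, [.int m]⟩ : MAtom C P) ∈ M →
      (⟨.nonDomLv, [t₁, t₂, .int m]⟩ : MAtom C P) ∈ M → l < m →
      Step T VR A M (some ⟨.nonBef, [t₁, t₂, .int l]⟩)
  | dom (t₁ t₂ L : MTerm C P) : (t₁, t₂) ∈ comparisons T VR →
      (⟨.domLv, [t₁, t₂, L]⟩ : MAtom C P) ∈ M → (⟨.nonBef, [t₁, t₂, L]⟩ : MAtom C P) ∉ A →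
      Step T VR A M (some ⟨.dom, [t₁, t₂]⟩)
  | vs (I : Set (OAtom C P)) (t : MTerm C P) : (I, t) ∈ reasonIds VR →
      Step T VR A M (some ⟨.vs, [t]⟩)
  | inVs (I : Set (OAtom C P)) (t : MTerm C P) (a : OAtom C P) : (I, t) ∈ reasonIds VR → a ∈ I →
      Step T VR A M (some (reifyAtom .inVs t a))
  | mmr (t : MTerm C P) (a : OAtom C P) :
      Derives (fullReduct (prog T M) (slice .inVs A t)) (slice .mmr M t) (some a) →
      (⟨.vs, [t]⟩ : MAtom C P) ∈ M → Step T VR A M (some (reifyAtom .mmr t a))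
  | mmrBot (t : MTerm C P) :
      Derives (fullReduct (prog T M) (slice .inVs A t)) (slice .mmr M t) none →
      (⟨.vs, [t]⟩ : MAtom C P) ∈ M → Step T VR A M (some ⟨.mmr, [idt .bot, t]⟩)
  | weightVs (t : MTerm C P) (p : Term C ℕ × Term C ℕ × List (Term C ℕ)) :
      WeakDerives (prog T M) (slice .inVs A t) (slice .inVs M t) p →
      (⟨.vs, [t]⟩ : MAtom C P) ∈ M → Step T VR A M (some (weightAtom p t))
  | nasInVs (y t : MTerm C P) : (⟨.inVs, [y, t]⟩ : MAtom C P) ∈ M →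
      (⟨.mmr, [y, t]⟩ : MAtom C P) ∉ A → Step T VR A M (some ⟨.nas, [t]⟩)
  | nasMmr (y t : MTerm C P) : (⟨.mmr, [y, t]⟩ : MAtom C P) ∈ M →
      (⟨.inVs, [y, t]⟩ : MAtom C P) ∉ A → Step T VR A M (some ⟨.nas, [t]⟩)
  | interp (I : Set (OAtom C P)) : .interp I ∈ VR →
      (⟨.nas, [idt (.interpId I)]⟩ : MAtom C P) ∉ A → Step T VR A M none
  | pair (I₁ I₂ : Set (OAtom C P)) : .pair I₁ I₂ ∈ VR →
      (⟨.nas, [idt (.pairId₁ I₁ I₂)]⟩ : MAtom C P) ∉ A →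
      (⟨.nas, [idt (.pairId₂ I₁ I₂)]⟩ : MAtom C P) ∉ A →
      (⟨.dom, [idt (.pairId₁ I₁ I₂), idt (.pairId₂ I₁ I₂)]⟩ : MAtom C P) ∉ A → Step T VR A M none

/-- Negative literals and aggregates are evaluated in `A`, so everything that is evaluated in `M`
occurs positively, including the choice of rules in `prog T M`. -/
theorem Step.mono {T : Task C P} {VR : List (Reason C P)} {A M M' : Set (MAtom C P)}
    (hM : M ⊆ M') {o : Option (MAtom C P)} (h : Step T VR A M o) : Step T VR A M' o := by
  have hd : ∀ {p q : MetaPred} {t : MTerm C P} {o : Option (OAtom C P)},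
      Derives (fullReduct (prog T M) (slice p A t)) (slice q M t) o →
      Derives (fullReduct (prog T M') (slice p A t)) (slice q M' t) o :=
    fun h => h.mono (fullReduct_mono (prog_mono T hM) _) (slice_mono hM _)
  have hw : ∀ {p q : MetaPred} {t : MTerm C P} {o : Term C ℕ × Term C ℕ × List (Term C ℕ)},
      WeakDerives (prog T M) (slice p A t) (slice q M t) o →
      WeakDerives (prog T M') (slice p A t) (slice q M' t) o :=
    fun h => h.mono (prog_mono T hM) (slice_mono hM _)
  cases h with
  | inAs t a h1 h2 => exact .inAs t a (hd h1) (hM h2)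
  | hard t h1 h2 => exact .hard t (hd h1) (hM h2)
  | weightAs t p h1 h2 => exact .weightAs t p (hw h1) (hM h2)
  | hyp r h1 h2 => exact .hyp r h1 h2
  | as t h => exact .as t h
  | cov e t h1 h2 h3 => exact .cov e t h1 (fun a ha => hM (h2 a ha)) h3
  | uncovered e t h1 h2 => exact .uncovered e t h1 h2
  | vi e h1 h2 h3 => exact .vi e h1 (fun a ha => hM (h2 a ha)) h3
  | violatingVi h => exact .violatingVi (hM h)
  | violatingVp h => exact .violatingVp (hM h)
  | vp o h1 h2 => exact .vp o h1 h2
  | vpNil t₁ t₂ h => exact .vpNil t₁ t₂ (hM h)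
  | brave o h1 h2 => exact .brave o h1 h2
  | lv l h => exact .lv l h
  | domLv t₁ t₂ L h1 h2 h3 => exact .domLv t₁ t₂ L h1 (hM h2) h3
  | nonDomLv t₁ t₂ L h1 h2 h3 => exact .nonDomLv t₁ t₂ L h1 (hM h2) h3
  | nonBef t₁ t₂ l m h1 h2 h3 h4 h5 => exact .nonBef t₁ t₂ l m h1 (hM h2) (hM h3) (hM h4) h5
  | dom t₁ t₂ L h1 h2 h3 => exact .dom t₁ t₂ L h1 (hM h2) h3
  | vs I t h => exact .vs I t h
  | inVs I t a h1 h2 => exact .inVs I t a h1 h2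
  | mmr t a h1 h2 => exact .mmr t a (hd h1) (hM h2)
  | mmrBot t h1 h2 => exact .mmrBot t (hd h1) (hM h2)
  | weightVs t p h1 h2 => exact .weightVs t p (hw h1) (hM h2)
  | nasInVs y t h1 h2 => exact .nasInVs y t (hM h1) h2
  | nasMmr y t h1 h2 => exact .nasMmr y t (hM h1) h2
  | interp I h1 h2 => exact .interp I h1 h2
  | pair I₁ I₂ h1 h2 h3 h4 => exact .pair I₁ I₂ h1 h2 h3 h4

/-! ### Instances of the individual meta rules. -/

section

variable {A M : Set (MAtom C P)} {o : Option (MAtom C P)}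

theorem derives_rule_iff {h : MAtom C P} {pos neg : List (MAtom C P)}
    {guards : List (Guard (MetaFn C P) MetaVar MetaPred)} :
    Derives (fullReduct {rule h pos neg guards} A) M o ↔ ∃ σ : MetaVar → MTerm C P,
      (∀ a ∈ pos, a.subst σ ∈ M) ∧ (∀ a ∈ neg, a.subst σ ∉ A) ∧
      (∀ g ∈ guards, (g.subst σ).Holds A) ∧ o = some (h.subst σ) :=
  derives_strong_iff

theorem derives_fact_iff {a : MAtom C P} (ha : ∀ σ, a.subst σ = a) :
    Derives (fullReduct {fact a} A) M o ↔ o = some a := by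
  refine (derives_rule_iff (h := a) (pos := []) (neg := []) (guards := [])).trans ?_
  simp only [List.not_mem_nil, false_imp_iff, implies_true, true_and, ha]
  exact ⟨fun ⟨_, h⟩ => h, fun h => ⟨fun _ => .int 0, h⟩⟩

theorem derives_forbid_iff {as : List (MAtom C P)} (ha : ∀ a ∈ as, ∀ σ, a.subst σ = a) :
    Derives (fullReduct {forbid as} A) M o ↔ o = none ∧ ∀ a ∈ as, a ∉ A := by
  refine derives_strong_iff.trans ?_
  simp only [List.not_mem_nil, false_imp_iff, implies_true, true_and]
  constructor
  · rintro ⟨σ, h1, h2⟩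
    exact ⟨h2, fun a h => ha a h σ ▸ h1 a h⟩
  · rintro ⟨h1, h2⟩
    refine ⟨fun _ => .int 0, fun a h => ?_, h1⟩
    rw [ha a h]
    exact h2 a h

/-- Instances of a rule whose body is a reified partial interpretation. -/
theorem derives_partialInterp_iff {e : PartialInterp C P} (he : e.IsGround) {f : MetaFn C P}
    {h : MAtom C P} (hh : ∀ σ, h.subst σ = h) :
    Derives (fullReduct {rule h (e.inc.toList.map (reifyAtom .inAs (idt f)))
        (e.exc.toList.map (reifyAtom .inAs (idt f))) []} A) M o ↔
      (∀ a ∈ e.inc, reifyAtom .inAs (idt f) a ∈ M) ∧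
      (∀ a ∈ e.exc, reifyAtom .inAs (idt f) a ∉ A) ∧ o = some h := by
  have hinc : ∀ a ∈ e.inc, ∀ σ : MetaVar → MTerm C P,
      (reifyAtom .inAs (idt f) a).subst σ = reifyAtom .inAs (idt f) a := fun a ha σ => by
    rw [reifyAtom_subst_of_isGround (he.1 a ha), idt_subst]
  have hexc : ∀ a ∈ e.exc, ∀ σ : MetaVar → MTerm C P,
      (reifyAtom .inAs (idt f) a).subst σ = reifyAtom .inAs (idt f) a := fun a ha σ => by
    rw [reifyAtom_subst_of_isGround (he.2 a ha), idt_subst]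
  simp only [derives_rule_iff, List.mem_map, Finset.mem_toList, forall_exists_index, and_imp,
    forall_apply_eq_imp_iff₂, List.not_mem_nil, false_imp_iff, implies_true, true_and, hh]
  constructor
  · rintro ⟨σ, h1, h2, h3⟩
    exact ⟨fun a ha => hinc a ha σ ▸ h1 a ha, fun a ha => hexc a ha σ ▸ h2 a ha, h3⟩
  · rintro ⟨h1, h2, h3⟩
    refine ⟨fun _ => .int 0, fun a ha => ?_, fun a ha => ?_, h3⟩
    · rw [hinc a ha]; exact h1 a ha
    · rw [hexc a ha]; exact h2 a ha

theorem derives_cover_iff {e : PartialInterp C P} (he : e.IsGround) {f : MetaFn C P} :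
    (∃ r ∈ cover e (idt f), Derives (fullReduct {r} A) M o) ↔
      ((∀ a ∈ e.inc, reifyAtom .inAs (idt f) a ∈ M) ∧
        (∀ a ∈ e.exc, reifyAtom .inAs (idt f) a ∉ A) ∧ o = some ⟨.cov, [idt f]⟩) ∨
      (o = none ∧ (⟨.cov, [idt f]⟩ : MAtom C P) ∉ A) := by
  have hcov : ∀ σ, (⟨.cov, [idt f]⟩ : MAtom C P).subst σ = ⟨.cov, [idt f]⟩ := by
    simp [Atom.subst]
  simp only [cover, Set.mem_insert_iff, Set.mem_singleton_iff, exists_eq_or_imp, exists_eq_left,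
    derives_partialInterp_iff he hcov]
  rw [derives_forbid_iff (by simpa using hcov)]
  simp

theorem holds_sumGuard_iff {f g : MetaFn C P} {σ : MetaVar → MTerm C P} :
    ((sumGuard (idt f) (idt g)).subst σ).Holds A ↔
      weightSum A (idt f) (σ .L) < weightSum A (idt g) (σ .L) := by
  simp [sumGuard, Guard.subst, Guard.Holds, SumElem.value, weightSum, Atom.subst, mv]

theorem derives_dominates_iff {f g : MetaFn C P} :
    (∃ r ∈ dominates (idt f) (idt g), Derives (fullReduct {r} A) M o) ↔
      (∃ L, (⟨.lv, [L]⟩ : MAtom C P) ∈ M ∧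
        weightSum A (idt f) L < weightSum A (idt g) L ∧ o = some ⟨.domLv, [idt f, idt g, L]⟩) ∨
      (∃ L, (⟨.lv, [L]⟩ : MAtom C P) ∈ M ∧
        weightSum A (idt g) L < weightSum A (idt f) L ∧ o = some ⟨.nonDomLv, [idt f, idt g, L]⟩) ∨
      (∃ l m : ℤ, (⟨.lv, [.int l]⟩ : MAtom C P) ∈ M ∧ (⟨.lv, [.int m]⟩ : MAtom C P) ∈ M ∧
        (⟨.nonDomLv, [idt f, idt g, .int m]⟩ : MAtom C P) ∈ M ∧ l < m ∧
        o = some ⟨.nonBef, [idt f, idt g, .int l]⟩) ∨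
      (∃ L, (⟨.domLv, [idt f, idt g, L]⟩ : MAtom C P) ∈ M ∧
        (⟨.nonBef, [idt f, idt g, L]⟩ : MAtom C P) ∉ A ∧ o = some ⟨.dom, [idt f, idt g]⟩) := by
  have hlt : ∀ (s t : MTerm C P) (σ : MetaVar → MTerm C P),
      ((Guard.lt s t : Guard (MetaFn C P) MetaVar MetaPred).subst σ).Holds A ↔
        ∃ a b : ℤ, s.subst σ = .int a ∧ t.subst σ = .int b ∧ a < b := fun _ _ _ => Iff.rfl
  simp only [dominates, Set.mem_insert_iff, Set.mem_singleton_iff, exists_eq_or_imp,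
    exists_eq_left, derives_rule_iff, List.mem_cons, List.not_mem_nil, or_false, forall_eq,
    false_imp_iff, implies_true, true_and, forall_eq_or_imp, holds_sumGuard_iff, Atom.subst,
    List.map_cons, List.map_nil, idt_subst, mv_subst, hlt]
  -- Three of the four rules have L as their only variable, so a constant substitution suffices; the
  -- remaining rule compares two levels.
  refine or_congr ⟨fun ⟨σ, h⟩ => ⟨σ .L, h⟩, fun ⟨L, h⟩ => ⟨fun _ => L, h⟩⟩
    (or_congr ⟨fun ⟨σ, h⟩ => ⟨σ .L, h⟩, fun ⟨L, h⟩ => ⟨fun _ => L, h⟩⟩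
    (or_congr ?_ ⟨fun ⟨σ, h⟩ => ⟨σ .L, h⟩, fun ⟨L, h⟩ => ⟨fun _ => L, h⟩⟩))
  constructor
  · rintro ⟨σ, ⟨h1, h2, h3⟩, ⟨l, m, h4, h5, h6⟩, rfl⟩
    rw [h4] at h1
    rw [h5] at h2 h3
    exact ⟨l, m, h1, h2, h3, h6, by rw [h4]⟩
  · rintro ⟨l, m, h1, h2, h3, h4, rfl⟩
    exact ⟨fun | .L => .int l | _ => .int m, ⟨h1, h2, h3⟩, ⟨l, m, rfl, rfl, h4⟩, rfl⟩

theorem count_nonneg (as : List (MAtom C P)) : 0 ≤ count A as := by simp [count]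

theorem count_le_length (as : List (MAtom C P)) : count A as ≤ as.length := by
  classical
  unfold count
  have h : {a | a ∈ as ∧ a ∈ A} ⊆ (as.toFinset : Set (MAtom C P)) := fun a ha => by simpa using ha.1
  have := (Set.ncard_le_ncard h).trans_eq (Set.ncard_coe_finset _)
  exact_mod_cast this.trans as.toFinset_card_le

/-- The bounds 0 and |S| hold for every interpretation, so this choice rule never yields `⊥` and H
is unrestricted. -/
theorem derives_hypChoice_iff {S : Finset (ORule C P)} :
    Derives (fullReduct {.strong (.choice 0 (S.toList.map inH) S.card) ⟨[], [], []⟩} A) M o ↔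
      ∃ r ∈ S, inH r ∈ A ∧ o = some (inH r) := by
  have hmap : ∀ σ, (S.toList.map inH).map (Atom.subst σ) = S.toList.map inH := by simp
  have hle := count_le_length (A := A) (S.toList.map inH)
  simp only [List.length_map, Finset.length_toList] at hle
  have : Nonempty (MetaVar → MTerm C P) := ⟨fun _ => .int 0⟩
  refine derives_strong_iff.trans (Iff.trans ?_ (exists_const (MetaVar → MTerm C P)))
  simp only [List.not_mem_nil, false_imp_iff, implies_true, true_and,
    Head.subst, hmap, Head.reduct, Set.mem_ofPred_eq, hle, count_nonneg, not_true,
    false_and, or_false, List.mem_map, Finset.mem_toList, exists_exists_and_eq_and]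

end

theorem reified_of_step {T : Task C P} {VR : List (Reason C P)} {A M : Set (MAtom C P)}
    {p : MetaPred} {y t : MTerm C P} (h : Step T VR A M (some ⟨p, [y, t]⟩))
    (hp : p = .inAs ∨ p = .inVs ∨ p = .mmr) : y = idt .bot ∨ ∃ a, y = ofAtom a := by
  generalize ho : some (⟨p, [y, t]⟩ : MAtom C P) = o at h
  -- Only four kinds of step produce these predicates: one for in_as, one for in_vs, and two for
  -- mmr, one of them with first argument `⊥`.
  cases h <;> simp only [Option.some.injEq, reifyAtom, weightAtom, inH, Atom.mk.injEq,
    List.cons.injEq, reduceCtorEq] at ho <;> obtain ⟨rfl, ho⟩ := ho <;> simp at hp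
  · exact Or.inr ⟨_, ho.1⟩
  · exact Or.inr ⟨_, ho.1⟩
  · exact Or.inr ⟨_, ho.1⟩
  · exact Or.inl ho.1

theorem mem_prog_of_background {T : Task C P} {M : Set (MAtom C P)} {r : ORule C P}
    (hr : r ∈ T.background) : r ∈ prog T M := Or.inl hr

theorem mem_prog_of_space {T : Task C P} {M : Set (MAtom C P)} {r : ORule C P}
    (hr : r ∈ T.space) (h : inH r ∈ M) : r ∈ prog T M := Or.inr ⟨hr, h⟩

/-! ### From derivations of the meta program to `Step`. -/

section

variable {T : Task C P} {VR : List (Reason C P)} {A M : Set (MAtom C P)} {o : Option (MAtom C P)}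

theorem step_of_derives_reify {h : Head C ℕ P} {b : Body C ℕ P} (hM : Reified M)
    (hr : (Rule.strong h b).IsSafe) (hb : (Rule.strong h b).IsBasic)
    (hp : Rule.strong h b ∈ prog T M)
    (hd : Derives (fullReduct {append ⟨.as, [mv .X]⟩
        (.strong (reifyHead .inAs (mv .X) h) (reifyBody .inAs (mv .X) b))} A) M o) :
    Step T VR A M o := by
  obtain ⟨t, o', hd', has, rfl⟩ := (derives_reify_iff hr hb.1 hM).1 hd
  replace hd' := derives_fullReduct_iff.2 ⟨_, hp, hd'⟩
  cases o' with
  | none => exact .hard t hd' has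
  | some a => exact .inAs t a hd' has

theorem step_of_derives_reductify {h : Head C ℕ P} {b : Body C ℕ P} (hM : Reified M)
    (hMA : M ⊆ A) (hr : (Rule.strong h b).IsSafe) (hb : (Rule.strong h b).IsBasic)
    (hp : Rule.strong h b ∈ prog T M)
    (hd : ∃ r ∈ reductify h b, Derives (fullReduct {r} A) M o) :
    Step T VR A M o := by
  obtain ⟨t, o', hd', hvs, rfl⟩ := (derives_reductify hr hb.1 hM).1 (fun _ _ h => hMA h) hd
  replace hd' := derives_fullReduct_iff.2 ⟨_, hp, hd'⟩
  cases o' with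
  | none => exact .mmrBot t hd' hvs
  | some a => exact .mmr t a hd' hvs

theorem step_of_derives_dominates {f g : MetaFn C P} (hc : (idt f, idt g) ∈ comparisons T VR)
    (hd : ∃ r ∈ dominates (idt f) (idt g), Derives (fullReduct {r} A) M o) :
    Step T VR A M o := by
  rcases derives_dominates_iff.1 hd with ⟨L, h1, h2, rfl⟩ | ⟨L, h1, h2, rfl⟩ |
    ⟨l, m, h1, h2, h3, h4, rfl⟩ | ⟨L, h1, h2, rfl⟩
  · exact .domLv _ _ L hc h1 h2
  · exact .nonDomLv _ _ L hc h1 h2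
  · exact .nonBef _ _ l m hc h1 h2 h3 h4
  · exact .dom _ _ L hc h1 h2

theorem step_of_derives_cover {e : PartialInterp C P} (he : e.IsGround) {f : MetaFn C P}
    (hc : (e, idt f) ∈ covers T)
    (hd : ∃ r ∈ cover e (idt f), Derives (fullReduct {r} A) M o) : Step T VR A M o := by
  rcases (derives_cover_iff he).1 hd with ⟨h1, h2, rfl⟩ | ⟨rfl, h⟩
  · exact .cov e _ hc h1 h2
  · exact .uncovered e _ hc h

theorem step_of_derives_levelFacts {r : MRule C P} (hr : r ∈ levelFacts T)
    (hd : Derives (fullReduct {r} A) M o) : Step T VR A M o := by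
  obtain ⟨l, hl, rfl⟩ := hr
  obtain rfl := (derives_fact_iff (by simp [Atom.subst])).1 hd
  exact .lv l hl

theorem step_of_derives_interpFacts {r : MRule C P} {I : Set (OAtom C P)} {f : MetaFn C P}
    (hI : (I, idt f) ∈ reasonIds VR) (hg : ∀ a ∈ I, a.IsGround) (hr : r ∈ interpFacts I (idt f))
    (hd : Derives (fullReduct {r} A) M o) : Step T VR A M o := by
  obtain ⟨a, ha, rfl⟩ := hr
  obtain rfl := (derives_fact_iff fun σ => by
    rw [reifyAtom_subst_of_isGround (hg a ha), idt_subst]).1 hd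
  exact .inVs I _ a hI ha

theorem step_of_derives_taskMeta (hM : Reified M)
    (h : Derives (fullReduct (taskMeta T) A) M o) : Step T VR A M o := by
  obtain ⟨r, hr, hd⟩ := derives_fullReduct_iff.1 h
  rcases hr with ((((hr | hr) | hr) | hr) | hr) | hr
  · rcases hr with ⟨h, b, hr, rfl⟩ | ⟨b, wt, lev, ts, hr, rfl⟩
    · exact step_of_derives_reify hM (T.background_safe _ hr) (T.background_basic _ hr)
        (mem_prog_of_background hr) hd
    · obtain ⟨t, p, hp, has, rfl⟩ :=
        (derives_metaWeak_iff (T.background_safe _ hr) (Or.inl rfl) hM).1 hd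
      exact .weightAs t p (weakDerives_iff.2 ⟨_, mem_prog_of_background hr, hp⟩) has
  · rcases hr with ((⟨h, b, hr, rfl⟩ | ⟨b, wt, lev, ts, hr, rfl⟩) | ⟨R, hR, rfl⟩) | rfl
    · obtain ⟨hin, hd⟩ := (derives_append_iff (by simp)).1 hd
      exact step_of_derives_reify hM (T.space_safe _ hr) (T.space_basic _ hr)
        (mem_prog_of_space hr hin) hd
    · obtain ⟨hin, hd⟩ := (derives_append_iff (by simp)).1 hd
      obtain ⟨t, p, hp, has, rfl⟩ :=
        (derives_metaWeak_iff (T.space_safe _ hr) (Or.inl rfl) hM).1 hd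
      exact .weightAs t p (weakDerives_iff.2 ⟨_, mem_prog_of_space hr hin, hp⟩) has
    · exact absurd hd not_derives_weak
    · obtain ⟨r, hr, hA, rfl⟩ := derives_hypChoice_iff.1 hd
      exact .hyp r hr hA
  · obtain ⟨e, he, hr | rfl⟩ := hr
    · exact step_of_derives_cover (T.pos_ground e he) (Or.inl ⟨e, he, rfl⟩) ⟨r, hr, hd⟩
    · obtain rfl := (derives_fact_iff (by simp [Atom.subst])).1 hd
      exact .as _ (Or.inl ⟨e, he, rfl⟩)
  · rcases hr with ⟨e, he, rfl | rfl⟩ | rfl | rfl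
    · obtain ⟨h1, h2, rfl⟩ := (derives_partialInterp_iff (T.neg_ground e he)
        (by simp [Atom.subst])).1 hd
      exact .vi e he h1 h2
    · obtain rfl := (derives_fact_iff (by simp [Atom.subst])).1 hd
      exact .as _ (Or.inr (Or.inl ⟨⟨e, he⟩, rfl⟩))
    · obtain ⟨σ, h1, -, -, rfl⟩ := derives_rule_iff.1 hd
      exact .violatingVi (by simpa [Atom.subst] using h1)
    · exact absurd hd not_derives_weak
  · rcases hr with ⟨o', ho, rfl | rfl | hr | hr | hr | rfl⟩ | hr
    · obtain rfl := (derives_fact_iff (by simp [Atom.subst])).1 hd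
      exact .as _ (Or.inr (Or.inr ⟨o', ho, Or.inl rfl⟩))
    · obtain rfl := (derives_fact_iff (by simp [Atom.subst])).1 hd
      exact .as _ (Or.inr (Or.inr ⟨o', ho, Or.inr rfl⟩))
    · exact step_of_derives_cover (T.pos_ground _ (T.brave_over_pos _ ho).1)
        (Or.inr ⟨o', ho, Or.inl rfl⟩) ⟨r, hr, hd⟩
    · exact step_of_derives_cover (T.pos_ground _ (T.brave_over_pos _ ho).2)
        (Or.inr ⟨o', ho, Or.inr rfl⟩) ⟨r, hr, hd⟩
    · exact step_of_derives_dominates (Or.inl ⟨o', ho, rfl⟩) ⟨r, hr, hd⟩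
    · obtain ⟨rfl, hA⟩ := (derives_forbid_iff (by simp [Atom.subst])).1 hd
      exact .brave o' ho (by simpa using hA)
    · exact step_of_derives_levelFacts hr hd
  · rcases hr with ⟨o', ho, hr | rfl⟩ | rfl | rfl
    · exact step_of_derives_dominates (Or.inr (Or.inl ⟨o', ho, rfl⟩)) ⟨r, hr, hd⟩
    · obtain ⟨σ, -, h2, -, rfl⟩ := derives_rule_iff.1 hd
      simpa [Atom.subst] using Step.vp (T := T) (VR := VR) (A := A) (M := M) o' ho
        (by simpa [Atom.subst] using h2)
    · obtain ⟨σ, h1, -, -, rfl⟩ := derives_rule_iff.1 hd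
      exact .vpNil (σ .T1) (σ .T2) (by simpa [Atom.subst] using h1)
    · obtain ⟨σ, h1, -, -, rfl⟩ := derives_rule_iff.1 hd
      exact .violatingVp (by simpa [Atom.subst] using h1)

theorem step_of_derives_reasonsMeta (hVR : GroundReasons VR) (hM : Reified M) (hMA : M ⊆ A)
    (h : Derives (fullReduct (reasonsMeta T VR) A) M o) : Step T VR A M o := by
  obtain ⟨r, hr, hd⟩ := derives_fullReduct_iff.1 h
  rcases hr with (hr | hr) | hr
  · obtain ⟨I, hI, hr | rfl | rfl⟩ := hr
    · exact step_of_derives_interpFacts (Or.inl ⟨I, hI, rfl⟩) (hVR.1 I hI) hr hd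
    · obtain ⟨rfl, hA⟩ := (derives_forbid_iff (by simp [Atom.subst])).1 hd
      exact .interp I hI (by simpa using hA)
    · obtain rfl := (derives_fact_iff (by simp [Atom.subst])).1 hd
      exact .vs I _ (Or.inl ⟨I, hI, rfl⟩)
  · obtain ⟨I₁, I₂, hI, hr | hr | hr | rfl | rfl | rfl⟩ := hr
    · exact step_of_derives_dominates (Or.inr (Or.inr ⟨I₁, I₂, hI, rfl⟩)) ⟨r, hr, hd⟩
    · exact step_of_derives_interpFacts (Or.inr ⟨I₁, I₂, hI, Or.inl rfl⟩) (hVR.2 I₁ I₂ hI).1 hr hd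
    · exact step_of_derives_interpFacts (Or.inr ⟨I₁, I₂, hI, Or.inr rfl⟩) (hVR.2 I₁ I₂ hI).2 hr hd
    · obtain rfl := (derives_fact_iff (by simp [Atom.subst])).1 hd
      exact .vs I₁ _ (Or.inr ⟨I₁, I₂, hI, Or.inl rfl⟩)
    · obtain rfl := (derives_fact_iff (by simp [Atom.subst])).1 hd
      exact .vs I₂ _ (Or.inr ⟨I₁, I₂, hI, Or.inr rfl⟩)
    · obtain ⟨rfl, hA⟩ := (derives_forbid_iff (by simp [Atom.subst])).1 hd
      simp only [List.mem_cons, List.not_mem_nil, or_false, forall_eq_or_imp, forall_eq] at hA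
      exact .pair I₁ I₂ hI hA.1 hA.2.1 hA.2.2
  · rcases hr with ((((⟨h, b, hr, hr'⟩ | rfl | rfl) | ⟨h, b, hr, r', hr', rfl⟩) |
      ⟨b, wt, lev, ts, hr, rfl⟩) | ⟨b, wt, lev, ts, hr, rfl⟩) | hr
    · exact step_of_derives_reductify hM hMA (T.background_safe _ hr) (T.background_basic _ hr)
        (mem_prog_of_background hr) ⟨r, hr', hd⟩
    · obtain ⟨σ, h1, h2, -, rfl⟩ := derives_rule_iff.1 hd
      simpa [Atom.subst] using Step.nasInVs (T := T) (VR := VR) (A := A) (M := M)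
        (σ .ATOM) (σ .X) (by simpa [Atom.subst] using h1) (by simpa [Atom.subst] using h2)
    · obtain ⟨σ, h1, h2, -, rfl⟩ := derives_rule_iff.1 hd
      simpa [Atom.subst] using Step.nasMmr (T := T) (VR := VR) (A := A) (M := M)
        (σ .ATOM) (σ .X) (by simpa [Atom.subst] using h1) (by simpa [Atom.subst] using h2)
    · obtain ⟨hin, hd⟩ := (derives_append_iff (by simp)).1 hd
      exact step_of_derives_reductify hM hMA (T.space_safe _ hr) (T.space_basic _ hr)
        (mem_prog_of_space hr hin) ⟨r', hr', hd⟩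
    · obtain ⟨hin, hd⟩ := (derives_append_iff (by simp)).1 hd
      obtain ⟨t, p, hp, has, rfl⟩ :=
        (derives_metaWeak_iff (T.space_safe _ hr) (Or.inr (Or.inl rfl)) hM).1 hd
      exact .weightVs t p (weakDerives_iff.2 ⟨_, mem_prog_of_space hr hin, hp⟩) has
    · obtain ⟨t, p, hp, has, rfl⟩ :=
        (derives_metaWeak_iff (T.background_safe _ hr) (Or.inr (Or.inl rfl)) hM).1 hd
      exact .weightVs t p (weakDerives_iff.2 ⟨_, mem_prog_of_background hr, hp⟩) has
    · exact step_of_derives_levelFacts hr hd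

/-- `Reified M` excludes instances whose variables take values that are not task terms; `M ⊆ A` is
used for the choice rules in the recomputed reduct. -/
theorem step_of_derives (hVR : GroundReasons VR) (hM : Reified M) (hMA : M ⊆ A)
    (h : Derives (fullReduct (metaProgram T VR) A) M o) : Step T VR A M o := by
  obtain ⟨r, hr | hr, hd⟩ := derives_fullReduct_iff.1 h
  · exact step_of_derives_taskMeta hM (derives_fullReduct_iff.2 ⟨r, hr, hd⟩)
  · exact step_of_derives_reasonsMeta hVR hM hMA (derives_fullReduct_iff.2 ⟨r, hr, hd⟩)

end

end LOAS

/-! ## The answer sets of the meta programs in terms of immediate consequences -/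

namespace LOAS

open ASP

universe u v

variable {C : Type u} {P : Type v}

section

variable {T : Task C P} {VR : List (Reason C P)} {A M : Set (MAtom C P)} {o : Option (MAtom C P)}

theorem derives_of_mem {Q : Set (MRule C P)} {r : MRule C P} (hr : r ∈ Q)
    (h : Derives (fullReduct {r} A) M o) : Derives (fullReduct Q A) M o :=
  derives_fullReduct_iff.2 ⟨r, hr, h⟩

theorem derives_of_dominates {f g : MetaFn C P} (hc : (idt f, idt g) ∈ comparisons T VR)
    (hd : ∃ r ∈ dominates (idt f) (idt g), Derives (fullReduct {r} A) M o) :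
    Derives (fullReduct (metaProgram T VR) A) M o := by
  obtain ⟨r, hr, hd⟩ := hd
  refine derives_of_mem ?_ hd
  rcases hc with ⟨o', ho, h⟩ | ⟨o', ho, h⟩ | ⟨I₁, I₂, hI, h⟩ <;>
    rw [Prod.mk.injEq] at h <;> rw [h.1, h.2] at hr
  · exact Or.inl (Or.inl (Or.inr (Or.inl ⟨o', ho, Or.inr (Or.inr (Or.inr (Or.inr (Or.inl hr))))⟩)))
  · exact Or.inl (Or.inr (Or.inl ⟨o', ho, Or.inl hr⟩))
  · exact Or.inr (Or.inl (Or.inr ⟨I₁, I₂, hI, Or.inl hr⟩))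

/-- Identifiers are constants, so the comparison rules are unchanged by substitutions except at the
level variables. -/
theorem exists_idt_of_mem_comparisons {t₁ t₂ : MTerm C P} (h : (t₁, t₂) ∈ comparisons T VR) :
    ∃ f g, t₁ = idt f ∧ t₂ = idt g := by
  rcases h with ⟨o', ho, h⟩ | ⟨o', ho, h⟩ | ⟨I₁, I₂, hI, h⟩ <;>
    rw [Prod.mk.injEq] at h <;> exact ⟨_, _, h⟩

theorem derives_of_covers {e : PartialInterp C P} {t : MTerm C P} (hc : (e, t) ∈ covers T)
    (ho : ((∀ a ∈ e.inc, reifyAtom .inAs t a ∈ M) ∧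
        (∀ a ∈ e.exc, reifyAtom .inAs t a ∉ A) ∧ o = some ⟨.cov, [t]⟩) ∨
      (o = none ∧ (⟨.cov, [t]⟩ : MAtom C P) ∉ A)) :
    Derives (fullReduct (metaProgram T VR) A) M o := by
  rcases hc with ⟨e', he, h⟩ | ⟨q, hq, h | h⟩
  · rw [Prod.mk.injEq] at h
    obtain ⟨rfl, rfl⟩ := h
    obtain ⟨r, hr, hd⟩ := (derives_cover_iff (T.pos_ground _ he)).2 ho
    exact derives_of_mem (Or.inl (Or.inl (Or.inl (Or.inl (Or.inr ⟨_, he, Or.inl hr⟩))))) hd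
  · rw [Prod.mk.injEq] at h
    obtain ⟨rfl, rfl⟩ := h
    obtain ⟨r, hr, hd⟩ := (derives_cover_iff (T.pos_ground _ (T.brave_over_pos q hq).1)).2 ho
    exact derives_of_mem (Or.inl (Or.inl (Or.inr (Or.inl ⟨q, hq, Or.inr (Or.inr (Or.inl hr))⟩)))) hd
  · rw [Prod.mk.injEq] at h
    obtain ⟨rfl, rfl⟩ := h
    obtain ⟨r, hr, hd⟩ := (derives_cover_iff (T.pos_ground _ (T.brave_over_pos q hq).2)).2 ho
    exact derives_of_mem (Or.inl (Or.inl (Or.inr (Or.inl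
      ⟨q, hq, Or.inr (Or.inr (Or.inr (Or.inl hr)))⟩)))) hd

theorem derives_inAs (hM : Reified M) {t : MTerm C P} {o' : Option (OAtom C P)}
    (hd : Derives (fullReduct (prog T M) (slice .inAs A t)) (slice .inAs M t) o')
    (has : (⟨.as, [t]⟩ : MAtom C P) ∈ M) :
    Derives (fullReduct (metaProgram T VR) A) M (o'.map (reifyAtom .inAs t)) := by
  obtain ⟨r, hr, hd⟩ := derives_fullReduct_iff.1 hd
  cases r with
  | weak => exact absurd hd not_derives_weak
  | strong h b =>
    rcases hr with hr | ⟨hr, hin⟩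
    · exact derives_of_mem (Or.inl (Or.inl (Or.inl (Or.inl (Or.inl (Or.inl (Or.inl
          ⟨h, b, hr, rfl⟩)))))))
        ((derives_reify_iff (T.background_safe _ hr) (T.background_basic _ hr).1 hM).2
          ⟨t, o', hd, has, rfl⟩)
    · exact derives_of_mem (Or.inl (Or.inl (Or.inl (Or.inl (Or.inl (Or.inr (Or.inl (Or.inl (Or.inl
          ⟨h, b, hr, rfl⟩)))))))))
        ((derives_append_iff (by simp)).2 ⟨hin, (derives_reify_iff (T.space_safe _ hr)
          (T.space_basic _ hr).1 hM).2 ⟨t, o', hd, has, rfl⟩⟩)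

theorem derives_mmr (hM : Reified M)
    (hinVs : ∀ t a, reifyAtom .inVs t a ∈ A → reifyAtom .inVs t a ∈ M)
    {t : MTerm C P} {o' : Option (OAtom C P)}
    (hd : Derives (fullReduct (prog T M) (slice .inVs A t)) (slice .mmr M t) o')
    (hvs : (⟨.vs, [t]⟩ : MAtom C P) ∈ M) :
    Derives (fullReduct (metaProgram T VR) A) M (some (mmrAtom t o')) := by
  obtain ⟨r, hr, hd⟩ := derives_fullReduct_iff.1 hd
  cases r with
  | weak => exact absurd hd not_derives_weak
  | strong h b =>
    rcases hr with hr | ⟨hr, hin⟩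
    · obtain ⟨r, hr', hd⟩ := (derives_reductify (T.background_safe _ hr)
        (T.background_basic _ hr).1 hM).2 hinVs ⟨t, o', hd, hvs, rfl⟩
      exact derives_of_mem (Or.inr (Or.inr (Or.inl (Or.inl (Or.inl (Or.inl (Or.inl
        ⟨h, b, hr, hr'⟩))))))) hd
    · obtain ⟨r, hr', hd⟩ := (derives_reductify (T.space_safe _ hr)
        (T.space_basic _ hr).1 hM).2 hinVs ⟨t, o', hd, hvs, rfl⟩
      exact derives_of_mem (Or.inr (Or.inr (Or.inl (Or.inl (Or.inl (Or.inr
        ⟨h, b, hr, r, hr', rfl⟩)))))) ((derives_append_iff (by simp)).2 ⟨hin, hd⟩)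

theorem derives_weightAs (hM : Reified M) {t : MTerm C P}
    {p : Term C ℕ × Term C ℕ × List (Term C ℕ)}
    (hp : WeakDerives (prog T M) (slice .inAs A t) (slice .inAs M t) p)
    (has : (⟨.as, [t]⟩ : MAtom C P) ∈ M) :
    Derives (fullReduct (metaProgram T VR) A) M (some (weightAtom p t)) := by
  obtain ⟨r, hr, hp⟩ := weakDerives_iff.1 hp
  cases r with
  | strong => exact absurd hp not_weakDerives_strong
  | weak b wt lev ts =>
    rcases hr with hr | ⟨hr, hin⟩
    · exact derives_of_mem (Or.inl (Or.inl (Or.inl (Or.inl (Or.inl (Or.inl (Or.inr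
          ⟨b, wt, lev, ts, hr, rfl⟩)))))))
        ((derives_metaWeak_iff (T.background_safe _ hr) (Or.inl rfl) hM).2 ⟨t, p, hp, has, rfl⟩)
    · exact derives_of_mem (Or.inl (Or.inl (Or.inl (Or.inl (Or.inl (Or.inr (Or.inl (Or.inl (Or.inr
          ⟨b, wt, lev, ts, hr, rfl⟩)))))))))
        ((derives_append_iff (by simp)).2 ⟨hin,
          (derives_metaWeak_iff (T.space_safe _ hr) (Or.inl rfl) hM).2 ⟨t, p, hp, has, rfl⟩⟩)

theorem derives_weightVs (hM : Reified M) {t : MTerm C P}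
    {p : Term C ℕ × Term C ℕ × List (Term C ℕ)}
    (hp : WeakDerives (prog T M) (slice .inVs A t) (slice .inVs M t) p)
    (hvs : (⟨.vs, [t]⟩ : MAtom C P) ∈ M) :
    Derives (fullReduct (metaProgram T VR) A) M (some (weightAtom p t)) := by
  obtain ⟨r, hr, hp⟩ := weakDerives_iff.1 hp
  cases r with
  | strong => exact absurd hp not_weakDerives_strong
  | weak b wt lev ts =>
    rcases hr with hr | ⟨hr, hin⟩
    · exact derives_of_mem (Or.inr (Or.inr (Or.inl (Or.inr ⟨b, wt, lev, ts, hr, rfl⟩))))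
        ((derives_metaWeak_iff (T.background_safe _ hr) (Or.inr (Or.inl rfl)) hM).2
          ⟨t, p, hp, hvs, rfl⟩)
    · exact derives_of_mem (Or.inr (Or.inr (Or.inl (Or.inl (Or.inr ⟨b, wt, lev, ts, hr, rfl⟩)))))
        ((derives_append_iff (by simp)).2 ⟨hin, (derives_metaWeak_iff (T.space_safe _ hr)
          (Or.inr (Or.inl rfl)) hM).2 ⟨t, p, hp, hvs, rfl⟩⟩)

theorem derives_inVs (hVR : GroundReasons VR) {I : Set (OAtom C P)} {t : MTerm C P}
    {a : OAtom C P} (hI : (I, t) ∈ reasonIds VR) (ha : a ∈ I) :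
    Derives (fullReduct (metaProgram T VR) A) M (some (reifyAtom .inVs t a)) := by
  have hfact : ∀ f : MetaFn C P, a.IsGround →
      Derives (fullReduct {fact (reifyAtom .inVs (idt f) a)} A) M
        (some (reifyAtom .inVs (idt f) a)) := fun f hg => (derives_fact_iff fun σ => by
    rw [reifyAtom_subst_of_isGround hg, idt_subst]).2 rfl
  rcases hI with ⟨I, hI, h⟩ | ⟨I₁, I₂, hI, h | h⟩
  · rw [Prod.mk.injEq] at h
    obtain ⟨rfl, rfl⟩ := h
    exact derives_of_mem (Or.inr (Or.inl (Or.inl ⟨_, hI, Or.inl ⟨a, ha, rfl⟩⟩)))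
      (hfact _ (hVR.1 _ hI a ha))
  · rw [Prod.mk.injEq] at h
    obtain ⟨rfl, rfl⟩ := h
    exact derives_of_mem (Or.inr (Or.inl (Or.inr ⟨_, _, hI, Or.inr (Or.inl ⟨a, ha, rfl⟩)⟩)))
      (hfact _ ((hVR.2 _ _ hI).1 a ha))
  · rw [Prod.mk.injEq] at h
    obtain ⟨rfl, rfl⟩ := h
    exact derives_of_mem (Or.inr (Or.inl (Or.inr
      ⟨_, _, hI, Or.inr (Or.inr (Or.inl ⟨a, ha, rfl⟩))⟩))) (hfact _ ((hVR.2 _ _ hI).2 a ha))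

theorem derives_of_step (hVR : GroundReasons VR) (hM : Reified M)
    (hinVs : ∀ t a, reifyAtom .inVs t a ∈ A → reifyAtom .inVs t a ∈ M)
    (h : Step T VR A M o) : Derives (fullReduct (metaProgram T VR) A) M o := by
  cases h with
  | inAs t a h1 h2 => exact derives_inAs hM h1 h2
  | hard t h1 h2 => exact derives_inAs hM h1 h2
  | weightAs t p h1 h2 => exact derives_weightAs hM h1 h2
  | hyp r h1 h2 =>
    exact derives_of_mem (Or.inl (Or.inl (Or.inl (Or.inl (Or.inl (Or.inr (Or.inr rfl)))))))
      (derives_hypChoice_iff.2 ⟨r, h1, h2, rfl⟩)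
  | as t h =>
    rcases h with ⟨e, he, rfl⟩ | ⟨⟨e, he⟩, rfl⟩ | ⟨q, hq, rfl | rfl⟩
    · exact derives_of_mem (Or.inl (Or.inl (Or.inl (Or.inl (Or.inr ⟨e, he, Or.inr rfl⟩)))))
        ((derives_fact_iff (by simp [Atom.subst])).2 rfl)
    · exact derives_of_mem (Or.inl (Or.inl (Or.inl (Or.inr (Or.inl ⟨e, he, Or.inr rfl⟩)))))
        ((derives_fact_iff (by simp [Atom.subst])).2 rfl)
    · exact derives_of_mem (Or.inl (Or.inl (Or.inr (Or.inl ⟨q, hq, Or.inl rfl⟩))))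
        ((derives_fact_iff (by simp [Atom.subst])).2 rfl)
    · exact derives_of_mem (Or.inl (Or.inl (Or.inr (Or.inl ⟨q, hq, Or.inr (Or.inl rfl)⟩))))
        ((derives_fact_iff (by simp [Atom.subst])).2 rfl)
  | cov e t h1 h2 h3 => exact derives_of_covers h1 (Or.inl ⟨h2, h3, rfl⟩)
  | uncovered e t h1 h2 => exact derives_of_covers h1 (Or.inr ⟨rfl, h2⟩)
  | vi e h1 h2 h3 =>
    exact derives_of_mem (Or.inl (Or.inl (Or.inl (Or.inr (Or.inl ⟨e, h1, Or.inl rfl⟩)))))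
      ((derives_partialInterp_iff (T.neg_ground e h1) (by simp [Atom.subst])).2 ⟨h2, h3, rfl⟩)
  | violatingVi h =>
    exact derives_of_mem (Or.inl (Or.inl (Or.inl (Or.inr (Or.inr (Or.inl rfl))))))
      (derives_rule_iff.2 ⟨fun _ => .int 0, by simpa [Atom.subst] using h, by simp, by simp, rfl⟩)
  | violatingVp h =>
    exact derives_of_mem (Or.inl (Or.inr (Or.inr (Or.inr rfl))))
      (derives_rule_iff.2 ⟨fun _ => .int 0, by simpa [Atom.subst] using h, by simp, by simp, rfl⟩)
  | vp q h1 h2 =>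
    exact derives_of_mem (Or.inl (Or.inr (Or.inl ⟨q, h1, Or.inr rfl⟩)))
      (derives_rule_iff.2 ⟨fun _ => .int 0, by simp, by simpa [Atom.subst] using h2, by simp,
        by simp [Atom.subst]⟩)
  | vpNil t₁ t₂ h =>
    exact derives_of_mem (Or.inl (Or.inr (Or.inr (Or.inl rfl))))
      (derives_rule_iff.2 ⟨fun | .T1 => t₁ | _ => t₂, by simpa [Atom.subst] using h, by simp,
        by simp, rfl⟩)
  | brave q h1 h2 =>
    exact derives_of_mem (Or.inl (Or.inl (Or.inr (Or.inl
      ⟨q, h1, Or.inr (Or.inr (Or.inr (Or.inr (Or.inr rfl))))⟩))))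
      ((derives_forbid_iff (by simp [Atom.subst])).2 ⟨rfl, by simpa using h2⟩)
  | lv l h =>
    exact derives_of_mem (Or.inl (Or.inl (Or.inr (Or.inr ⟨l, h, rfl⟩))))
      ((derives_fact_iff (by simp [Atom.subst])).2 rfl)
  | domLv t₁ t₂ L h1 h2 h3 =>
    obtain ⟨f, g, rfl, rfl⟩ := exists_idt_of_mem_comparisons h1
    exact derives_of_dominates h1 (derives_dominates_iff.2 (Or.inl ⟨L, h2, h3, rfl⟩))
  | nonDomLv t₁ t₂ L h1 h2 h3 =>
    obtain ⟨f, g, rfl, rfl⟩ := exists_idt_of_mem_comparisons h1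
    exact derives_of_dominates h1 (derives_dominates_iff.2 (Or.inr (Or.inl ⟨L, h2, h3, rfl⟩)))
  | nonBef t₁ t₂ l m h1 h2 h3 h4 h5 =>
    obtain ⟨f, g, rfl, rfl⟩ := exists_idt_of_mem_comparisons h1
    exact derives_of_dominates h1 (derives_dominates_iff.2
      (Or.inr (Or.inr (Or.inl ⟨l, m, h2, h3, h4, h5, rfl⟩))))
  | dom t₁ t₂ L h1 h2 h3 =>
    obtain ⟨f, g, rfl, rfl⟩ := exists_idt_of_mem_comparisons h1
    exact derives_of_dominates h1 (derives_dominates_iff.2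
      (Or.inr (Or.inr (Or.inr ⟨L, h2, h3, rfl⟩))))
  | vs I t h =>
    rcases h with ⟨I, hI, h⟩ | ⟨I₁, I₂, hI, h | h⟩
    · rw [Prod.mk.injEq] at h
      obtain ⟨rfl, rfl⟩ := h
      exact derives_of_mem (Or.inr (Or.inl (Or.inl ⟨_, hI, Or.inr (Or.inr rfl)⟩)))
        ((derives_fact_iff (by simp [Atom.subst])).2 rfl)
    · rw [Prod.mk.injEq] at h
      obtain ⟨rfl, rfl⟩ := h
      exact derives_of_mem (Or.inr (Or.inl (Or.inr
        ⟨_, _, hI, Or.inr (Or.inr (Or.inr (Or.inl rfl)))⟩)))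
        ((derives_fact_iff (by simp [Atom.subst])).2 rfl)
    · rw [Prod.mk.injEq] at h
      obtain ⟨rfl, rfl⟩ := h
      exact derives_of_mem (Or.inr (Or.inl (Or.inr
        ⟨_, _, hI, Or.inr (Or.inr (Or.inr (Or.inr (Or.inl rfl))))⟩)))
        ((derives_fact_iff (by simp [Atom.subst])).2 rfl)
  | inVs I t a h1 h2 => exact derives_inVs hVR h1 h2
  | mmr t a h1 h2 => exact derives_mmr hM hinVs h1 h2
  | mmrBot t h1 h2 => exact derives_mmr hM hinVs h1 h2
  | weightVs t p h1 h2 => exact derives_weightVs hM h1 h2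
  | nasInVs y t h1 h2 =>
    exact derives_of_mem (Or.inr (Or.inr (Or.inl (Or.inl (Or.inl (Or.inl (Or.inr (Or.inl rfl))))))))
      (derives_rule_iff.2 ⟨fun | .ATOM => y | _ => t, by simpa [Atom.subst] using h1,
        by simpa [Atom.subst] using h2, by simp, by simp [Atom.subst]⟩)
  | nasMmr y t h1 h2 =>
    exact derives_of_mem (Or.inr (Or.inr (Or.inl (Or.inl (Or.inl (Or.inl (Or.inr (Or.inr rfl))))))))
      (derives_rule_iff.2 ⟨fun | .ATOM => y | _ => t, by simpa [Atom.subst] using h1,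
        by simpa [Atom.subst] using h2, by simp, by simp [Atom.subst]⟩)
  | interp I h1 h2 =>
    exact derives_of_mem (Or.inr (Or.inl (Or.inl ⟨I, h1, Or.inr (Or.inl rfl)⟩)))
      ((derives_forbid_iff (by simp [Atom.subst])).2 ⟨rfl, by simpa using h2⟩)
  | pair I₁ I₂ h1 h2 h3 h4 =>
    exact derives_of_mem (Or.inr (Or.inl (Or.inr
      ⟨I₁, I₂, h1, Or.inr (Or.inr (Or.inr (Or.inr (Or.inr rfl))))⟩)))
      ((derives_forbid_iff (by simp [Atom.subst])).2 ⟨rfl, by simp [h2, h3, h4]⟩)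

/-- `A` is a stable model with respect to `Step`. -/
structure Stable (T : Task C P) (VR : List (Reason C P)) (A : Set (MAtom C P)) : Prop where
  closed : ∀ a, Step T VR A A (some a) → a ∈ A
  consistent : ¬ Step T VR A A none
  least : ∀ M ⊆ A, (∀ a, Step T VR A M (some a) → a ∈ M) → A ⊆ M

/-- Every atom of a stable model is supported: by monotonicity the supported atoms form a closed
subset, which must be all of `A`. With closedness this makes membership in `A` equivalent to
one-step derivability, so atoms can be analysed by cases on `Step`. -/
theorem Stable.step (h : Stable T VR A) {a : MAtom C P} (ha : a ∈ A) : Step T VR A A (some a) :=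
  (h.least {a ∈ A | Step T VR A A (some a)} (fun _ hx => hx.1) (fun x hx =>
    have := hx.mono (M' := A) fun _ hy => hy.1
    ⟨h.closed x this, this⟩) ha).2

theorem Stable.mem_iff (h : Stable T VR A) {a : MAtom C P} : a ∈ A ↔ Step T VR A A (some a) :=
  ⟨h.step, h.closed a⟩

theorem Stable.reified (h : Stable T VR A) : Reified A :=
  fun _ _ _ hy hp => reified_of_step (h.step hy) hp

theorem exists_reasonIds_of_step {t : MTerm C P} {a : OAtom C P}
    (h : Step T VR A M (some (reifyAtom .inVs t a))) : ∃ I, (I, t) ∈ reasonIds VR ∧ a ∈ I := by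
  generalize ho : some (reifyAtom .inVs t a) = o at h
  cases h <;> simp [reifyAtom, weightAtom, inH, ofAtom_injective.eq_iff] at ho
  obtain ⟨rfl, rfl⟩ := ho
  exact ⟨_, by assumption, by assumption⟩

/-- Derivations and steps agree only on well-formed sets of atoms, so the minimality conditions on
the two sides quantify over different sets `M`. Each comparison first restricts to a suitable subset
of `A`. -/
theorem mem_answerSets_metaProgram_iff (hVR : GroundReasons VR) :
    A ∈ answerSets (metaProgram T VR) ↔ Stable T VR A := by
  rw [mem_answerSets_iff (isSafe_metaProgram T hVR)]
  constructor
  · rintro ⟨hcl, hbot, hleast⟩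
    -- `K` is the well-formed part of `A`. It is closed under the program, since derivations from a
    -- reified set give reified heads; minimality of `A` then yields `A ⊆ K`.
    let K : Set (MAtom C P) := {x ∈ A | ∀ p y t, x = ⟨p, [y, t]⟩ →
      p = .inAs ∨ p = .inVs ∨ p = .mmr → y = idt .bot ∨ ∃ a, y = ofAtom a}
    have hKA : K ⊆ A := fun x hx => hx.1
    have hK : Reified K := fun p y t h hp => h.2 p y t rfl hp
    have hA : Reified A := hK.mono <| hleast K fun a ha => ⟨hcl a (ha.mono subset_rfl hKA), by
      rintro p y t rfl hp
      exact reified_of_step (step_of_derives hVR hK hKA ha) hp⟩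
    refine ⟨fun a ha => hcl a (derives_of_step hVR hA (fun _ _ h => h) ha),
      fun h => hbot (derives_of_step hVR hA (fun _ _ h => h) h), fun M hMA hM => ?_⟩
    exact hleast M fun a ha => hM a (step_of_derives hVR (hA.mono hMA) hMA ha)
  · intro h
    refine ⟨fun a ha => h.closed a (step_of_derives hVR h.reified subset_rfl ha),
      fun hn => h.consistent (step_of_derives hVR h.reified subset_rfl hn), fun M hM => ?_⟩
    -- An arbitrary closed `M` need not be reified, but its intersection with `A` is. All in_vs
    -- atoms of `A` survive in the intersection because they are facts.
    refine (h.least (A ∩ M) Set.inter_subset_left fun a ha => ?_).trans Set.inter_subset_right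
    refine ⟨h.closed a (ha.mono Set.inter_subset_left), hM a ?_⟩
    refine (derives_of_step hVR (h.reified.mono Set.inter_subset_left) (fun t a ha => ?_) ha).mono
      subset_rfl Set.inter_subset_right
    obtain ⟨I, hI, haI⟩ := exists_reasonIds_of_step (h.step ha)
    exact ⟨ha, hM _ (derives_inVs hVR hI haI)⟩

end

end LOAS

/-! ## What the answer sets of the meta programs represent -/

namespace ASP

universe u v w

variable {F : Type u} {V : Type v} {P : Type w}

theorem HerbrandUniverse.mono {Q Q' : Set (Rule F V P)} (h : Q ⊆ Q') {t : Term F V}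
    (ht : HerbrandUniverse Q t) : HerbrandUniverse Q' t := by
  induction ht with
  | int z r t hr ht hs => exact .int z r t (h hr) ht hs
  | app f ss ts r t hr ht hs hl _ ih => exact .app f ss ts r t (h hr) ht hs hl ih

theorem levels_mono {Q Q' : Set (Rule F V P)} (h : Q ⊆ Q') : levels Q ⊆ levels Q' := by
  rintro l ⟨b, wt, ts, r, hr, σ, hσ, hg⟩
  exact ⟨b, wt, ts, r, h hr, σ, fun x hx => (hσ x hx).mono h, hg⟩

theorem levelSum_of_notMem_levels {Q : Set (Rule F V P)} {l : ℤ} (hl : l ∉ levels Q)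
    (A : Set (Atom F V P)) : levelSum Q A l = 0 := by
  have : {p ∈ weakTuples Q A | p.2.1 = l} = ∅ := by
    refine Set.eq_empty_of_forall_notMem ?_
    rintro ⟨w, l', ts⟩ ⟨⟨b, hb, -⟩, rfl⟩
    exact hl ⟨b, _, ts, hb⟩
  rw [levelSum, this, finsum_mem_empty]

end ASP

namespace LOAS

open ASP

universe u v

variable {C : Type u} {P : Type v}

/-- The background together with a hypothesis. -/
def theory (T : Task C P) (H : Finset (ORule C P)) : Set (ORule C P) :=
  (T.background : Set (ORule C P)) ∪ H

section

variable {T : Task C P} {H : Finset (ORule C P)}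

theorem theory_isSafe (hH : H ⊆ T.space) : ∀ r ∈ theory T H, r.IsSafe := by
  rintro r (hr | hr)
  · exact T.background_safe r hr
  · exact T.space_safe r (hH hr)

theorem theory_guards (hH : H ⊆ T.space) : ∀ r ∈ theory T H, r.body.guards = [] := by
  rintro r (hr | hr)
  · exact (T.background_basic r hr).1
  · exact (T.space_basic r (hH hr)).1

/-- The levels of the task. -/
def taskLevels (T : Task C P) : Set ℤ := levels ((T.background : Set (ORule C P)) ∪ T.space)

theorem finite_taskLevels (T : Task C P) : (taskLevels T).Finite := by
  refine finite_levels (T.background.finite_toSet.union T.space.finite_toSet) ?_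
  rintro r (hr | hr)
  · exact T.background_basic r hr
  · exact T.space_basic r hr

/-- The relation that the atoms `dom(t₁, t₂)` express: dominance with respect to the levels of the
task. -/
def LevelDom (T : Task C P) (Q : Set (ORule C P)) (J₁ J₂ : Set (OAtom C P)) : Prop :=
  ∃ l ∈ taskLevels T, activeSum Q J₁ l < activeSum Q J₂ l ∧
    ¬ ∃ m ∈ taskLevels T, l < m ∧ activeSum Q J₂ m < activeSum Q J₁ m

/-- The meta program asks for a level at which J₁ is better with no higher level at which J₂ is
better; dominance asks for equality at all higher levels. As there are finitely many levels, the
highest level at which J₁ is better satisfies the stronger condition. Levels of the task that do not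
occur in this program contribute zero on both sides. -/
theorem levelDom_iff (hH : H ⊆ T.space) {J₁ J₂ : Set (OAtom C P)}
    (h₁ : J₁ ∈ answerSets (theory T H)) (h₂ : J₂ ∈ answerSets (theory T H)) :
    LevelDom T (theory T H) J₁ J₂ ↔ Dominates (theory T H) J₁ J₂ := by
  have e₁ := levelSum_eq_activeSum (theory_isSafe hH) (theory_guards hH) h₁.1
  have e₂ := levelSum_eq_activeSum (theory_isSafe hH) (theory_guards hH) h₂.1
  have hzero : ∀ l ∉ taskLevels T, ∀ J, levelSum (theory T H) J l = 0 := by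
    intro l hl J
    refine levelSum_of_notMem_levels (fun h => hl (levels_mono ?_ h)) J
    exact Set.union_subset_union_right _ (by exact_mod_cast hH)
  simp only [LevelDom, Dominates, ← e₁, ← e₂]
  constructor
  · rintro ⟨l, hl, hlt, hle⟩
    have hfin : {m | m ∈ taskLevels T ∧
        levelSum (theory T H) J₁ m < levelSum (theory T H) J₂ m}.Finite :=
      (finite_taskLevels T).subset fun _ h => h.1
    obtain ⟨m, ⟨hm, hlt'⟩, hmax⟩ := hfin.exists_maximal ⟨l, hl, hlt⟩
    refine ⟨m, hlt', fun k hk => ?_⟩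
    by_cases hkl : k ∈ taskLevels T
    · refine le_antisymm (not_lt.1 fun hlt'' => ?_) (not_lt.1 fun hlt'' => ?_)
      · by_cases hlm : l < k
        · exact hle ⟨k, hkl, hlm, hlt''⟩
        -- Here m < k ≤ l, although J₁ is better at `l` and `m` is maximal with that property.
        · have := hmax (y := l) ⟨hl, hlt⟩ (by omega)
          omega
      · have := hmax (y := k) ⟨hkl, hlt''⟩ hk.le
        omega
    · rw [hzero k hkl, hzero k hkl]
  · rintro ⟨l, hlt, heq⟩
    refine ⟨l, ?_, hlt, ?_⟩
    · by_contra hl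
      rw [hzero l hl, hzero l hl] at hlt
      exact lt_irrefl _ hlt
    · rintro ⟨m, -, hlm, h⟩
      rw [heq m hlm] at h
      exact lt_irrefl _ h

theorem ofTerm_int (z : ℤ) : (ofTerm (.int z) : MTerm C P) = .int z := by simp [ofTerm]

/-- For a fixed identifier and level, the w-atoms with integer weight correspond bijectively to the
active tuples, because the tuple is stored injectively in the atom. Each tuple is thus counted once,
as in the original sum, and non-integer weights are ignored on both sides. -/
theorem weightSum_eq_activeSum {A : Set (MAtom C P)} {Q : Set (ORule C P)} {J : Set (OAtom C P)}
    {f : MetaFn C P} (hw : ∀ W L X, (⟨.w, [W, L, X, idt f]⟩ : MAtom C P) ∈ A ↔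
      ∃ p, WeakDerives Q J J p ∧ (⟨.w, [W, L, X, idt f]⟩ : MAtom C P) = weightAtom p (idt f))
    (l : ℤ) : weightSum A (idt f) (.int l) = activeSum Q J l := by
  symm
  refine finsum_mem_eq_of_bijOn
    (fun p : ℤ × ℤ × List (Term C ℕ) =>
      (weightAtom (.int p.1, .int p.2.1, p.2.2) (idt f), p.1)) ⟨?_, ?_, ?_⟩ fun _ _ => rfl
  · rintro ⟨w, l', ts⟩ ⟨hp, rfl⟩
    refine ⟨(hw _ _ _).2 ⟨_, hp, rfl⟩,
      fun | .W => .int w | _ => .app .args (ts.map ofTerm), ?_, ?_⟩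
    · simp [Atom.subst, weightAtom, ofTerm_int]
    · simp
  · rintro ⟨w, l', ts⟩ - ⟨w', l'', ts'⟩ - h
    simp only [weightAtom, ofTerm_int, Prod.mk.injEq, Atom.mk.injEq, List.cons.injEq,
      Term.int.injEq, Term.app.injEq, true_and, and_true] at h
    obtain ⟨⟨rfl, rfl, h⟩, -⟩ := h
    rw [List.map_injective_iff.2 ofTerm_injective h]
  · rintro ⟨a, z⟩ ⟨ha, θ, rfl, hz⟩
    simp only [Atom.subst, List.map_cons, mv_subst, Term.subst_int, idt_subst, List.map_nil]
      at ha hz ⊢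
    rw [hz] at ha ⊢
    obtain ⟨⟨wt, lev, ts⟩, hp, h⟩ := (hw _ _ _).1 ha
    simp only [weightAtom, Atom.mk.injEq, List.cons.injEq, true_and, and_true] at h
    obtain ⟨h1, h2, h3⟩ := h
    rw [← ofTerm_int, ofTerm_injective.eq_iff] at h1 h2
    subst h1 h2
    refine ⟨(z, l, ts), ⟨hp, rfl⟩, ?_⟩
    simp [weightAtom, ofTerm_int, h3]

end

/-! ### Identifiers determine the objects they name. -/

theorem eq_of_mem_covers {T : Task C P} {e e' : PartialInterp C P} {t : MTerm C P}
    (h : (e, t) ∈ covers T) (h' : (e', t) ∈ covers T) : e = e' := by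
  rcases h with ⟨q, hq, h⟩ | ⟨q, hq, h | h⟩ <;> rcases h' with ⟨q', hq', h'⟩ | ⟨q', hq', h' | h'⟩ <;>
  · rw [Prod.mk.injEq] at h h'
    obtain ⟨rfl, rfl⟩ := h
    obtain ⟨rfl, h'⟩ := h'
    simp only [idt, Term.app.injEq, reduceCtorEq, MetaFn.posId.injEq,
      MetaFn.ordId₁.injEq, MetaFn.ordId₂.injEq, and_true] at h' <;> rw [h']

theorem eq_of_mem_reasonIds {VR : List (Reason C P)} {I I' : Set (OAtom C P)} {t : MTerm C P}
    (h : (I, t) ∈ reasonIds VR) (h' : (I', t) ∈ reasonIds VR) : I = I' := by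
  rcases h with ⟨q, hq, h⟩ | ⟨q₁, q₂, hq, h | h⟩ <;>
  rcases h' with ⟨q', hq', h'⟩ | ⟨q'₁, q'₂, hq', h' | h'⟩ <;>
  · rw [Prod.mk.injEq] at h h'
    obtain ⟨rfl, rfl⟩ := h
    obtain ⟨rfl, h'⟩ := h'
    simp only [idt, Term.app.injEq, reduceCtorEq, MetaFn.interpId.injEq,
      MetaFn.pairId₁.injEq, MetaFn.pairId₂.injEq, and_true] at h' <;> simp only [h']

/-- Both encodings of the weak constraints derive w-atoms. Disjointness of the identifiers ensures
that the atoms w(…, t) for one t come from only one of them. -/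
theorem notMem_asIds_of_mem_reasonIds {T : Task C P} {VR : List (Reason C P)}
    {I : Set (OAtom C P)} {t : MTerm C P} (h : (I, t) ∈ reasonIds VR) : t ∉ asIds T := by
  intro h'
  rcases h with ⟨q, hq, h⟩ | ⟨q₁, q₂, hq, h | h⟩ <;> rw [Prod.mk.injEq] at h <;>
  obtain ⟨rfl, rfl⟩ := h <;>
  · rcases h' with ⟨e, -, h'⟩ | ⟨-, h'⟩ | ⟨o, -, h' | h'⟩ <;> simp [idt] at h'

theorem mem_asIds_of_mem_covers {T : Task C P} {e : PartialInterp C P} {t : MTerm C P}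
    (h : (e, t) ∈ covers T) : t ∈ asIds T := by
  rcases h with ⟨q, hq, h⟩ | ⟨q, hq, h | h⟩ <;> rw [Prod.mk.injEq] at h
  · exact Or.inl ⟨q, hq, h.2⟩
  · exact Or.inr (Or.inr ⟨q, hq, Or.inl h.2⟩)
  · exact Or.inr (Or.inr ⟨q, hq, Or.inr h.2⟩)

@[simp] theorem mem_hypOf {T : Task C P} {A : Set (MAtom C P)} {r : ORule C P} :
    r ∈ hypOf T A ↔ r ∈ T.space ∧ inH r ∈ A := by
  simp [hypOf]

theorem hypOf_subset (T : Task C P) (A : Set (MAtom C P)) : hypOf T A ⊆ T.space :=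
  fun _ hr => (mem_hypOf.1 hr).1

theorem prog_eq_theory (T : Task C P) (A : Set (MAtom C P)) : prog T A = theory T (hypOf T A) := by
  ext r
  simp [prog, theory]

/-! ### Reading off a stable model of the meta program. -/

namespace Stable

variable {T : Task C P} {VR : List (Reason C P)} {A : Set (MAtom C P)}

theorem as_iff (h : Stable T VR A) {t : MTerm C P} :
    (⟨.as, [t]⟩ : MAtom C P) ∈ A ↔ t ∈ asIds T := by
  refine h.mem_iff.trans ⟨fun hs => ?_, .as t⟩
  cases hs; assumption

theorem vs_iff (h : Stable T VR A) {t : MTerm C P} :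
    (⟨.vs, [t]⟩ : MAtom C P) ∈ A ↔ ∃ I, (I, t) ∈ reasonIds VR := by
  refine h.mem_iff.trans ⟨fun hs => ?_, fun ⟨I, hI⟩ => .vs I t hI⟩
  cases hs; exact ⟨_, by assumption⟩

theorem lv_iff (h : Stable T VR A) {L : MTerm C P} :
    (⟨.lv, [L]⟩ : MAtom C P) ∈ A ↔ ∃ l ∈ taskLevels T, L = .int l := by
  refine h.mem_iff.trans ⟨fun hs => ?_, ?_⟩
  · cases hs; exact ⟨_, by assumption, rfl⟩
  · rintro ⟨l, hl, rfl⟩; exact .lv l hl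

theorem inVs_iff (h : Stable T VR A) {y t : MTerm C P} :
    (⟨.inVs, [y, t]⟩ : MAtom C P) ∈ A ↔ ∃ I a, (I, t) ∈ reasonIds VR ∧ a ∈ I ∧ y = ofAtom a := by
  refine h.mem_iff.trans ⟨fun hs => ?_, ?_⟩
  · cases hs; exact ⟨_, _, by assumption, by assumption, rfl⟩
  · rintro ⟨I, a, hI, ha, rfl⟩; exact .inVs I t a hI ha

theorem slice_inVs (h : Stable T VR A) {I : Set (OAtom C P)} {t : MTerm C P}
    (hI : (I, t) ∈ reasonIds VR) : slice .inVs A t = I := by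
  ext a
  refine h.inVs_iff.trans ⟨?_, fun ha => ⟨I, a, hI, ha, rfl⟩⟩
  rintro ⟨I', a', hI', ha', hy⟩
  rw [ofAtom_injective hy, eq_of_mem_reasonIds hI hI']
  exact ha'

/-- The interpretations `in_as(·, t)` are answer sets. -/
theorem slice_inAs_mem (h : Stable T VR A) {t : MTerm C P} (ht : t ∈ asIds T) :
    slice .inAs A t ∈ answerSets (theory T (hypOf T A)) := by
  rw [mem_answerSets_iff (theory_isSafe (hypOf_subset T A)), ← prog_eq_theory]
  refine ⟨fun a ha => h.closed _ (.inAs t a ha (h.as_iff.2 ht)),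
    fun hn => h.consistent (.hard t hn (h.as_iff.2 ht)), fun N hN => ?_⟩
  -- Minimality for the slice: delete from `A` the atoms in_as(a, t) with a outside `N`. The result
  -- is still closed, since in_as atoms at t are derived only from in_as atoms at the same t; so
  -- nothing was deleted.
  have hle := h.least {x ∈ A | ∀ a, x = reifyAtom .inAs t a → a ∈ N} (fun x hx => hx.1) ?_
  · exact fun a ha => (hle ha).2 a rfl
  · intro x hx
    refine ⟨h.closed x (hx.mono fun y hy => hy.1), ?_⟩
    rintro a rfl
    generalize hy : reifyAtom .inAs t a = y at hx
    obtain ⟨p, args⟩ := y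
    simp only [reifyAtom, Atom.mk.injEq] at hy
    obtain ⟨rfl, rfl⟩ := hy
    generalize hz : ofAtom a = z at hx
    cases hx with
    | inAs _ a' hd _ =>
      obtain rfl := ofAtom_injective hz
      exact hN a (hd.mono (fullReduct_mono (prog_mono T fun y hy => hy.1) _)
        fun b hb => hb.2 b rfl)

theorem extends_of_mem_covers (h : Stable T VR A) {e : PartialInterp C P} {t : MTerm C P}
    (he : (e, t) ∈ covers T) : Extends (slice .inAs A t) e := by
  have hc : (⟨.cov, [t]⟩ : MAtom C P) ∈ A := by
    -- The constraint of cover(e, t) forces cov(t), and cov(t) can only be derived from a cover rule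
    -- for t, which belongs to the same example.
    by_contra hn
    exact h.consistent (.uncovered e t he hn)
  have hs := h.step hc
  cases hs with
  | cov e' _ he' h1 h2 =>
    rw [eq_of_mem_covers he he']
    exact ⟨h1, h2⟩

theorem vi_iff (h : Stable T VR A) : (⟨.vi, []⟩ : MAtom C P) ∈ A ↔
    ∃ e ∈ T.neg, Extends (slice .inAs A (idt .negId)) e := by
  refine h.mem_iff.trans ⟨fun hs => ?_, fun ⟨e, he, h1, h2⟩ => .vi e he h1 h2⟩
  cases hs with
  | vi e he h1 h2 => exact ⟨e, he, h1, h2⟩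

/-- An interpretation that is an answer set is not rejected. -/
theorem nas_notMem (h : Stable T VR A) {I : Set (OAtom C P)} {t : MTerm C P}
    (hI : (I, t) ∈ reasonIds VR) (hA : I ∈ answerSets (theory T (hypOf T A))) :
    (⟨.nas, [t]⟩ : MAtom C P) ∉ A := by
  rw [mem_answerSets_iff (theory_isSafe (hypOf_subset T A)), ← prog_eq_theory] at hA
  obtain ⟨hcl, hbot, hleast⟩ := hA
  have hvs := h.vs_iff.2 ⟨I, hI⟩
  -- Delete the atoms mmr(y, t) that do not represent elements of `I`. The set stays closed because
  -- `I` is closed under its own reduct and does not derive `⊥`. Together with `hge` this shows that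
  -- mmr recomputes exactly `I`.
  have hle : ∀ y, (⟨.mmr, [y, t]⟩ : MAtom C P) ∈ A → ∃ a ∈ I, y = ofAtom a := by
    have := h.least {x ∈ A | ∀ y, x = ⟨.mmr, [y, t]⟩ → ∃ a ∈ I, y = ofAtom a} (fun x hx => hx.1) ?_
    · exact fun y hy => (this hy).2 y rfl
    · intro x hx
      refine ⟨h.closed x (hx.mono fun y hy => hy.1), ?_⟩
      rintro y rfl
      have hd : ∀ {o}, Derives (fullReduct (prog T {x ∈ A | ∀ y, x = ⟨.mmr, [y, t]⟩ →
          ∃ a ∈ I, y = ofAtom a}) (slice .inVs A t)) (slice .mmr {x ∈ A | ∀ y,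
          x = ⟨.mmr, [y, t]⟩ → ∃ a ∈ I, y = ofAtom a} t) o →
          Derives (fullReduct (prog T A) I) I o := by
        intro o hd
        rw [h.slice_inVs hI] at hd
        refine hd.mono (fullReduct_mono (prog_mono T fun y hy => hy.1) _) fun b hb => ?_
        obtain ⟨a, ha, hab⟩ := hb.2 _ rfl
        rw [ofAtom_injective hab]
        exact ha
      cases hx with
      | mmr _ a h1 _ => exact ⟨a, hcl a (hd h1), rfl⟩
      | mmrBot _ h1 _ => exact absurd (hd h1) hbot
  -- The recomputed set is closed under the reduct by `I`, of which `I` is the least closed set.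
  have hge : ∀ a ∈ I, reifyAtom .mmr t a ∈ A := by
    refine hleast (slice .mmr A t) fun a ha => h.closed _ (.mmr t a ?_ hvs)
    rwa [h.slice_inVs hI]
  intro hn
  have hs := h.step hn
  cases hs with
  | nasInVs y _ h1 h2 =>
    obtain ⟨I', a, hI', ha, rfl⟩ := h.inVs_iff.1 h1
    rw [eq_of_mem_reasonIds hI' hI] at ha
    exact h2 (hge a ha)
  | nasMmr y _ h1 h2 =>
    obtain ⟨a, ha, rfl⟩ := hle y h1
    exact h2 (h.inVs_iff.2 ⟨I, a, hI, ha, rfl⟩)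

theorem weightSum_as (h : Stable T VR A) {f : MetaFn C P} (ht : idt f ∈ asIds T) (l : ℤ) :
    weightSum A (idt f) (.int l) = activeSum (theory T (hypOf T A)) (slice .inAs A (idt f)) l := by
  refine weightSum_eq_activeSum (fun W L X => ?_) l
  rw [← prog_eq_theory]
  constructor
  · intro hw
    have hs := h.step hw
    generalize hf : idt f = t at hs ht
    cases hs with
    | weightAs _ p h1 _ => exact ⟨p, h1, rfl⟩
    | weightVs _ p _ h2 =>
      obtain ⟨I, hI⟩ := h.vs_iff.1 h2
      exact absurd ht (notMem_asIds_of_mem_reasonIds hI)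
  · rintro ⟨p, hp, he⟩
    rw [he]
    exact h.closed _ (.weightAs _ p hp (h.as_iff.2 ht))

theorem weightSum_vs (h : Stable T VR A) {f : MetaFn C P} {I : Set (OAtom C P)}
    (ht : (I, idt f) ∈ reasonIds VR) (l : ℤ) :
    weightSum A (idt f) (.int l) = activeSum (theory T (hypOf T A)) I l := by
  refine weightSum_eq_activeSum (fun W L X => ?_) l
  rw [← prog_eq_theory, ← h.slice_inVs ht]
  constructor
  · intro hw
    have hs := h.step hw
    generalize hf : idt f = t at hs ht
    cases hs with
    | weightAs _ p _ h2 => exact absurd (h.as_iff.1 h2) (notMem_asIds_of_mem_reasonIds ht)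
    | weightVs _ p h1 _ => exact ⟨p, h1, rfl⟩
  · rintro ⟨p, hp, he⟩
    rw [he]
    exact h.closed _ (.weightVs _ p hp (h.vs_iff.2 ⟨I, ht⟩))

/-- The interpretations enter only through their level sums, so that one argument serves examples,
orderings and stored pairs. -/
theorem dom_iff (h : Stable T VR A) {t₁ t₂ : MTerm C P} (hc : (t₁, t₂) ∈ comparisons T VR)
    {Q : Set (ORule C P)} {J₁ J₂ : Set (OAtom C P)}
    (h₁ : ∀ l, weightSum A t₁ (.int l) = activeSum Q J₁ l)
    (h₂ : ∀ l, weightSum A t₂ (.int l) = activeSum Q J₂ l) :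
    (⟨.dom, [t₁, t₂]⟩ : MAtom C P) ∈ A ↔ LevelDom T Q J₁ J₂ := by
  have hbef : ∀ l ∈ taskLevels T, (⟨.nonBef, [t₁, t₂, .int l]⟩ : MAtom C P) ∈ A ↔
      ∃ m ∈ taskLevels T, l < m ∧ activeSum Q J₂ m < activeSum Q J₁ m := by
    intro l hl
    rw [h.mem_iff]
    constructor
    · intro hs
      cases hs with
      | nonBef _ _ _ m _ _ hm hnd hlm =>
        have hs' := h.step hnd
        cases hs' with
        | nonDomLv _ _ _ _ hm hlt =>
          obtain ⟨m', hm', he⟩ := h.lv_iff.1 hm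
          cases he
          rw [h₁, h₂] at hlt
          exact ⟨m, hm', hlm, hlt⟩
    · rintro ⟨m, hm, hlm, hlt⟩
      refine .nonBef t₁ t₂ l m hc (h.lv_iff.2 ⟨l, hl, rfl⟩) (h.lv_iff.2 ⟨m, hm, rfl⟩) ?_ hlm
      refine h.closed _ (.nonDomLv t₁ t₂ _ hc (h.lv_iff.2 ⟨m, hm, rfl⟩) ?_)
      rwa [h₁, h₂]
  rw [h.mem_iff]
  constructor
  · intro hs
    cases hs with
    | dom _ _ L _ hd hn =>
      have hs' := h.step hd
      cases hs' with
      | domLv _ _ _ _ hl hlt =>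
        obtain ⟨l, hl', rfl⟩ := h.lv_iff.1 hl
        rw [h₁, h₂] at hlt
        exact ⟨l, hl', hlt, fun hm => hn ((hbef l hl').2 hm)⟩
  · rintro ⟨l, hl, hlt, hn⟩
    refine .dom t₁ t₂ (.int l) hc (h.closed _ ?_) fun hm => hn ((hbef l hl).1 hm)
    refine .domLv t₁ t₂ _ hc (h.lv_iff.2 ⟨l, hl, rfl⟩) ?_
    rwa [h₁, h₂]

theorem dom_posId_iff (h : Stable T VR A) {o : PartialInterp C P × PartialInterp C P}
    (ho : o ∈ T.cautious) :
    (⟨.dom, [idt (.posId o.1), idt (.posId o.2)]⟩ : MAtom C P) ∈ A ↔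
      Dominates (theory T (hypOf T A)) (slice .inAs A (idt (.posId o.1)))
        (slice .inAs A (idt (.posId o.2))) := by
  have h₁ : idt (.posId o.1) ∈ asIds T := Or.inl ⟨_, (T.cautious_over_pos o ho).1, rfl⟩
  have h₂ : idt (.posId o.2) ∈ asIds T := Or.inl ⟨_, (T.cautious_over_pos o ho).2, rfl⟩
  rw [h.dom_iff (Or.inr (Or.inl ⟨o, ho, rfl⟩)) (h.weightSum_as h₁) (h.weightSum_as h₂),
    levelDom_iff (hypOf_subset T A) (h.slice_inAs_mem h₁) (h.slice_inAs_mem h₂)]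

theorem dominates_of_brave (h : Stable T VR A) {o : PartialInterp C P × PartialInterp C P}
    (ho : o ∈ T.brave) :
    Dominates (theory T (hypOf T A)) (slice .inAs A (idt (.ordId₁ o)))
      (slice .inAs A (idt (.ordId₂ o))) := by
  have h₁ : idt (.ordId₁ o) ∈ asIds T := Or.inr (Or.inr ⟨o, ho, Or.inl rfl⟩)
  have h₂ : idt (.ordId₂ o) ∈ asIds T := Or.inr (Or.inr ⟨o, ho, Or.inr rfl⟩)
  rw [← levelDom_iff (hypOf_subset T A) (h.slice_inAs_mem h₁) (h.slice_inAs_mem h₂),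
    ← h.dom_iff (Or.inl ⟨o, ho, rfl⟩) (h.weightSum_as h₁) (h.weightSum_as h₂)]
  by_contra hn
  exact h.consistent (.brave o ho hn)

theorem vp_iff (h : Stable T VR A) {t₁ t₂ : MTerm C P} :
    (⟨.vp, [t₁, t₂]⟩ : MAtom C P) ∈ A ↔
      ∃ o ∈ T.cautious, t₁ = idt (.posId o.1) ∧ t₂ = idt (.posId o.2) ∧
        ¬ Dominates (theory T (hypOf T A)) (slice .inAs A t₁) (slice .inAs A t₂) := by
  rw [h.mem_iff]
  constructor
  · intro hs
    cases hs with
    | vp o ho hn => exact ⟨o, ho, rfl, rfl, fun hd => hn ((h.dom_posId_iff ho).2 hd)⟩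
  · rintro ⟨o, ho, rfl, rfl, hn⟩
    exact .vp o ho fun hd => hn ((h.dom_posId_iff ho).1 hd)

theorem violating_iff (h : Stable T VR A) : (⟨.violating, []⟩ : MAtom C P) ∈ A ↔
    (∃ e ∈ T.neg, Extends (slice .inAs A (idt .negId)) e) ∨
    ∃ o ∈ T.cautious, ¬ Dominates (theory T (hypOf T A)) (slice .inAs A (idt (.posId o.1)))
      (slice .inAs A (idt (.posId o.2))) := by
  rw [h.mem_iff]
  constructor
  · intro hs
    cases hs with
    | violatingVi hv => exact Or.inl (h.vi_iff.1 hv)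
    | violatingVp hv =>
      have hs' := h.step hv
      cases hs' with
      | vpNil t₁ t₂ hv =>
        obtain ⟨o, ho, rfl, rfl, hn⟩ := h.vp_iff.1 hv
        exact Or.inr ⟨o, ho, hn⟩
  · rintro (hv | ⟨o, ho, hn⟩)
    · exact .violatingVi (h.vi_iff.2 hv)
    · exact .violatingVp (h.closed _ (.vpNil _ _ (h.vp_iff.2 ⟨o, ho, rfl, rfl, hn⟩)))

end Stable

/-- The violating reasons in `VR` do not apply to the program `Q`. -/
def Avoids (Q : Set (ORule C P)) (VR : List (Reason C P)) : Prop :=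
  (∀ I, .interp I ∈ VR → I ∉ answerSets Q) ∧
    ∀ I₁ I₂, .pair I₁ I₂ ∈ VR → I₁ ∈ answerSets Q → I₂ ∈ answerSets Q → Dominates Q I₁ I₂

/-- The constraints on stored reasons demand that they be rejected by nas, or ordered by dom. A
stored interpretation that is an answer set of B ∪ H is not rejected, so only the other possibility
can satisfy the constraint. -/
theorem Stable.avoids {T : Task C P} {VR : List (Reason C P)} {A : Set (MAtom C P)}
    (h : Stable T VR A) : Avoids (theory T (hypOf T A)) VR := by
  refine ⟨fun I hI hA => h.consistent (.interp I hI (h.nas_notMem (Or.inl ⟨I, hI, rfl⟩) hA)),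
    fun I₁ I₂ hI h₁ h₂ => ?_⟩
  have i₁ : (I₁, idt (.pairId₁ I₁ I₂)) ∈ reasonIds VR := Or.inr ⟨I₁, I₂, hI, Or.inl rfl⟩
  have i₂ : (I₂, idt (.pairId₂ I₁ I₂)) ∈ reasonIds VR := Or.inr ⟨I₁, I₂, hI, Or.inr rfl⟩
  rw [← levelDom_iff (hypOf_subset T A) h₁ h₂,
    ← h.dom_iff (Or.inr (Or.inr ⟨I₁, I₂, hI, rfl⟩)) (h.weightSum_vs i₁) (h.weightSum_vs i₂)]
  by_contra hn
  exact h.consistent (.pair I₁ I₂ hI (h.nas_notMem i₁ h₁) (h.nas_notMem i₂ h₂) hn)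

end LOAS

/-! ## Answer sets of the meta programs from hypotheses -/

namespace ASP

universe u v w

variable {F : Type u} {V : Type v} {P : Type w}

/-- The least set that is closed under the positive rules `D`, apart from those with head `⊥`. -/
def leastClosed (D : Set (Option (Atom F V P) × List (Atom F V P))) : Set (Atom F V P) :=
  {a | ∀ M, (∀ b, Derives D M (some b) → b ∈ M) → a ∈ M}

theorem leastClosed_subset {D : Set (Option (Atom F V P) × List (Atom F V P))}
    {M : Set (Atom F V P)} (hM : ∀ b, Derives D M (some b) → b ∈ M) : leastClosed D ⊆ M :=
  fun _ ha => ha M hM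

theorem mem_leastClosed_of_derives {D : Set (Option (Atom F V P) × List (Atom F V P))}
    {a : Atom F V P} (h : Derives D (leastClosed D) (some a)) : a ∈ leastClosed D :=
  fun _ hM => hM a (h.mono subset_rfl (leastClosed_subset hM))

/-- The atoms mmr(a, t) compute this least closed set even when the interpretation is not an answer
set, with `⊥` recorded separately; both ways to fail the criterion are therefore visible to nas. -/
theorem mem_answerSets_iff_leastClosed {Q : Set (Rule F V P)} (hQ : ∀ r ∈ Q, r.IsSafe)
    {I : Set (Atom F V P)} :
    I ∈ answerSets Q ↔
      leastClosed (fullReduct Q I) = I ∧ ¬ Derives (fullReduct Q I) I none := by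
  rw [mem_answerSets_iff hQ]
  constructor
  · rintro ⟨h1, h2, h3⟩
    exact ⟨(leastClosed_subset h1).antisymm (h3 _ fun _ => mem_leastClosed_of_derives), h2⟩
  · rintro ⟨h1, h2⟩
    refine ⟨fun a ha => ?_, h2, fun M hM => h1.symm.subset.trans (leastClosed_subset hM)⟩
    rw [← h1]
    refine mem_leastClosed_of_derives ?_
    rwa [h1]

end ASP

namespace LOAS

open ASP

universe u v

variable {C : Type u} {P : Type v}

/-- The atoms of the answer set of the meta program that represents the hypothesis `H` and the
interpretations `f t`. -/
def CanonHolds (T : Task C P) (VR : List (Reason C P)) (H : Finset (ORule C P))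
    (f : MTerm C P → Set (OAtom C P)) : MetaPred → List (MTerm C P) → Prop
  | .inAs, [y, t] => t ∈ asIds T ∧ ∃ a ∈ f t, y = ofAtom a
  | .as, [t] => t ∈ asIds T
  | .inH, [y] => ∃ r ∈ H, y = idt (.ruleId r)
  | .cov, [t] => ∃ e, (e, t) ∈ covers T
  | .w, [W, L, X, t] => (t ∈ asIds T ∨ ∃ I, (I, t) ∈ reasonIds VR) ∧
      ∃ p, WeakDerives (theory T H) (f t) (f t) p ∧
        (⟨.w, [W, L, X, t]⟩ : MAtom C P) = weightAtom p t
  | .vi, [] => ∃ e ∈ T.neg, Extends (f (idt .negId)) e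
  | .vp, [t₁, t₂] => ∃ o ∈ T.cautious, t₁ = idt (.posId o.1) ∧ t₂ = idt (.posId o.2) ∧
      ¬ LevelDom T (theory T H) (f t₁) (f t₂)
  | .vp, [] => ∃ o ∈ T.cautious,
      ¬ LevelDom T (theory T H) (f (idt (.posId o.1))) (f (idt (.posId o.2)))
  | .violating, [] => (∃ e ∈ T.neg, Extends (f (idt .negId)) e) ∨ ∃ o ∈ T.cautious,
      ¬ LevelDom T (theory T H) (f (idt (.posId o.1))) (f (idt (.posId o.2)))
  | .dom, [t₁, t₂] => (t₁, t₂) ∈ comparisons T VR ∧ LevelDom T (theory T H) (f t₁) (f t₂)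
  | .domLv, [t₁, t₂, L] => (t₁, t₂) ∈ comparisons T VR ∧ ∃ l ∈ taskLevels T, L = .int l ∧
      activeSum (theory T H) (f t₁) l < activeSum (theory T H) (f t₂) l
  | .nonDomLv, [t₁, t₂, L] => (t₁, t₂) ∈ comparisons T VR ∧ ∃ l ∈ taskLevels T, L = .int l ∧
      activeSum (theory T H) (f t₂) l < activeSum (theory T H) (f t₁) l
  | .nonBef, [t₁, t₂, L] => (t₁, t₂) ∈ comparisons T VR ∧ ∃ l ∈ taskLevels T, L = .int l ∧
      ∃ m ∈ taskLevels T, l < m ∧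
        activeSum (theory T H) (f t₂) m < activeSum (theory T H) (f t₁) m
  | .lv, [L] => ∃ l ∈ taskLevels T, L = .int l
  | .mmr, [y, t] => (∃ I, (I, t) ∈ reasonIds VR) ∧
      ((∃ a ∈ leastClosed (fullReduct (theory T H) (f t)), y = ofAtom a) ∨
        (y = idt .bot ∧ Derives (fullReduct (theory T H) (f t))
          (leastClosed (fullReduct (theory T H) (f t))) none))
  | .inVs, [y, t] => (∃ I, (I, t) ∈ reasonIds VR) ∧ ∃ a ∈ f t, y = ofAtom a
  | .vs, [t] => ∃ I, (I, t) ∈ reasonIds VR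
  | .nas, [t] => (∃ I, (I, t) ∈ reasonIds VR) ∧ f t ∉ answerSets (theory T H)
  | _, _ => False

/-- The answer set with the atoms `CanonHolds`. -/
def canon (T : Task C P) (VR : List (Reason C P)) (H : Finset (ORule C P))
    (f : MTerm C P → Set (OAtom C P)) : Set (MAtom C P) :=
  {x | CanonHolds T VR H f x.pred x.args}

/-- The interpretations `f t` witness that the hypothesis `H` satisfies the constraints of the meta
program. -/
structure Witnesses (T : Task C P) (VR : List (Reason C P)) (H : Finset (ORule C P))
    (f : MTerm C P → Set (OAtom C P)) : Prop where
  subset : H ⊆ T.space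
  mem_answerSets : ∀ t ∈ asIds T, f t ∈ answerSets (theory T H)
  covers : ∀ e t, (e, t) ∈ covers T → Extends (f t) e
  brave : ∀ o ∈ T.brave, Dominates (theory T H) (f (idt (.ordId₁ o))) (f (idt (.ordId₂ o)))
  reasons : ∀ I t, (I, t) ∈ reasonIds VR → f t = I
  avoids : Avoids (theory T H) VR

section

variable {T : Task C P} {VR : List (Reason C P)} {H : Finset (ORule C P)}
  {f : MTerm C P → Set (OAtom C P)}

theorem slice_inAs_canon {t : MTerm C P} (ht : t ∈ asIds T) :
    slice .inAs (canon T VR H f) t = f t := by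
  ext a
  refine ⟨?_, fun ha => ⟨ht, a, ha, rfl⟩⟩
  rintro ⟨-, a', ha', h⟩
  rwa [ofAtom_injective h]

theorem slice_inVs_canon {t : MTerm C P} (ht : ∃ I, (I, t) ∈ reasonIds VR) :
    slice .inVs (canon T VR H f) t = f t := by
  ext a
  refine ⟨?_, fun ha => ⟨ht, a, ha, rfl⟩⟩
  rintro ⟨-, a', ha', h⟩
  rwa [ofAtom_injective h]

theorem slice_mmr_canon {t : MTerm C P} (ht : ∃ I, (I, t) ∈ reasonIds VR) :
    slice .mmr (canon T VR H f) t = leastClosed (fullReduct (theory T H) (f t)) := by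
  ext a
  refine ⟨?_, fun ha => ⟨ht, Or.inl ⟨a, ha, rfl⟩⟩⟩
  rintro ⟨-, ⟨a', ha', h⟩ | ⟨h, -⟩⟩
  · rwa [ofAtom_injective h]
  · simp [ofAtom, idt] at h

theorem inH_mem_canon {r : ORule C P} : inH r ∈ canon T VR H f ↔ r ∈ H := by
  refine ⟨?_, fun hr => ⟨r, hr, rfl⟩⟩
  rintro ⟨r', hr', h⟩
  simp only [idt, Term.app.injEq, MetaFn.ruleId.injEq, and_true] at h
  rwa [h]

theorem hypOf_canon (hH : H ⊆ T.space) : hypOf T (canon T VR H f) = H := by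
  ext r
  rw [mem_hypOf, inH_mem_canon]
  exact ⟨fun h => h.2, fun h => ⟨hH h, h⟩⟩

theorem ids_of_mem_comparisons {t₁ t₂ : MTerm C P} (h : (t₁, t₂) ∈ comparisons T VR) :
    (t₁ ∈ asIds T ∨ ∃ I, (I, t₁) ∈ reasonIds VR) ∧
      (t₂ ∈ asIds T ∨ ∃ I, (I, t₂) ∈ reasonIds VR) := by
  rcases h with ⟨o, ho, h⟩ | ⟨o, ho, h⟩ | ⟨I₁, I₂, hI, h⟩ <;> rw [Prod.mk.injEq] at h <;>
    obtain ⟨rfl, rfl⟩ := h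
  · exact ⟨Or.inl (Or.inr (Or.inr ⟨o, ho, Or.inl rfl⟩)),
      Or.inl (Or.inr (Or.inr ⟨o, ho, Or.inr rfl⟩))⟩
  · exact ⟨Or.inl (Or.inl ⟨_, (T.cautious_over_pos o ho).1, rfl⟩),
      Or.inl (Or.inl ⟨_, (T.cautious_over_pos o ho).2, rfl⟩)⟩
  · exact ⟨Or.inr ⟨I₁, Or.inr ⟨I₁, I₂, hI, Or.inl rfl⟩⟩,
      Or.inr ⟨I₂, Or.inr ⟨I₁, I₂, hI, Or.inr rfl⟩⟩⟩

/-- Compared identifiers always belong to an interpretation for which w-atoms are generated, so the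
side condition in `canon` is harmless. -/
theorem weightSum_canon {t₁ t₂ : MTerm C P} (h : (t₁, t₂) ∈ comparisons T VR) (l : ℤ) :
    weightSum (canon T VR H f) t₁ (.int l) = activeSum (theory T H) (f t₁) l ∧
    weightSum (canon T VR H f) t₂ (.int l) = activeSum (theory T H) (f t₂) l := by
  obtain ⟨h₁, h₂⟩ := ids_of_mem_comparisons h
  obtain ⟨g₁, g₂, rfl, rfl⟩ := exists_idt_of_mem_comparisons h
  exact ⟨weightSum_eq_activeSum (fun W L X => Iff.intro (fun h => And.right h)
      fun h => And.intro h₁ h) l,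
    weightSum_eq_activeSum (fun W L X => Iff.intro (fun h => And.right h)
      fun h => And.intro h₂ h) l⟩

namespace Witnesses

theorem prog_canon (h : Witnesses T VR H f) : prog T (canon T VR H f) = theory T H := by
  rw [prog_eq_theory, hypOf_canon h.subset]

theorem canon_closed (h : Witnesses T VR H f) {x : MAtom C P}
    (hx : Step T VR (canon T VR H f) (canon T VR H f) (some x)) : x ∈ canon T VR H f := by
  have hsafe := theory_isSafe h.subset
  cases hx with
  | inAs t a h1 h2 =>
    have ht : t ∈ asIds T := h2
    rw [h.prog_canon, slice_inAs_canon ht] at h1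
    exact ⟨ht, a, ((mem_answerSets_iff hsafe).1 (h.mem_answerSets t ht)).1 a h1, rfl⟩
  | weightAs t p h1 h2 =>
    have ht : t ∈ asIds T := h2
    rw [h.prog_canon, slice_inAs_canon ht] at h1
    exact ⟨Or.inl ht, p, h1, rfl⟩
  | hyp r h1 h2 => exact h2
  | as t ht => exact ht
  | cov e t h1 h2 h3 => exact ⟨e, h1⟩
  | vi e h1 h2 h3 =>
    have ht : idt .negId ∈ asIds T := Or.inr (Or.inl ⟨⟨e, h1⟩, rfl⟩)
    refine ⟨e, h1, ?_⟩
    rw [← slice_inAs_canon (VR := VR) (H := H) (f := f) ht]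
    exact ⟨h2, h3⟩
  | violatingVi h1 => exact Or.inl h1
  | violatingVp h1 => exact Or.inr h1
  | vp o h1 h2 =>
    exact ⟨o, h1, rfl, rfl, fun hd => h2 ⟨Or.inr (Or.inl ⟨o, h1, rfl⟩), hd⟩⟩
  | vpNil t₁ t₂ h1 =>
    obtain ⟨o, ho, rfl, rfl, hd⟩ := h1
    exact ⟨o, ho, hd⟩
  | lv l hl => exact ⟨l, hl, rfl⟩
  | domLv t₁ t₂ L h1 h2 h3 =>
    obtain ⟨l, hl, rfl⟩ := h2
    rw [(weightSum_canon h1 l).1, (weightSum_canon h1 l).2] at h3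
    exact ⟨h1, l, hl, rfl, h3⟩
  | nonDomLv t₁ t₂ L h1 h2 h3 =>
    obtain ⟨l, hl, rfl⟩ := h2
    rw [(weightSum_canon h1 l).1, (weightSum_canon h1 l).2] at h3
    exact ⟨h1, l, hl, rfl, h3⟩
  | nonBef t₁ t₂ l m h1 h2 h3 h4 h5 =>
    obtain ⟨l', hl', hl⟩ := h2
    obtain ⟨-, m', hm', hm, hlt⟩ := h4
    cases hl
    cases hm
    exact ⟨h1, l, hl', rfl, m, hm', h5, hlt⟩
  | dom t₁ t₂ L h1 h2 h3 =>
    obtain ⟨-, l, hl, rfl, hlt⟩ := h2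
    exact ⟨h1, l, hl, hlt, fun hm => h3 ⟨h1, l, hl, rfl, hm⟩⟩
  | vs I t h1 => exact ⟨I, h1⟩
  | inVs I t a h1 h2 => exact ⟨⟨I, h1⟩, a, (h.reasons I t h1).symm ▸ h2, rfl⟩
  | mmr t a h1 h2 =>
    have ht : ∃ I, (I, t) ∈ reasonIds VR := h2
    rw [h.prog_canon, slice_inVs_canon ht, slice_mmr_canon ht] at h1
    exact ⟨ht, Or.inl ⟨a, mem_leastClosed_of_derives h1, rfl⟩⟩
  | mmrBot t h1 h2 =>
    have ht : ∃ I, (I, t) ∈ reasonIds VR := h2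
    rw [h.prog_canon, slice_inVs_canon ht, slice_mmr_canon ht] at h1
    exact ⟨ht, Or.inr ⟨rfl, h1⟩⟩
  | weightVs t p h1 h2 =>
    have ht : ∃ I, (I, t) ∈ reasonIds VR := h2
    rw [h.prog_canon, slice_inVs_canon ht] at h1
    exact ⟨Or.inr ht, p, h1, rfl⟩
  | nasInVs y t h1 h2 =>
    obtain ⟨ht, a, ha, rfl⟩ := h1
    refine ⟨ht, fun hA => h2 ⟨ht, Or.inl ⟨a, ?_, rfl⟩⟩⟩
    -- For an answer set the recomputed closure is the interpretation itself, so an element of it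
    -- cannot lack its mmr atom.
    rwa [((mem_answerSets_iff_leastClosed hsafe).1 hA).1]
  | nasMmr y t h1 h2 =>
    obtain ⟨ht, hy⟩ := h1
    refine ⟨ht, fun hA => ?_⟩
    obtain ⟨e1, e2⟩ := (mem_answerSets_iff_leastClosed hsafe).1 hA
    rw [e1] at hy
    rcases hy with ⟨a, ha, rfl⟩ | ⟨-, hd⟩
    · exact h2 ⟨ht, a, ha, rfl⟩
    · exact e2 hd

theorem canon_consistent (h : Witnesses T VR H f) :
    ¬ Step T VR (canon T VR H f) (canon T VR H f) none := by
  intro hx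
  cases hx with
  | hard t h1 h2 =>
    have ht : t ∈ asIds T := h2
    rw [h.prog_canon, slice_inAs_canon ht] at h1
    exact ((mem_answerSets_iff (theory_isSafe h.subset)).1 (h.mem_answerSets t ht)).2.1 h1
  | uncovered e t h1 h2 => exact h2 ⟨e, h1⟩
  | brave o h1 h2 =>
    refine h2 ⟨Or.inl ⟨o, h1, rfl⟩, (levelDom_iff h.subset ?_ ?_).2 (h.brave o h1)⟩
    · exact h.mem_answerSets _ (Or.inr (Or.inr ⟨o, h1, Or.inl rfl⟩))
    · exact h.mem_answerSets _ (Or.inr (Or.inr ⟨o, h1, Or.inr rfl⟩))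
  | interp I h1 h2 =>
    have hI : (I, idt (.interpId I)) ∈ reasonIds VR := Or.inl ⟨I, h1, rfl⟩
    refine h2 ⟨⟨I, hI⟩, ?_⟩
    rw [h.reasons _ _ hI]
    exact h.avoids.1 I h1
  | pair I₁ I₂ h1 h2 h3 h4 =>
    have i₁ : (I₁, idt (.pairId₁ I₁ I₂)) ∈ reasonIds VR := Or.inr ⟨I₁, I₂, h1, Or.inl rfl⟩
    have i₂ : (I₂, idt (.pairId₂ I₁ I₂)) ∈ reasonIds VR := Or.inr ⟨I₁, I₂, h1, Or.inr rfl⟩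
    have a₁ : I₁ ∈ answerSets (theory T H) := by
      by_contra hn
      exact h2 ⟨⟨I₁, i₁⟩, by rwa [h.reasons _ _ i₁]⟩
    have a₂ : I₂ ∈ answerSets (theory T H) := by
      by_contra hn
      exact h3 ⟨⟨I₂, i₂⟩, by rwa [h.reasons _ _ i₂]⟩
    refine h4 ⟨Or.inr (Or.inr ⟨I₁, I₂, h1, rfl⟩), ?_⟩
    rw [h.reasons _ _ i₁, h.reasons _ _ i₂, levelDom_iff h.subset a₁ a₂]
    exact h.avoids.2 I₁ I₂ h1 a₁ a₂

/-- The atoms of `canon` are derived in the order of dependency: facts and the chosen rules, then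
in_as by minimality of each answer set `f t` and mmr by minimality of the closure, then weights,
comparisons and violations. -/
theorem canon_least (h : Witnesses T VR H f) {M : Set (MAtom C P)}
    (hM : ∀ a, Step T VR (canon T VR H f) M (some a) → a ∈ M) : canon T VR H f ⊆ M := by
  have hsafe := theory_isSafe h.subset
  have has : ∀ t ∈ asIds T, (⟨.as, [t]⟩ : MAtom C P) ∈ M := fun t ht => hM _ (.as t ht)
  have hvs : ∀ t, (∃ I, (I, t) ∈ reasonIds VR) → (⟨.vs, [t]⟩ : MAtom C P) ∈ M :=
    fun t ⟨I, hI⟩ => hM _ (.vs I t hI)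
  have hlv : ∀ l ∈ taskLevels T, (⟨.lv, [.int l]⟩ : MAtom C P) ∈ M :=
    fun l hl => hM _ (.lv l hl)
  have hinH : ∀ r ∈ H, inH r ∈ M :=
    fun r hr => hM _ (.hyp r (h.subset hr) (inH_mem_canon.2 hr))
  have hprog : theory T H ⊆ prog T M := by
    rintro r (hr | hr)
    · exact Or.inl hr
    · exact Or.inr ⟨h.subset hr, hinH r hr⟩
  have hinVs : ∀ t, (∃ I, (I, t) ∈ reasonIds VR) → f t ⊆ slice .inVs M t := by
    rintro t ⟨I, hI⟩ a ha
    rw [h.reasons I t hI] at ha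
    exact hM _ (.inVs I t a hI ha)
  have hinAs : ∀ t ∈ asIds T, f t ⊆ slice .inAs M t := by
    intro t ht
    refine ((mem_answerSets_iff hsafe).1 (h.mem_answerSets t ht)).2.2 _ fun a ha => ?_
    refine hM _ (.inAs t a ?_ (has t ht))
    rw [slice_inAs_canon ht]
    exact ha.mono (fullReduct_mono hprog _) subset_rfl
  have hmmr : ∀ t, (∃ I, (I, t) ∈ reasonIds VR) →
      leastClosed (fullReduct (theory T H) (f t)) ⊆ slice .mmr M t := by
    intro t ht
    refine leastClosed_subset fun a ha => ?_
    refine hM _ (.mmr t a ?_ (hvs t ht))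
    rw [slice_inVs_canon ht]
    exact ha.mono (fullReduct_mono hprog _) subset_rfl
  have hvi : ∀ e ∈ T.neg, Extends (f (idt .negId)) e → (⟨.vi, []⟩ : MAtom C P) ∈ M := by
    intro e he hex
    have ht : idt .negId ∈ asIds T := Or.inr (Or.inl ⟨⟨e, he⟩, rfl⟩)
    refine hM _ (.vi e he (fun a ha => hinAs _ ht (hex.1 a ha)) fun a ha h' => ?_)
    have : a ∈ slice .inAs (canon T VR H f) (idt .negId) := h'
    rw [slice_inAs_canon ht] at this
    exact hex.2 a ha this
  have hvp : ∀ o ∈ T.cautious,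
      ¬ LevelDom T (theory T H) (f (idt (.posId o.1))) (f (idt (.posId o.2))) →
      (⟨.vp, [idt (.posId o.1), idt (.posId o.2)]⟩ : MAtom C P) ∈ M :=
    fun o ho hn => hM _ (.vp o ho fun h' => hn h'.2)
  have hndl : ∀ t₁ t₂, (t₁, t₂) ∈ comparisons T VR → ∀ l ∈ taskLevels T,
      activeSum (theory T H) (f t₂) l < activeSum (theory T H) (f t₁) l →
      (⟨.nonDomLv, [t₁, t₂, .int l]⟩ : MAtom C P) ∈ M := by
    intro t₁ t₂ hc l hl hlt
    refine hM _ (.nonDomLv t₁ t₂ _ hc (hlv l hl) ?_)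
    rwa [(weightSum_canon hc l).1, (weightSum_canon hc l).2]
  have hdl : ∀ t₁ t₂, (t₁, t₂) ∈ comparisons T VR → ∀ l ∈ taskLevels T,
      activeSum (theory T H) (f t₁) l < activeSum (theory T H) (f t₂) l →
      (⟨.domLv, [t₁, t₂, .int l]⟩ : MAtom C P) ∈ M := by
    intro t₁ t₂ hc l hl hlt
    refine hM _ (.domLv t₁ t₂ _ hc (hlv l hl) ?_)
    rwa [(weightSum_canon hc l).1, (weightSum_canon hc l).2]
  rintro ⟨p, args⟩ hx
  simp only [canon, Set.mem_ofPred_eq] at hx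
  unfold CanonHolds at hx
  split at hx
  · obtain ⟨ht, a, ha, rfl⟩ := hx
    exact hinAs _ ht ha
  · exact has _ hx
  · obtain ⟨r, hr, rfl⟩ := hx
    exact hinH r hr
  · rename_i t
    obtain ⟨e, he⟩ := hx
    have ht := mem_asIds_of_mem_covers he
    have hex := h.covers e t he
    refine hM _ (.cov e t he (fun a ha => hinAs t ht (hex.1 a ha)) fun a ha h' => ?_)
    have : a ∈ slice .inAs (canon T VR H f) t := h'
    rw [slice_inAs_canon ht] at this
    exact hex.2 a ha this
  · obtain ⟨ht, p, hp, he⟩ := hx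
    rw [he]
    rcases ht with ht | ht
    · refine hM _ (.weightAs _ p ?_ (has _ ht))
      rw [slice_inAs_canon ht]
      exact hp.mono hprog (hinAs _ ht)
    · refine hM _ (.weightVs _ p ?_ (hvs _ ht))
      rw [slice_inVs_canon ht]
      exact hp.mono hprog (hinVs _ ht)
  · obtain ⟨e, he, hex⟩ := hx
    exact hvi e he hex
  · obtain ⟨o, ho, rfl, rfl, hn⟩ := hx
    exact hvp o ho hn
  · obtain ⟨o, ho, hn⟩ := hx
    exact hM _ (.vpNil _ _ (hvp o ho hn))
  · rcases hx with ⟨e, he, hex⟩ | ⟨o, ho, hn⟩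
    · exact hM _ (.violatingVi (hvi e he hex))
    · exact hM _ (.violatingVp (hM _ (.vpNil _ _ (hvp o ho hn))))
  · obtain ⟨hc, l, hl, hlt, hn⟩ := hx
    refine hM _ (.dom _ _ (.int l) hc (hdl _ _ hc l hl hlt) ?_)
    rintro ⟨-, l', hl', he, hm⟩
    cases he
    exact hn hm
  · obtain ⟨hc, l, hl, rfl, hlt⟩ := hx
    exact hdl _ _ hc l hl hlt
  · obtain ⟨hc, l, hl, rfl, hlt⟩ := hx
    exact hndl _ _ hc l hl hlt
  · obtain ⟨hc, l, hl, rfl, m, hm, hlm, hlt⟩ := hx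
    exact hM _ (.nonBef _ _ l m hc (hlv l hl) (hlv m hm) (hndl _ _ hc m hm hlt) hlm)
  · obtain ⟨l, hl, rfl⟩ := hx
    exact hlv l hl
  · obtain ⟨ht, ⟨a, ha, rfl⟩ | ⟨rfl, hd⟩⟩ := hx
    · exact hmmr _ ht ha
    · refine hM _ (.mmrBot _ ?_ (hvs _ ht))
      rw [slice_inVs_canon ht]
      exact hd.mono (fullReduct_mono hprog _) (hmmr _ ht)
  · obtain ⟨ht, a, ha, rfl⟩ := hx
    exact hinVs _ ht ha
  · exact hvs _ hx
  · rename_i t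
    obtain ⟨ht, hn⟩ := hx
    set D := fullReduct (theory T H) (f t) with hD
    -- There are three ways not to be an answer set: an unsupported element, a missing consequence,
    -- or the right closure with `⊥` derivable. The first gives nas through in_vs without mmr, the
    -- other two through mmr without in_vs.
    by_cases hsub : f t ⊆ leastClosed D
    · by_cases hsub' : leastClosed D ⊆ f t
      · have heq : leastClosed D = f t := hsub'.antisymm hsub
        have hd : Derives D (leastClosed D) none := by
          by_contra hd
          exact hn ((mem_answerSets_iff_leastClosed hsafe).2 ⟨heq, by rwa [heq] at hd⟩)
        refine hM _ (.nasMmr (idt .bot) t (hM _ (.mmrBot t ?_ (hvs t ht))) ?_)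
        · rw [slice_inVs_canon ht]
          exact hd.mono (fullReduct_mono hprog _) (hmmr t ht)
        · rintro ⟨-, a, -, he⟩
          simp [ofAtom, idt] at he
      · obtain ⟨a, ha, ha'⟩ := Set.not_subset.1 hsub'
        refine hM _ (.nasMmr (ofAtom a) t (hmmr t ht ha) ?_)
        rintro ⟨-, a', ha'', he⟩
        rw [ofAtom_injective he] at ha'
        exact ha' ha''
    · obtain ⟨a, ha, ha'⟩ := Set.not_subset.1 hsub
      refine hM _ (.nasInVs (ofAtom a) t (hinVs t ht ha) ?_)
      intro h'
      have : a ∈ slice .mmr (canon T VR H f) t := h'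
      rw [slice_mmr_canon ht] at this
      exact ha' this
  · exact hx.elim

theorem stable_canon (h : Witnesses T VR H f) : Stable T VR (canon T VR H f) :=
  ⟨fun _ => h.canon_closed, h.canon_consistent, fun _ _ => h.canon_least⟩

end Witnesses

end

end LOAS

/-! ## Correctness of ILASP2 -/

namespace LOAS

open ASP

universe u v

variable {C : Type u} {P : Type v}

/-! ### The optimality values of the meta programs. -/

theorem not_isWeak_of_mem_reductify {h : Head C ℕ P} {b : Body C ℕ P} {r : MRule C P}
    (hr : r ∈ reductify h b) : ∃ h' b', r = .strong h' b' := by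
  cases h with
  | atom a => exact ⟨_, _, hr⟩
  | bot => exact ⟨_, _, hr⟩
  | choice l hs u => rcases hr with ⟨a, -, rfl⟩ | rfl | rfl <;> exact ⟨_, _, rfl⟩

theorem strong_of_mem_cover {e : PartialInterp C P} {t : MTerm C P} {r : MRule C P}
    (hr : r ∈ cover e t) : ∃ h b, r = .strong h b := by
  rcases hr with rfl | rfl <;> exact ⟨_, _, rfl⟩

theorem strong_of_mem_dominates {t₁ t₂ : MTerm C P} {r : MRule C P}
    (hr : r ∈ dominates t₁ t₂) : ∃ h b, r = .strong h b := by
  rcases hr with rfl | rfl | rfl | rfl <;> exact ⟨_, _, rfl⟩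

theorem strong_of_mem_levelFacts {T : Task C P} {r : MRule C P}
    (hr : r ∈ levelFacts T) : ∃ h b, r = .strong h b := by
  obtain ⟨l, -, rfl⟩ := hr
  exact ⟨_, _, rfl⟩

theorem strong_of_mem_interpFacts {I : Set (OAtom C P)} {t : MTerm C P} {r : MRule C P}
    (hr : r ∈ interpFacts I t) : ∃ h b, r = .strong h b := by
  obtain ⟨l, -, rfl⟩ := hr
  exact ⟨_, _, rfl⟩

/-- The weak constraints of the meta programs. -/
theorem strong_or_weak_of_mem_metaProgram {T : Task C P} {VR : List (Reason C P)} {r : MRule C P}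
    (hr : r ∈ metaProgram T VR) : (∃ h b, r = .strong h b) ∨
      (∃ R ∈ T.space, r = .weak ⟨[inH R], [], []⟩ (.int (2 * R.length)) (.int 0)
        [idt (.ruleId R)]) ∨
      r = .weak ⟨[], [⟨.violating, []⟩], []⟩ (.int 1) (.int 0) [] := by
  rcases hr with (((((hr | hr) | hr) | hr) | hr) | hr) | ((hr | hr) | hr)
  · rcases hr with ⟨h, b, hr, rfl⟩ | ⟨b, wt, lev, ts, hr, rfl⟩ <;> exact Or.inl ⟨_, _, rfl⟩
  · rcases hr with ((⟨h, b, hr, rfl⟩ | ⟨b, wt, lev, ts, hr, rfl⟩) | ⟨R, hR, rfl⟩) | rfl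
    · exact Or.inl ⟨_, _, rfl⟩
    · exact Or.inl ⟨_, _, rfl⟩
    · exact Or.inr (Or.inl ⟨R, hR, rfl⟩)
    · exact Or.inl ⟨_, _, rfl⟩
  · obtain ⟨e, he, hr | rfl⟩ := hr
    · exact Or.inl (strong_of_mem_cover hr)
    · exact Or.inl ⟨_, _, rfl⟩
  · rcases hr with ⟨e, he, rfl | rfl⟩ | rfl | rfl
    · exact Or.inl ⟨_, _, rfl⟩
    · exact Or.inl ⟨_, _, rfl⟩
    · exact Or.inl ⟨_, _, rfl⟩
    · exact Or.inr (Or.inr rfl)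
  · rcases hr with ⟨o, ho, rfl | rfl | hr | hr | hr | rfl⟩ | hr
    · exact Or.inl ⟨_, _, rfl⟩
    · exact Or.inl ⟨_, _, rfl⟩
    · exact Or.inl (strong_of_mem_cover hr)
    · exact Or.inl (strong_of_mem_cover hr)
    · exact Or.inl (strong_of_mem_dominates hr)
    · exact Or.inl ⟨_, _, rfl⟩
    · exact Or.inl (strong_of_mem_levelFacts hr)
  · rcases hr with ⟨o, ho, hr | rfl⟩ | rfl | rfl
    · exact Or.inl (strong_of_mem_dominates hr)
    all_goals exact Or.inl ⟨_, _, rfl⟩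
  · obtain ⟨I, hI, hr | rfl | rfl⟩ := hr
    · exact Or.inl (strong_of_mem_interpFacts hr)
    all_goals exact Or.inl ⟨_, _, rfl⟩
  · obtain ⟨I₁, I₂, hI, hr | hr | hr | rfl | rfl | rfl⟩ := hr
    · exact Or.inl (strong_of_mem_dominates hr)
    · exact Or.inl (strong_of_mem_interpFacts hr)
    · exact Or.inl (strong_of_mem_interpFacts hr)
    all_goals exact Or.inl ⟨_, _, rfl⟩
  · rcases hr with ((((⟨h, b, hr, hr'⟩ | rfl | rfl) | ⟨h, b, hr, r', hr', rfl⟩) |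
      ⟨b, wt, lev, ts, hr, rfl⟩) | ⟨b, wt, lev, ts, hr, rfl⟩) | hr
    · exact Or.inl (not_isWeak_of_mem_reductify hr')
    · exact Or.inl ⟨_, _, rfl⟩
    · exact Or.inl ⟨_, _, rfl⟩
    · obtain ⟨h', b', rfl⟩ := not_isWeak_of_mem_reductify hr'
      exact Or.inl ⟨_, _, rfl⟩
    · exact Or.inl ⟨_, _, rfl⟩
    · exact Or.inl ⟨_, _, rfl⟩
    · exact Or.inl (strong_of_mem_levelFacts hr)

/-- The weak constraints of the task are translated into ordinary rules, so only the length
penalties and the penalty for not violating remain. -/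
theorem mem_weakTuples_metaProgram_iff {T : Task C P} {VR : List (Reason C P)}
    {A : Set (MAtom C P)} {p : ℤ × ℤ × List (MTerm C P)} :
    p ∈ weakTuples (metaProgram T VR) A ↔
      (∃ R ∈ hypOf T A, p = (2 * (R.length : ℤ), 0, [idt (.ruleId R)])) ∨
      ((⟨.violating, []⟩ : MAtom C P) ∉ A ∧ p = (1, 0, [])) := by
  obtain ⟨w, l, ts⟩ := p
  constructor
  · rintro ⟨b, ⟨r, hr, σ, -, hg⟩, hb⟩
    rcases strong_or_weak_of_mem_metaProgram hr with ⟨h', b', rfl⟩ | ⟨R, hR, rfl⟩ | rfl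
    · simp [Rule.subst] at hg
    · simp only [Rule.subst, Rule.weak.injEq, Term.subst_int, Term.int.injEq, List.map_cons,
        List.map_nil, idt_subst] at hg
      obtain ⟨rfl, rfl, rfl, rfl⟩ := hg
      refine Or.inl ⟨R, mem_hypOf.2 ⟨hR, ?_⟩, rfl⟩
      simpa using hb.1 (inH R) (by simp [Body.subst])
    · simp only [Rule.subst, Rule.weak.injEq, Term.subst_int, Term.int.injEq,
        List.map_nil] at hg
      obtain ⟨rfl, rfl, rfl, rfl⟩ := hg
      exact Or.inr ⟨hb.2.1 ⟨.violating, []⟩ (by simp [Body.subst, Atom.subst]), rfl⟩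
  · rintro (⟨R, hR, h⟩ | ⟨hA, h⟩) <;> cases h
    · obtain ⟨hR, hA⟩ := mem_hypOf.1 hR
      refine ⟨⟨[inH R], [], []⟩, ⟨_, Or.inl (Or.inl (Or.inl (Or.inl (Or.inl (Or.inr (Or.inl (Or.inr
        ⟨R, hR, rfl⟩))))))), fun _ => .int 0, ?_, ?_⟩, ?_⟩
      · simp [Rule.vars, Body.vars]
      · simp [Rule.subst, Body.subst]
      · simp [Body.Holds, hA]
    · refine ⟨⟨[], [⟨.violating, []⟩], []⟩, ⟨_, Or.inl (Or.inl (Or.inl (Or.inr (Or.inr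
        (Or.inr rfl))))), fun _ => .int 0, ?_, ?_⟩, ?_⟩
      · simp [Rule.vars, Body.vars, mem_vars_atom]
      · simp [Rule.subst, Body.subst, Atom.subst]
      · simp [Body.Holds, hA]

-- The identifier in each tuple keeps rules of equal length apart, and the tuple without terms
-- differs from all of them, so no penalties are merged. The factor 2 makes the parity record
-- violation without disturbing the order of lengths.
open Classical in
theorem levelSum_metaProgram_zero (T : Task C P) (VR : List (Reason C P)) (A : Set (MAtom C P)) :
    levelSum (metaProgram T VR) A 0 =
      2 * hypLength (hypOf T A) + if (⟨.violating, []⟩ : MAtom C P) ∈ A then 0 else 1 := by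
  let g : ORule C P → ℤ × ℤ × List (MTerm C P) :=
    fun R => (2 * (R.length : ℤ), 0, [idt (.ruleId R)])
  have hg : Function.Injective g := by
    intro R R' h
    have h' : R.length = R'.length ∧ R = R' := by simpa [g, idt] using h
    exact h'.2
  let S : Set (ℤ × ℤ × List (MTerm C P)) :=
    {p | (⟨.violating, []⟩ : MAtom C P) ∉ A ∧ p = (1, 0, [])}
  have hset : {p ∈ weakTuples (metaProgram T VR) A | p.2.1 = 0} =
      g '' (hypOf T A : Set (ORule C P)) ∪ S := by
    ext p
    simp only [Set.mem_ofPred_eq, mem_weakTuples_metaProgram_iff, Set.mem_union, Set.mem_image,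
      SetLike.mem_coe]
    constructor
    · rintro ⟨⟨R, hR, rfl⟩ | h, -⟩
      · exact Or.inl ⟨R, hR, rfl⟩
      · exact Or.inr h
    · rintro (⟨R, hR, rfl⟩ | ⟨h, rfl⟩)
      · exact ⟨Or.inl ⟨R, hR, rfl⟩, rfl⟩
      · exact ⟨Or.inr ⟨h, rfl⟩, rfl⟩
  have hS : S.Finite := (Set.finite_singleton (1, 0, [])).subset fun p hp => hp.2
  have hdisj : Disjoint (g '' (hypOf T A : Set (ORule C P))) S := by
    rw [Set.disjoint_left]
    rintro _ ⟨R, -, rfl⟩ ⟨-, h⟩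
    simp [g] at h
  rw [levelSum, hset, finsum_mem_union hdisj ((hypOf T A).finite_toSet.image g) hS,
    finsum_mem_image hg.injOn, finsum_mem_coe_finset]
  congr 1
  · simp [g, hypLength, Finset.mul_sum]
  · by_cases h : (⟨.violating, []⟩ : MAtom C P) ∈ A
    · have : S = ∅ := Set.eq_empty_of_forall_notMem fun p hp => hp.1 h
      rw [this, finsum_mem_empty, if_pos h]
    · have : S = {(1, 0, [])} := Set.ext fun p => ⟨fun hp => hp.2, fun hp => ⟨h, hp⟩⟩
      rw [this, finsum_mem_singleton, if_neg h]

theorem levelSum_metaProgram_of_ne_zero (T : Task C P) (VR : List (Reason C P))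
    (A : Set (MAtom C P)) {l : ℤ} (hl : l ≠ 0) : levelSum (metaProgram T VR) A l = 0 := by
  have : {p ∈ weakTuples (metaProgram T VR) A | p.2.1 = l} = ∅ := by
    refine Set.eq_empty_of_forall_notMem ?_
    rintro p ⟨hp, rfl⟩
    rcases mem_weakTuples_metaProgram_iff.1 hp with ⟨R, -, rfl⟩ | ⟨-, rfl⟩ <;> exact hl rfl
  rw [levelSum, this, finsum_mem_empty]

theorem dominates_metaProgram_iff {T : Task C P} {VR : List (Reason C P)}
    {A A' : Set (MAtom C P)} : Dominates (metaProgram T VR) A A' ↔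
      levelSum (metaProgram T VR) A 0 < levelSum (metaProgram T VR) A' 0 := by
  constructor
  · rintro ⟨l, hlt, -⟩
    by_cases hl : l = 0
    · rwa [hl] at hlt
    · rw [levelSum_metaProgram_of_ne_zero T VR A hl,
        levelSum_metaProgram_of_ne_zero T VR A' hl] at hlt
      exact absurd hlt (lt_irrefl _)
  · intro h
    refine ⟨0, h, fun m hm => ?_⟩
    rw [levelSum_metaProgram_of_ne_zero T VR A hm.ne',
      levelSum_metaProgram_of_ne_zero T VR A' hm.ne']

/-! ### Inductive solutions and answer sets of the meta programs. -/

theorem not_dominates_self {Q : Set (ORule C P)} (A : Set (OAtom C P)) : ¬ Dominates Q A A := by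
  rintro ⟨l, hl, -⟩
  exact lt_irrefl _ hl

/-- The interpretations assigned to the identifiers of the examples, the orderings and the
violating reasons. -/
def assign (g : PartialInterp C P → Set (OAtom C P)) (N : Set (OAtom C P))
    (p : PartialInterp C P × PartialInterp C P → Set (OAtom C P) × Set (OAtom C P)) :
    MTerm C P → Set (OAtom C P)
  | .app (.posId e) [] => g e
  | .app .negId [] => N
  | .app (.ordId₁ o) [] => (p o).1
  | .app (.ordId₂ o) [] => (p o).2
  | .app (.interpId I) [] => I
  | .app (.pairId₁ I₁ _) [] => I₁
  | .app (.pairId₂ _ I₂) [] => I₂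
  | _ => ∅

/-- The sets `(p o).1` and `(p o).2` witness that the ordering `o` is bravely respected. -/
def WitnessesBrave (T : Task C P) (H : Finset (ORule C P))
    (p : PartialInterp C P × PartialInterp C P → Set (OAtom C P) × Set (OAtom C P)) : Prop :=
  ∀ o ∈ T.brave, (p o).1 ∈ answerSets (theory T H) ∧ (p o).2 ∈ answerSets (theory T H) ∧
    Extends (p o).1 o.1 ∧ Extends (p o).2 o.2 ∧ Dominates (theory T H) (p o).1 (p o).2

/-- The sets `g e` witness that the positive examples are covered. -/
def WitnessesPos (T : Task C P) (H : Finset (ORule C P))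
    (g : PartialInterp C P → Set (OAtom C P)) : Prop :=
  ∀ e ∈ T.pos, g e ∈ answerSets (theory T H) ∧ Extends (g e) e

/-- The interpretations of the different identifiers can be chosen independently, since the
constraints tie together only the two members of a brave ordering. In particular a counterexample
can be inserted without changing the other choices. -/
theorem exists_stable {T : Task C P} {VR : List (Reason C P)} {H : Finset (ORule C P)}
    (hH : H ⊆ T.space) {g : PartialInterp C P → Set (OAtom C P)} {N : Set (OAtom C P)}
    {p : PartialInterp C P × PartialInterp C P → Set (OAtom C P) × Set (OAtom C P)}
    (hpos : WitnessesPos T H g) (hneg : T.neg.Nonempty → N ∈ answerSets (theory T H))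
    (hbrave : WitnessesBrave T H p) (hav : Avoids (theory T H) VR) :
    ∃ A, Stable T VR A ∧ hypOf T A = H ∧ ((⟨.violating, []⟩ : MAtom C P) ∈ A ↔
      (∃ e ∈ T.neg, Extends N e) ∨
        ∃ o ∈ T.cautious, ¬ Dominates (theory T H) (g o.1) (g o.2)) := by
  have hw : Witnesses T VR H (assign g N p) := by
    refine ⟨hH, ?_, ?_, fun o ho => (hbrave o ho).2.2.2.2, ?_, hav⟩
    · rintro t (⟨e, he, rfl⟩ | ⟨he, rfl⟩ | ⟨o, ho, rfl | rfl⟩)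
      · exact (hpos e he).1
      · exact hneg he
      · exact (hbrave o ho).1
      · exact (hbrave o ho).2.1
    · rintro e t (⟨q, hq, h⟩ | ⟨q, hq, h | h⟩) <;> rw [Prod.mk.injEq] at h <;>
        obtain ⟨rfl, rfl⟩ := h
      · exact (hpos e hq).2
      · exact (hbrave q hq).2.2.1
      · exact (hbrave q hq).2.2.2.1
    · rintro I t (⟨q, hq, h⟩ | ⟨I₁, I₂, hq, h | h⟩) <;> rw [Prod.mk.injEq] at h <;>
        obtain ⟨rfl, rfl⟩ := h <;> rfl
  refine ⟨_, hw.stable_canon, hypOf_canon hH, ?_⟩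
  rw [hw.stable_canon.violating_iff, hypOf_canon hH]
  refine or_congr ?_ ?_
  · refine exists_congr fun e => and_congr_right fun he => ?_
    rw [slice_inAs_canon (Or.inr (Or.inl ⟨⟨e, he⟩, rfl⟩))]
    rfl
  · refine exists_congr fun o => and_congr_right fun ho => ?_
    rw [slice_inAs_canon (Or.inl ⟨_, (T.cautious_over_pos o ho).1, rfl⟩),
      slice_inAs_canon (Or.inl ⟨_, (T.cautious_over_pos o ho).2, rfl⟩)]
    rfl

/-- Condition (1) refers to H without its weak constraints, while the meta program uses one theory
throughout. -/
theorem answerSets_nonWeak {T : Task C P} {H : Finset (ORule C P)} (hH : H ⊆ T.space) :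
    answerSets ((T.background : Set (ORule C P)) ∪ nonWeak (H : Set (ORule C P))) =
      answerSets (theory T H) := by
  refine answerSets_congr (fun r hr => ?_) (theory_isSafe hH) fun h b => ?_
  · exact theory_isSafe hH r (hr.imp_right fun h => h.1)
  · simp [theory, nonWeak, Rule.IsWeak]

/-- The violating reasons come from negative examples and cautious orderings. -/
def Justified (T : Task C P) (VR : List (Reason C P)) : Prop :=
  (∀ I, .interp I ∈ VR → ∃ e ∈ T.neg, Extends I e) ∧
    ∀ I₁ I₂, .pair I₁ I₂ ∈ VR → ∃ o ∈ T.cautious, Extends I₁ o.1 ∧ Extends I₂ o.2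

/-- Adding violating reasons never loses a solution: a stored interpretation extends a negative
example, so it is not an answer set for a solution, and a stored pair that consists of answer sets
must be ordered correctly by the cautious condition. -/
theorem exists_stable_of_isSolution {T : Task C P} (hE : T.neg.Nonempty → T.pos.Nonempty)
    {VR : List (Reason C P)} (hVR : Justified T VR) {H : Finset (ORule C P)}
    (hH : T.IsSolution H) :
    ∃ A, Stable T VR A ∧ hypOf T A = H ∧ (⟨.violating, []⟩ : MAtom C P) ∉ A := by
  obtain ⟨hsub, ⟨-, hpos, hneg⟩, hbrave, hcaut⟩ := hH
  rw [answerSets_nonWeak hsub] at hpos hneg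
  have hg : ∀ e, ∃ J, e ∈ T.pos → J ∈ answerSets (theory T H) ∧ Extends J e := fun e => by
    by_cases he : e ∈ T.pos
    · obtain ⟨J, h⟩ := hpos e he
      exact ⟨J, fun _ => h⟩
    · exact ⟨∅, fun h => absurd h he⟩
  choose g hg using hg
  have hp : ∀ o : PartialInterp C P × PartialInterp C P,
      ∃ q : Set (OAtom C P) × Set (OAtom C P), o ∈ T.brave →
      q.1 ∈ answerSets (theory T H) ∧ q.2 ∈ answerSets (theory T H) ∧
        Extends q.1 o.1 ∧ Extends q.2 o.2 ∧ Dominates (theory T H) q.1 q.2 := fun o => by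
    by_cases ho : o ∈ T.brave
    · obtain ⟨A₁, h₁, A₂, h₂, h⟩ := hbrave o ho
      exact ⟨(A₁, A₂), fun _ => ⟨h₁, h₂, h⟩⟩
    · exact ⟨(∅, ∅), fun h => absurd h ho⟩
  choose p hp using hp
  -- With negative examples present, as(n) needs some answer set; the one covering a positive
  -- example serves. Without them n is not used and the empty set is a dummy value.
  obtain ⟨N, hN⟩ : ∃ N, T.neg.Nonempty → N ∈ answerSets (theory T H) := by
    by_cases hn : T.neg.Nonempty
    · obtain ⟨e, he⟩ := hE hn
      exact ⟨g e, fun _ => (hg e he).1⟩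
    · exact ⟨∅, fun h => absurd h hn⟩
  have hav : Avoids (theory T H) VR := by
    refine ⟨fun I hI hA => ?_, fun I₁ I₂ hI h₁ h₂ => ?_⟩
    · obtain ⟨e, he, hex⟩ := hVR.1 I hI
      exact hneg e he ⟨I, hA, hex⟩
    · obtain ⟨o, ho, e₁, e₂⟩ := hVR.2 I₁ I₂ hI
      exact hcaut o ho I₁ h₁ I₂ h₂ e₁ e₂
  obtain ⟨A, hA, hAH, hv⟩ := exists_stable hsub (g := g) (fun e => hg e) hN (fun o => hp o) hav
  refine ⟨A, hA, hAH, fun h => ?_⟩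
  rcases hv.1 h with ⟨e, he, hex⟩ | ⟨o, ho, hn⟩
  · exact hneg e he ⟨N, hN ⟨e, he⟩, hex⟩
  · obtain ⟨h₁, e₁⟩ := hg _ (T.cautious_over_pos o ho).1
    obtain ⟨h₂, e₂⟩ := hg _ (T.cautious_over_pos o ho).2
    exact hn (hcaut o ho _ h₁ _ h₂ e₁ e₂)

theorem Stable.witnessesPos {T : Task C P} {VR : List (Reason C P)} {A : Set (MAtom C P)}
    (hA : Stable T VR A) :
    WitnessesPos T (hypOf T A) fun e => slice .inAs A (idt (.posId e)) :=
  fun e he => ⟨hA.slice_inAs_mem (Or.inl ⟨e, he, rfl⟩),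
    hA.extends_of_mem_covers (Or.inl ⟨e, he, rfl⟩)⟩

theorem Stable.witnessesBrave {T : Task C P} {VR : List (Reason C P)} {A : Set (MAtom C P)}
    (hA : Stable T VR A) : WitnessesBrave T (hypOf T A)
      fun o => (slice .inAs A (idt (.ordId₁ o)), slice .inAs A (idt (.ordId₂ o))) :=
  fun o ho => ⟨hA.slice_inAs_mem (Or.inr (Or.inr ⟨o, ho, Or.inl rfl⟩)),
    hA.slice_inAs_mem (Or.inr (Or.inr ⟨o, ho, Or.inr rfl⟩)),
    hA.extends_of_mem_covers (Or.inr ⟨o, ho, Or.inl rfl⟩),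
    hA.extends_of_mem_covers (Or.inr ⟨o, ho, Or.inr rfl⟩), hA.dominates_of_brave ho⟩

/-- A hypothesis that is represented by answer sets of the meta program, none of which is
violating, is an inductive solution. -/
theorem isSolution_of_stable {T : Task C P} {VR : List (Reason C P)} {A : Set (MAtom C P)}
    (hA : Stable T VR A) (hv : ∀ A', Stable T VR A' → hypOf T A' = hypOf T A →
      (⟨.violating, []⟩ : MAtom C P) ∉ A') : T.IsSolution (hypOf T A) := by
  classical
  have hsub := hypOf_subset T A
  refine ⟨hsub, ⟨fun r hr => ⟨hsub hr.1, hr.2⟩, ?_, ?_⟩, ?_, ?_⟩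
  · rw [answerSets_nonWeak hsub]
    exact fun e he => ⟨_, hA.witnessesPos e he⟩
  · rw [answerSets_nonWeak hsub]
    rintro e he ⟨J, hJ, hex⟩
    -- Keep all interpretations of `A` except that of n, which becomes the offending answer set `J`.
    obtain ⟨A', hA', hh, hiff⟩ :=
      exists_stable hsub hA.witnessesPos (fun _ => hJ) hA.witnessesBrave hA.avoids
    exact hv A' hA' hh (hiff.2 (Or.inl ⟨e, he, hex⟩))
  · intro o ho
    obtain ⟨h1, h2, h3⟩ := hA.witnessesBrave o ho
    exact ⟨_, h1, _, h2, h3⟩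
  · intro o ho A₁ h₁ A₂ h₂ e₁ e₂
    by_contra hn
    -- Let the two positive examples of the ordering be witnessed by the badly ordered pair; the
    -- other examples keep their witnesses.
    have hpos : WitnessesPos T (hypOf T A) (Function.update (Function.update
        (fun e => slice .inAs A (idt (.posId e))) o.1 A₁) o.2 A₂) := by
      intro e he
      by_cases he₂ : e = o.2
      · rw [he₂, Function.update_self]
        exact ⟨h₂, e₂⟩
      · rw [Function.update_of_ne he₂]
        by_cases he₁ : e = o.1
        · rw [he₁, Function.update_self]
          exact ⟨h₁, e₁⟩
        · rw [Function.update_of_ne he₁]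
          exact hA.witnessesPos e he
    obtain ⟨A', hA', hh, hiff⟩ := exists_stable hsub hpos (N := slice .inAs A (idt .negId))
      (fun hne => hA.slice_inAs_mem (Or.inr (Or.inl ⟨hne, rfl⟩))) hA.witnessesBrave hA.avoids
    refine hv A' hA' hh (hiff.2 (Or.inr ⟨o, ho, ?_⟩))
    -- If both components are the same example, the second update overrides the first and a single
    -- interpretation is compared with itself. The ordering is still violated, as nothing dominates
    -- itself.
    by_cases heq : o.1 = o.2
    · rw [heq]
      exact not_dominates_self _
    · rw [Function.update_self, Function.update_of_ne heq, Function.update_self]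
      exact hn

/-- The value returned when the loop is left is the set of optimal inductive solutions. -/
theorem hypOf_optimalAnswerSets_eq {T : Task C P} (hE : T.neg.Nonempty → T.pos.Nonempty)
    {VR : List (Reason C P)} (hg : GroundReasons VR) (hVR : Justified T VR)
    {s : Option (Set (MAtom C P) × ℤ)} (hs : Solve (metaProgram T VR) s) (hc : ¬ Continue s) :
    {H | ∃ A ∈ optimalAnswerSets (metaProgram T VR), H = hypOf T A} =
      {H | T.IsOptimalSolution H} := by
  have hAS : ∀ A, A ∈ answerSets (metaProgram T VR) ↔ Stable T VR A :=
    fun A => mem_answerSets_metaProgram_iff hg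
  cases s with
  | none =>
    have hs : answerSets (metaProgram T VR) = ∅ := hs
    ext H
    constructor
    · rintro ⟨A, hA, -⟩
      have := hA.1
      rw [hs] at this
      exact this.elim
    · rintro ⟨hH, -⟩
      obtain ⟨A, hA, -⟩ := exists_stable_of_isSolution hE hVR hH
      have := (hAS A).2 hA
      rw [hs] at this
      exact this.elim
  | some q =>
    obtain ⟨A₀, z⟩ := q
    obtain ⟨hA₀, rfl⟩ := hs
    have hodd : ¬ levelSum (metaProgram T VR) A₀ 0 % 2 = 0 := hc
    have hle : ∀ A, A ∈ optimalAnswerSets (metaProgram T VR) → ∀ A', Stable T VR A' →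
        levelSum (metaProgram T VR) A 0 ≤ levelSum (metaProgram T VR) A' 0 := by
      intro A hA A' hA'
      have := hA.2 A' ((hAS A').2 hA')
      rw [dominates_metaProgram_iff] at this
      exact not_lt.1 this
    have hsum : ∀ A, A ∈ optimalAnswerSets (metaProgram T VR) →
        (⟨.violating, []⟩ : MAtom C P) ∉ A ∧
          levelSum (metaProgram T VR) A 0 = 2 * hypLength (hypOf T A) + 1 := by
      intro A hA
      -- All optimal answer sets have the same value. Hence the odd value returned by `solve`
      -- excludes violation in every one of them.
      have heq := (hle A hA A₀ ((hAS A₀).1 hA₀.1)).antisymm (hle A₀ hA₀ A ((hAS A).1 hA.1))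
      rw [← heq] at hodd
      have h := levelSum_metaProgram_zero T VR A
      by_cases hv : (⟨.violating, []⟩ : MAtom C P) ∈ A
      · rw [if_pos hv] at h
        omega
      · rw [if_neg hv] at h
        exact ⟨hv, h⟩
    have hsol : ∀ A, A ∈ optimalAnswerSets (metaProgram T VR) → T.IsOptimalSolution (hypOf T A) := by
      intro A hA
      refine ⟨isSolution_of_stable ((hAS A).1 hA.1) fun A' hA' hh hv => ?_, fun H' hH' => ?_⟩
      -- A violating answer set for the same hypothesis would cost one less than the optimum.
      · have h := hle A hA A' hA'
        rw [(hsum A hA).2, levelSum_metaProgram_zero, if_pos hv, hh] at h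
        omega
      -- A solution H' is represented at cost 2|H'| + 1, which is at least the optimum 2|H| + 1.
      · obtain ⟨A', hA', hh, hv⟩ := exists_stable_of_isSolution hE hVR hH'
        have h := hle A hA A' hA'
        rw [(hsum A hA).2, levelSum_metaProgram_zero, if_neg hv, hh] at h
        omega
    ext H
    constructor
    · rintro ⟨A, hA, rfl⟩
      exact hsol A hA
    · rintro ⟨hH, hmin⟩
      obtain ⟨A, hA, rfl, hv⟩ := exists_stable_of_isSolution hE hVR hH
      refine ⟨A, ⟨(hAS A).2 hA, fun A' hA' => ?_⟩, rfl⟩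
      rw [dominates_metaProgram_iff, not_lt]
      -- The hypothesis of `A₀` is already known to be a solution, so an optimal solution is no
      -- longer than it and its representing answer set attains the minimum.
      refine le_trans ?_ (hle A₀ hA₀ A' ((hAS A').1 hA'))
      have h := hmin _ (hsol A₀ hA₀).1
      rw [(hsum A₀ hA₀).2, levelSum_metaProgram_zero, if_neg hv]
      omega

/-! ### The loop invariant and the final result. -/

theorem isGround_of_mem_slice {T : Task C P} {VR : List (Reason C P)} {A : Set (MAtom C P)}
    (hA : Stable T VR A) {t : MTerm C P} (ht : t ∈ asIds T) :
    ∀ a ∈ slice .inAs A t, a.IsGround :=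
  fun _ ha => isGround_of_mem_herbrandBase ((hA.slice_inAs_mem ht).1 ha)

/-- The body of the loop adds justified violating reasons. -/
theorem Update.invariant {T : Task C P} {VR VR' : List (Reason C P)} {A : Set (MAtom C P)}
    (hA : Stable T VR A) (hg : GroundReasons VR) (hVR : Justified T VR) (h : Update A VR VR') :
    GroundReasons VR' ∧ Justified T VR' := by
  cases h with
  | interp hvi =>
    obtain ⟨e, he, hex⟩ := hA.vi_iff.1 hvi
    have hgr := isGround_of_mem_slice hA (Or.inr (Or.inl ⟨⟨e, he⟩, rfl⟩))
    refine ⟨⟨fun I hI => ?_, fun I₁ I₂ hI => ?_⟩, ⟨fun I hI => ?_, fun I₁ I₂ hI => ?_⟩⟩ <;>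
      simp only [List.mem_append, List.mem_singleton, Reason.interp.injEq, reduceCtorEq,
        or_false] at hI
    · rcases hI with hI | rfl
      · exact hg.1 I hI
      · exact hgr
    · exact hg.2 I₁ I₂ hI
    · rcases hI with hI | rfl
      · exact hVR.1 I hI
      · exact ⟨e, he, hex⟩
    · exact hVR.2 I₁ I₂ hI
  | pair t₁ t₂ _ hvp =>
    -- The extracted identifiers can only be those of the positive examples of a cautious ordering,
    -- and their interpretations extend these examples by the cover constraints.
    obtain ⟨o, ho, rfl, rfl, -⟩ := hA.vp_iff.1 hvp
    have ho' := T.cautious_over_pos o ho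
    have hgr₁ := isGround_of_mem_slice hA (Or.inl ⟨_, ho'.1, rfl⟩)
    have hgr₂ := isGround_of_mem_slice hA (Or.inl ⟨_, ho'.2, rfl⟩)
    refine ⟨⟨fun I hI => ?_, fun I₁ I₂ hI => ?_⟩, ⟨fun I hI => ?_, fun I₁ I₂ hI => ?_⟩⟩ <;>
      simp only [List.mem_append, List.mem_singleton, Reason.pair.injEq, reduceCtorEq,
        or_false] at hI
    · exact hg.1 I hI
    · rcases hI with hI | ⟨rfl, rfl⟩
      · exact hg.2 I₁ I₂ hI
      · exact ⟨hgr₁, hgr₂⟩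
    · exact hVR.1 I hI
    · rcases hI with hI | ⟨rfl, rfl⟩
      · exact hVR.2 I₁ I₂ hI
      · exact ⟨o, ho, (hA.witnessesPos _ ho'.1).2, (hA.witnessesPos _ ho'.2).2⟩
  | skip => exact ⟨hg, hVR⟩

/-- A terminating run is a finite derivation of `Loop`, so induction carries the invariant to the
exit. Whether the list of reasons actually grows plays no role. -/
theorem Loop.eq_optimalSolutions {T : Task C P} (hE : T.neg.Nonempty → T.pos.Nonempty)
    {VR : List (Reason C P)} {s : Option (Set (MAtom C P) × ℤ)} {res : Set (Finset (ORule C P))}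
    (h : Loop T VR s res) (hg : GroundReasons VR) (hVR : Justified T VR)
    (hs : Solve (metaProgram T VR) s) : res = {H | T.IsOptimalSolution H} := by
  induction h with
  | exit VR s hc => exact hypOf_optimalAnswerSets_eq hE hg hVR hs hc
  | step VR VR' A z s res _ hu hs' _ ih =>
    obtain ⟨hg', hVR'⟩ := hu.invariant ((mem_answerSets_metaProgram_iff hg).1 hs.1.1) hg hVR
    exact ih hg' hVR' hs'

end LOAS

theorem mainTheorem1 {C : Type*} {P : Type*} (T : LOAS.Task C P)
    (hE : T.neg.Nonempty → T.pos.Nonempty)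
    (res : Set (Finset (LOAS.ORule C P))) (hres : LOAS.ILASP2 T res) :
    res = {H | T.IsOptimalSolution H} := by
  obtain ⟨s, hs, hloop⟩ := hres
  exact hloop.eq_optimalSolutions hE (by simp [LOAS.GroundReasons]) (by simp [LOAS.Justified]) hs
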